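/- Let $M$ be a smooth $n$-dimensional manifold, $n\ge 3$, $\alpha=\sqrt{a_{ij}(x)y^iy^j}$ a Riemannian metric and $\beta=b_i(x)y^i$ a nowhere vanishing $1$-form on $M$, $b=\|\beta\|_\alpha>0$, and let $F=\frac{(b\alpha+\beta)^2}{\alpha}$ be the corresponding singular square metric. Put $r_{ij}=\frac12(b_{i|j}+b_{j|i})$, $s_{ij}=\frac12(b_{i|j}-b_{j|i})$, $s_i=b^js_{ji}$, with covariant derivatives and raised indices taken with respect to $\alpha$; barred symbols denote the same objects for a pair $(\bar\alpha,\bar\beta)$. $F$ is a Douglas metric if in local coordinates its spray coefficients $G^i=\frac14g^{il}\{[F^2]_{x^ky^l}y^k-[F^2]_{x^l}\}$, $g_{ij}=[\frac12F^2]_{y^iy^j}$, have the form $G^i=\frac12\Gamma^i_{jk}(x)y^jy^k+P(x,y)y^i$ in all directions $y\neq0$ in which $(g_{ij})$ is nondegenerate, with $P$ positively homogeneous of degree one in $y$. For a function $\rho$ of $b^2$, smooth near the values of $b^2$, the deformation $\alpha\mapsto e^{\rho(b^2)}\alpha$, $\beta\mapsto e^{\rho(b^2)/2}\beta$ leaves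 $F$ and its form $\frac{(b\alpha+\beta)^2}{\alpha}$ unchanged ($b$ becoming the length of the new $1$-form); we say that $F$ can be reduced to one of the cases below if the resulting pair, for some such $\rho$, is of that kind. Assume that whenever functions $c,d$ on $M$ satisfy $$r_{ij}=c\,a_{ij}+d\,b_ib_j-\frac{3}{b^2}(s_ib_j+s_jb_i),\qquad s_{ij}=\frac1{b^2}(b_is_j-b_js_i),\tag{$*$}$$ the ratio $c:d$ depends only on $b$ (where $c$ and $d$ are not both zero). Then $F$ is a Douglas metric if and only if it can be reduced on $M$ to one of the following cases. (i) $\alpha=\sqrt{\bar\alpha^2+(\bar b^{-8}-\bar b^{-2})\bar\beta^2}$ and $\beta=\bar b^{-3}\bar\beta$, where the Riemannian metric $\bar\alpha$ and the $1$-form $\bar\beta$ satisfy, for some function $\bar\tau$, $$\bar r_{ij}=\bar\tau\,\bar a_{ij},\qquad \bar s_{ij}=\frac1{\bar b^2}(\bar b_i\bar s_j-\bar b_j\bar s_i).$$ In this case $\bar b=b$ and $$F=\frac{\Big(\sqrt{\bar b^6(\bar b^2\bar\alpha^2-\bar\beta^2)+\bar\beta^2}+\bar\beta\Big)^2}{\bar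 b^2\sqrt{\bar b^6(\bar b^2\bar\alpha^2-\bar\beta^2)+\bar\beta^2}}.$$ (ii) $\alpha=\bar b^{-3}\bar\alpha$ and $\beta=\bar b^{-3}\bar\beta$, where the Riemannian metric $\bar\alpha$ and the $1$-form $\bar\beta$ satisfy, for some function $\bar\tau$, $$\bar r_{ij}=\bar\tau(\bar b^2\bar a_{ij}-\bar b_i\bar b_j),\qquad \bar s_{ij}=\frac1{\bar b^2}(\bar b_i\bar s_j-\bar b_j\bar s_i).$$ In this case $\bar b=b$ and $$F=\frac{(\bar b\bar\alpha+\bar\beta)^2}{\bar b^3\bar\alpha}.$$ (In the equalities $\bar b=b$, $b$ is the length of the $1$-form of the reduced pair.) More precisely, if $F$ is a Douglas metric, then $(*)$ holds for some functions $c,d$; on the open set where $c+b^2d\neq0$, $F$ can be reduced to case (i), and on the interior of the set where $c+b^2d=0$ the given pair $(\alpha,\beta)$ itself is of the form (ii). -/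

import Mathlib

open scoped Manifold ContDiff Matrix

noncomputable section

namespace SingularSquare

/-- The coordinate space `ℝⁿ`. -/
abbrev Coord (n : ℕ) : Type := EuclideanSpace ℝ (Fin n)

/-- The `i`-th standard basis vector of `ℝⁿ`. -/
def stdVec {n : ℕ} (i : Fin n) : Coord n := EuclideanSpace.single i 1

/-- The partial derivative `∂f/∂xⁱ` at `p`. -/
def partialDeriv {n : ℕ} (i : Fin n) (f : Coord n → ℝ) (p : Coord n) : ℝ :=
  fderiv ℝ f p (stdVec i)

/-! ### Riemannian geometry in local coordinates

`A p = (a_ij(p))` is the matrix of a metric, `b p = (b_i(p))` the components of a `1`-form. -/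

/-- The Christoffel symbols `γ^i_jk` of `(a_ij)`. -/
def christoffel {n : ℕ} (A : Coord n → Matrix (Fin n) (Fin n) ℝ) (p : Coord n)
    (i j k : Fin n) : ℝ :=
  1 / 2 * ∑ l, (A p)⁻¹ i l *
    (partialDeriv j (fun q => A q l k) p + partialDeriv k (fun q => A q l j) p
      - partialDeriv l (fun q => A q j k) p)

/-- The covariant derivative `b_{i|j}` of a `1`-form. -/
def covDeriv {n : ℕ} (A : Coord n → Matrix (Fin n) (Fin n) ℝ) (b : Coord n → Fin n → ℝ)
    (p : Coord n) (i j : Fin n) : ℝ :=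
  partialDeriv j (fun q => b q i) p - ∑ k, christoffel A p k i j * b p k

/-- `r_ij = (b_{i|j} + b_{j|i}) / 2`. -/
def rTensor {n : ℕ} (A : Coord n → Matrix (Fin n) (Fin n) ℝ) (b : Coord n → Fin n → ℝ)
    (p : Coord n) (i j : Fin n) : ℝ :=
  1 / 2 * (covDeriv A b p i j + covDeriv A b p j i)

/-- `s_ij = (b_{i|j} - b_{j|i}) / 2`. -/
def sTensor {n : ℕ} (A : Coord n → Matrix (Fin n) (Fin n) ℝ) (b : Coord n → Fin n → ℝ)
    (p : Coord n) (i j : Fin n) : ℝ :=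
  1 / 2 * (covDeriv A b p i j - covDeriv A b p j i)

/-- `s_i = b^j s_ji`, where `b^j = a^{jk} b_k`. -/
def sForm {n : ℕ} (A : Coord n → Matrix (Fin n) (Fin n) ℝ) (b : Coord n → Fin n → ℝ)
    (p : Coord n) (i : Fin n) : ℝ :=
  ∑ j, (∑ k, (A p)⁻¹ j k * b p k) * sTensor A b p j i

/-! ### Sprays in local coordinates

`F p v` is a Finsler function in local coordinates, `p` the position and `v` the direction. -/

/-- The fundamental tensor `g_ij = [F²/2]_{yⁱyʲ}`. -/
def fundTensor {n : ℕ} (F : Coord n → Coord n → ℝ) (p v : Coord n) :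
    Matrix (Fin n) (Fin n) ℝ :=
  Matrix.of fun i j =>
    1 / 2 * partialDeriv i (fun w => partialDeriv j (fun u => F p u ^ 2) w) v

/-- The spray coefficients `Gⁱ = g^{il} ([F²]_{xᵏyˡ} yᵏ - [F²]_{xˡ}) / 4`. -/
def sprayCoeff {n : ℕ} (F : Coord n → Coord n → ℝ) (p v : Coord n) (i : Fin n) : ℝ :=
  1 / 4 * ∑ l, (fundTensor F p v)⁻¹ i l *
    ((∑ k, partialDeriv k (fun q => partialDeriv l (fun u => F q u ^ 2) v) p * v k)
      - partialDeriv l (fun q => F q v ^ 2) p)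

/-! ### Fields on a manifold -/

section Manifold

variable {n : ℕ} {M : Type*} [TopologicalSpace M] [ChartedSpace (Coord n) M]

variable (n M) in
/-- Fields of bilinear forms on the tangent spaces. -/
abbrev BilinField : Type _ :=
  ∀ x : M, TangentSpace (𝓡 n) x →L[ℝ] TangentSpace (𝓡 n) x →L[ℝ] ℝ

variable (n M) in
/-- Fields of linear forms on the tangent spaces (`1`-forms). -/
abbrev OneForm : Type _ := ∀ x : M, TangentSpace (𝓡 n) x →L[ℝ] ℝ

/-- The tangent vector `vⁱ ∂/∂xⁱ` at the point with coordinates `p` in the chart `φ`. -/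
def coordVec (φ : OpenPartialHomeomorph M (Coord n)) (p v : Coord n) :
    TangentSpace (𝓡 n) (φ.symm p) :=
  mfderiv (𝓡 n) (𝓡 n) φ.symm p v

/-- The components `a_ij` in the chart `φ`. -/
def metricComp (φ : OpenPartialHomeomorph M (Coord n)) (a : BilinField n M) (p : Coord n) :
    Matrix (Fin n) (Fin n) ℝ :=
  Matrix.of fun i j => a (φ.symm p) (coordVec φ p (stdVec i)) (coordVec φ p (stdVec j))

/-- The components `b_i` in the chart `φ`. -/
def formComp (φ : OpenPartialHomeomorph M (Coord n)) (β : OneForm n M) (p : Coord n)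
    (i : Fin n) : ℝ :=
  β (φ.symm p) (coordVec φ p (stdVec i))

/-- The expression of a function `F` on the tangent bundle in the chart `φ`. -/
def finslerComp (φ : OpenPartialHomeomorph M (Coord n))
    (F : ∀ x : M, TangentSpace (𝓡 n) x → ℝ) (p v : Coord n) : ℝ :=
  F (φ.symm p) (coordVec φ p v)

/-- `a` is a smooth Riemannian metric on `U`. -/
structure IsRiemannianOn (U : Set M) (a : BilinField n M) : Prop where
  symm : ∀ x ∈ U, ∀ v w, a x v w = a x w v
  pos : ∀ x ∈ U, ∀ v, v ≠ 0 → 0 < a x v v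
  smooth : ∀ φ ∈ IsManifold.maximalAtlas (𝓡 n) ∞ M, ∀ i j,
    ContDiffOn ℝ ∞ (fun p => metricComp φ a p i j) (φ.target ∩ φ.symm ⁻¹' U)

/-- `β` is a smooth `1`-form on `U`. -/
def IsSmoothFormOn (U : Set M) (β : OneForm n M) : Prop :=
  ∀ φ ∈ IsManifold.maximalAtlas (𝓡 n) ∞ M, ∀ i,
    ContDiffOn ℝ ∞ (fun p => formComp φ β p i) (φ.target ∩ φ.symm ⁻¹' U)

/-- The standard basis of `T_xM`, which is modelled on `ℝⁿ`. -/
def tangentBasis (x : M) (i : Fin n) : TangentSpace (𝓡 n) x := (stdVec i : Coord n)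

/-- `b² = ‖β‖²_α = a^{ij} b_i b_j` at `x`.  The value does not depend on the basis of `T_xM` in
which it is computed; here the standard one is used. -/
def normSq (a : BilinField n M) (β : OneForm n M) (x : M) : ℝ :=
  ∑ i, ∑ j,
    (Matrix.of fun k l : Fin n => a x (tangentBasis x k) (tangentBasis x l))⁻¹ i j
      * β x (tangentBasis x i) * β x (tangentBasis x j)

/-- `b`, the length of `β` with respect to `α`. -/
def len (a : BilinField n M) (β : OneForm n M) (x : M) : ℝ := √(normSq a β x)

/-- `α(y) = √(a_ij yⁱ yʲ)`. -/
def alpha (a : BilinField n M) (x : M) (y : TangentSpace (𝓡 n) x) : ℝ := √(a x y y)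

/-- The singular square metric `F = (bα + β)² / α`. -/
def singSquare (a : BilinField n M) (β : OneForm n M) (x : M) (y : TangentSpace (𝓡 n) x) : ℝ :=
  (len a β x * alpha a x y + β x y) ^ 2 / alpha a x y

/-- `F`, a function that is smooth off the zero section, is a Douglas metric: in all local
coordinates `Gⁱ = Γ^i_jk(x) yʲ yᵏ / 2 + P(x, y) yⁱ`, with `P` positively homogeneous of degree one
in `y`.  The spray is defined at the nonzero directions at which `(g_ij)` is nondegenerate. -/
def IsDouglas (F : ∀ x : M, TangentSpace (𝓡 n) x → ℝ) : Prop :=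
  ∀ φ ∈ IsManifold.maximalAtlas (𝓡 n) ∞ M,
    ∃ (Γ : Coord n → Fin n → Fin n → Fin n → ℝ) (P : Coord n → Coord n → ℝ),
      (∀ p ∈ φ.target, ∀ v, ∀ t : ℝ, 0 < t → P p (t • v) = t * P p v) ∧
      ∀ p ∈ φ.target, ∀ v : Coord n, v ≠ 0 → (fundTensor (finslerComp φ F) p v).det ≠ 0 →
        ∀ i, sprayCoeff (finslerComp φ F) p v i
          = 1 / 2 * (∑ j, ∑ k, Γ p i j k * v j * v k) + P p v * v i

/-- `r_ij = R_ij` on `U`, where the right-hand side is built from `x`, `a_ij`, `b_i` and `s_i`. -/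
def REqOn (U : Set M) (a : BilinField n M) (β : OneForm n M)
    (R : M → Matrix (Fin n) (Fin n) ℝ → (Fin n → ℝ) → (Fin n → ℝ) → Fin n → Fin n → ℝ) : Prop :=
  ∀ φ ∈ IsManifold.maximalAtlas (𝓡 n) ∞ M, ∀ p ∈ φ.target, φ.symm p ∈ U → ∀ i j,
    rTensor (metricComp φ a) (formComp φ β) p i j
      = R (φ.symm p) (metricComp φ a p) (formComp φ β p)
          (sForm (metricComp φ a) (formComp φ β) p) i j

/-- `r_ij = c a_ij + d b_i b_j - (3 / b²) (s_i b_j + s_j b_i)` on `U`. -/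
def StructureEqOn (U : Set M) (a : BilinField n M) (β : OneForm n M) (c d : M → ℝ) : Prop :=
  REqOn U a β fun x A b s i j =>
    c x * A i j + d x * (b i * b j) - 3 / normSq a β x * (s i * b j + s j * b i)

/-- `r_ij = τ a_ij` on `U`. -/
def ConformalOn (U : Set M) (a : BilinField n M) (β : OneForm n M) (τ : M → ℝ) : Prop :=
  REqOn U a β fun x A _ _ i j => τ x * A i j

/-- `r_ij = τ (b² a_ij - b_i b_j)` on `U`. -/
def TransverseConformalOn (U : Set M) (a : BilinField n M) (β : OneForm n M) (τ : M → ℝ) : Prop :=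
  REqOn U a β fun x A b _ i j => τ x * (normSq a β x * A i j - b i * b j)

/-- `s_ij = (b_i s_j - b_j s_i) / b²` on `U`. -/
def SkewEqOn (U : Set M) (a : BilinField n M) (β : OneForm n M) : Prop :=
  ∀ φ ∈ IsManifold.maximalAtlas (𝓡 n) ∞ M, ∀ p ∈ φ.target, φ.symm p ∈ U → ∀ i j,
    sTensor (metricComp φ a) (formComp φ β) p i j
      = 1 / normSq a β (φ.symm p) *
        (formComp φ β p i * sForm (metricComp φ a) (formComp φ β) p j
          - formComp φ β p j * sForm (metricComp φ a) (formComp φ β) p i)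

/-- The ratio `c : d` depends only on `b`: it is the same at any two points at which `b` is the
same (a point with `c = d = 0` has no ratio, and imposes nothing). -/
def RatioDependsOnlyOnLen (a : BilinField n M) (β : OneForm n M) (c d : M → ℝ) : Prop :=
  ∀ x y, len a β x = len a β y → c x * d y = c y * d x

/-- The metric `a'_ij` of the `β`-deformation `α' = e^{ρ(b²)} α`, `β' = e^{ρ(b²)/2} β`.  These are
the `β`-deformations with `κ = 0` and `ν = e^{ρ/2}`, which preserve `F = (bα + β)² / α`. -/
def deformMetric (ρ : ℝ → ℝ) (a : BilinField n M) (β : OneForm n M) : BilinField n M :=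
  fun x => Real.exp (2 * ρ (normSq a β x)) • a x

/-- The `1`-form `β' = e^{ρ(b²)/2} β` of the same `β`-deformation. -/
def deformForm (ρ : ℝ → ℝ) (a : BilinField n M) (β : OneForm n M) : OneForm n M :=
  fun x => Real.exp (ρ (normSq a β x) / 2) • β x

/-- `ρ` is smooth on a neighbourhood of the values of `b²` on `U`. -/
def IsDeformFactorOn (U : Set M) (a : BilinField n M) (β : OneForm n M) (ρ : ℝ → ℝ) : Prop :=
  ∃ J : Set ℝ, IsOpen J ∧ (∀ x ∈ U, normSq a β x ∈ J) ∧ ContDiffOn ℝ ∞ ρ J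

/-- On `U`, `α = √(ᾱ² + (b̄⁻⁸ - b̄⁻²) β̄²)` and `β = b̄⁻³ β̄`, where the Riemannian metric `ᾱ` and
the `1`-form `β̄` satisfy `r̄_ij = τ̄ ā_ij` and `s̄_ij = (b̄_i s̄_j - b̄_j s̄_i) / b̄²`. -/
structure IsCaseI (U : Set M) (a : BilinField n M) (β : OneForm n M)
    (a' : BilinField n M) (β' : OneForm n M) (τ : M → ℝ) : Prop where
  riemannian : IsRiemannianOn U a'
  smooth : IsSmoothFormOn U β'
  alpha_eq : ∀ x ∈ U, ∀ y, alpha a x y =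
    √(alpha a' x y ^ 2 + (len a' β' x ^ (-8 : ℤ) - len a' β' x ^ (-2 : ℤ)) * β' x y ^ 2)
  beta_eq : ∀ x ∈ U, ∀ y, β x y = len a' β' x ^ (-3 : ℤ) * β' x y
  r_eq : ConformalOn U a' β' τ
  s_eq : SkewEqOn U a' β'

/-- On `U`, `α = b̄⁻³ ᾱ` and `β = b̄⁻³ β̄`, where the Riemannian metric `ᾱ` and the `1`-form `β̄`
satisfy `r̄_ij = τ̄ (b̄² ā_ij - b̄_i b̄_j)` and `s̄_ij = (b̄_i s̄_j - b̄_j s̄_i) / b̄²`. -/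
structure IsCaseII (U : Set M) (a : BilinField n M) (β : OneForm n M)
    (a' : BilinField n M) (β' : OneForm n M) (τ : M → ℝ) : Prop where
  riemannian : IsRiemannianOn U a'
  smooth : IsSmoothFormOn U β'
  alpha_eq : ∀ x ∈ U, ∀ y, alpha a x y = len a' β' x ^ (-3 : ℤ) * alpha a' x y
  beta_eq : ∀ x ∈ U, ∀ y, β x y = len a' β' x ^ (-3 : ℤ) * β' x y
  r_eq : TransverseConformalOn U a' β' τ
  s_eq : SkewEqOn U a' β'

/-- On `U`, the metric `F = (bα + β)² / α` can be reduced to case (i): this form of `F` holds for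
a pair obtained from `(α, β)` by a form-preserving `β`-deformation. -/
def ReducesToCaseI (U : Set M) (a : BilinField n M) (β : OneForm n M) : Prop :=
  ∃ ρ, IsDeformFactorOn U a β ρ ∧ ∃ a' β' τ,
    IsCaseI U (deformMetric ρ a β) (deformForm ρ a β) a' β' τ

/-- On `U`, the metric `F = (bα + β)² / α` can be reduced to case (ii). -/
def ReducesToCaseII (U : Set M) (a : BilinField n M) (β : OneForm n M) : Prop :=
  ∃ ρ, IsDeformFactorOn U a β ρ ∧ ∃ a' β' τ,
    IsCaseII U (deformMetric ρ a β) (deformForm ρ a β) a' β' τ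

end Manifold

end SingularSquare

end

/-! The metric `F` sees less than the pair `(α, β)`: replacing `(α, β)` by `(b²α, bβ)` is one of the
deformations that preserve `F`, and the new `1`-form `θ` has length one. So `F = (α + θ)²/α` with
`‖θ‖ = 1`, and everything reduces to one fact: `F` is Douglas if and only if `θ` is closed and
`θ_{i|j} = c (a_ij - θ_i θ_j)` for a function `c`.

For sufficiency the spray is written down (`isDouglasAt_of_conformal`). For necessity
(`conformal_of_isDouglasAt`), the spray equation is contracted with `w`, and its instance `w = v` is
used to eliminate `P`. What remains is an identity in `v` containing a quadratic map `q(v, v)`.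
Comparing `v` with `-v` isolates `√(a(v,v))` and kills the skew part; unit length then gives `r(X,
·) = 0` for the dual vector `X`; expanding along `v = tX + z` with `z ⊥ X` determines `r` on `X^⊥`
up to a factor (`skew_eq_zero_and_exists_conformal`).

Both directions of the main theorem then change pairs. As `2 r_ij` is the Lie derivative of the
metric along the dual field, `r_ij` and `s_ij` of a pair `(f a + k θ⊗θ, g θ)` follow from Leibniz'
rule (`rTensor_pairChange`, `sTensor_pairChange`). Write `X` for the field dual to the unit form,
and `b` for the original length. Applied to the given pair this yields the structure equations, with
`c + b²d = b² X(b)` for the coefficients `c, d` of the theorem.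

The unit pair itself is of form (ii) with `b̄ = 1`, so a Douglas metric reduces to (ii) on all of
`M`. Where `X(b) = 0` on an open set, the given pair is already of form (ii). Where `X(b) ≠ 0`, form
(i) needs a new length `B` with `X(B) = B c/3`, `c` now being the conformal factor. Seeking `B =
e^{Φ(b)}` leads to `Φ'(b) = c / (3 X(b))`; the ratio hypothesis says precisely that the right side
is a function of `b`, and it is smooth since `b` is a submersion there. Conversely, normalizing a
pair of form (i) or (ii) gives a closed conformal unit form (`isDouglas_unitSquare_unitized`). -/

noncomputable section

namespace SingularSquare

/-! ### Pointwise linear algebra of the Douglas condition -/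

section Algebra

variable {V : Type*} [AddCommGroup V] [Module ℝ V]

/-- A bilinear form `T` on `X^⊥` for which orthogonal vectors are also `T`-orthogonal is a multiple
of the inner product on the diagonal. -/
theorem exists_diag_eq_of_orthogonal (B T : LinearMap.BilinForm ℝ V)
    (hs : ∀ u w, B u w = B w u) (hpos : ∀ v, v ≠ 0 → 0 < B v v) (X : V)
    (hT : ∀ z w, B X z = 0 → B X w = 0 → B z w = 0 → T z w = 0) :
    ∃ c, ∀ z, B X z = 0 → T z z = c * B z z := by
  by_cases h : ∃ z, B X z = 0 ∧ z ≠ 0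
  · obtain ⟨z₀, h0, hz₀⟩ := h
    have hp := hpos z₀ hz₀
    -- For `z ⊥ z₀` the vectors `z₀ + z` and `|z|² z₀ - |z₀|² z` are orthogonal; expanding `T` on
    -- them compares `T z z` with `T z₀ z₀`.
    have orth : ∀ z, B X z = 0 → B z₀ z = 0 → T z z = T z₀ z₀ / B z₀ z₀ * B z z := by
      intro z hz hzz
      have hzz' : B z z₀ = 0 := by rw [hs]; exact hzz
      have h1 := hT z₀ z h0 hz hzz
      have h2 := hT z z₀ hz h0 hzz'
      have h3 := hT (z₀ + z) (B z z • z₀ - B z₀ z₀ • z) (by simp [h0, hz]) (by simp [h0, hz])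
        (by simp [hzz, hzz']; ring)
      simp [h1, h2] at h3
      field_simp
      linarith
    refine ⟨T z₀ z₀ / B z₀ z₀, fun z hz => ?_⟩
    set m := B z₀ z / B z₀ z₀ with hm
    have e : B z₀ (z - m • z₀) = 0 := by simp [hm]; field_simp; ring
    have e' : B (z - m • z₀) z₀ = 0 := by rw [hs]; exact e
    have ex : B X (z - m • z₀) = 0 := by simp [h0, hz]
    have h1 := hT z₀ _ h0 ex e
    have h2 := hT _ z₀ ex h0 e'
    have h3 := orth _ ex e
    have hd : z = m • z₀ + (z - m • z₀) := by abel
    rw [hd]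
    generalize z - m • z₀ = y at *
    simp [h1, h2, e, e', h3]
    field_simp
  · push Not at h
    refine ⟨0, fun z hz => ?_⟩
    simp [h z hz]

theorem skew_eq_zero_and_exists_conformal (B S R : LinearMap.BilinForm ℝ V) (q : V →ₗ[ℝ] V →ₗ[ℝ] V)
    (hs : ∀ u w, B u w = B w u) (hpos : ∀ v, v ≠ 0 → 0 < B v v) (X : V) (hX : B X X = 1)
    (hS : ∀ u w, S u w = - S w u) (hR : ∀ u w, R u w = R w u)
    (hRX : ∀ w, R X w + S X w = 0)
    (H : ∀ v, (B X v) ^ 2 < B v v → ∀ w,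
      (B v v * B X w - B X v * B v w) * (B v v * (R v v - 2 * B X (q v v)) + 2 * B X v * B (q v v) v)
        + 2 * (√(B v v) + B X v) * B v v ^ 2 * S w v
      = (B v v - B X v ^ 2) * (B v v * B (q v v) w - B (q v v) v * B v w)) :
    (∀ u w, S u w = 0) ∧ ∃ c, ∀ u w, R u w = c * (B u w - B X u * B X w) := by
  -- All terms are even in `v` except those with `S`: the difference of the instances at `v` and
  -- `-v` retains only `√(B v v)` times `S w v`.
  have S1 : ∀ v, (B X v) ^ 2 < B v v → ∀ w, S w v = 0 := by
    intro v hv w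
    have h1 := H v hv w
    have h2 := H (-v) (by simpa using hv) w
    simp only [map_neg, LinearMap.neg_apply, neg_neg] at h2
    have hvv : 0 < B v v := lt_of_le_of_lt (sq_nonneg _) hv
    have : √(B v v) * B v v ^ 2 * S w v = 0 := by linear_combination (h1 - h2) / 4
    have h3 : √(B v v) ≠ 0 := (Real.sqrt_pos.2 hvv).ne'
    simpa [h3, hvv.ne'] using this
  have S0 : ∀ u w, S u w = 0 := by
    have S2 : ∀ z, B X z = 0 → ∀ w, S w z = 0 := by
      intro z hz w
      by_cases h : z = 0
      · simp [h]
      · exact S1 z (by simpa [hz] using hpos z h) w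
    -- The vector `X` itself violates the strict Cauchy–Schwarz inequality, so it is reached through
    -- skew-symmetry.
    have SX : ∀ w, S w X = 0 := by
      intro w
      have h1 := S2 (w - B X w • X) (by simp [hX]) X
      have h2 : S X X = 0 := by linarith [hS X X]
      simp [h2] at h1
      rw [hS, h1, neg_zero]
    intro u w
    have h1 := S2 (w - B X w • X) (by simp [hX]) u
    simpa [SX] using h1
  refine ⟨S0, ?_⟩
  have RX : ∀ w, R X w = 0 := fun w => by simpa [S0] using hRX w
  -- the condition at `v = t X + z`
  have key : ∀ z, z ≠ 0 → B X z = 0 → ∀ t : ℝ, ∀ w,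
      ((t ^ 2 + B z z) * B X w - t * B (t • X + z) w) *
        ((t ^ 2 + B z z) * (R z z - 2 * B X (q (t • X + z) (t • X + z)))
          + 2 * t * B (q (t • X + z) (t • X + z)) (t • X + z))
      = B z z * ((t ^ 2 + B z z) * B (q (t • X + z) (t • X + z)) w
          - B (q (t • X + z) (t • X + z)) (t • X + z) * B (t • X + z) w) := by
    intro z hz hXz t w
    have hzX : B z X = 0 := by rw [hs]; exact hXz
    have e1 : B (t • X + z) (t • X + z) = t ^ 2 + B z z := by
      simp [hX, hXz, hzX]; ring
    have e2 : B X (t • X + z) = t := by simp [hX, hXz]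
    have e3 : R (t • X + z) (t • X + z) = R z z := by
      simp [RX, hR z X]
    have := H (t • X + z) (by rw [e1, e2]; linarith [hpos z hz]) w
    rw [e1, e2, e3, S0] at this
    linear_combination this
  have sq : ∀ (z : V) (t : ℝ), q (t • X + z) (t • X + z) = t ^ 2 • q X X + t • (q X z + q z X) + q z z := by
    intro z t
    simp only [map_add, map_smul, LinearMap.add_apply, LinearMap.smul_apply]
    module
  -- For `w` orthogonal to `X` and `z` only `B (q v v) w` survives in the condition, so it vanishes
  -- for every `t ≠ 0`; the difference between `t = 1` and `t = -1` is the part linear in `t`.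
  have perp : ∀ z w, B X z = 0 → B X w = 0 → B z w = 0 → B (q X z + q z X) w = 0 := by
    intro z w hz hw hzw
    by_cases h : z = 0
    · simp [h]
    have k : ∀ t : ℝ, t ≠ 0 → B (q (t • X + z) (t • X + z)) w = 0 := by
      intro t _
      have := key z h hz t w
      have e : B (t • X + z) w = 0 := by simp [hw, hzw]
      rw [e, hw] at this
      have hp := hpos z h
      have : B z z * (t ^ 2 + B z z) * B (q (t • X + z) (t • X + z)) w = 0 := by
        linear_combination -this
      have h2 : t ^ 2 + B z z ≠ 0 := by positivity
      simpa [hp.ne', h2] using this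
    have k1 := k 1 one_ne_zero
    have k2 := k (-1) (by norm_num)
    rw [sq] at k1 k2
    simp only [map_add, map_smul, LinearMap.add_apply, LinearMap.smul_apply, smul_eq_mul] at k1 k2 ⊢
    linarith
  obtain ⟨l, hl⟩ := exists_diag_eq_of_orthogonal B
    (LinearMap.mk₂ ℝ (fun z w => B (q X z + q z X) w) (by intros; simp; ring) (by intros; simp; ring)
      (by intros; simp; ring) (by intros; simp)) hs hpos X (by simpa using perp)
  simp only [LinearMap.mk₂_apply] at hl
  -- Taking `w = X` gives a polynomial identity in `t`. The second difference over `t = 1, 0, -1`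
  -- extracts its `t²` coefficient, which contains `q X z + q z X` only through `l`.
  have diag : ∀ z, B X z = 0 → R z z = 3 * (B X (q X X) - l) * B z z := by
    intro z hz
    by_cases h : z = 0
    · simp [h]
    have hp := hpos z h
    have hzX : B z X = 0 := by rw [hs]; exact hz
    have k : ∀ t : ℝ, (t ^ 2 + B z z) * R z z
        = 3 * (B z z * B (q (t • X + z) (t • X + z)) X - t * B (q (t • X + z) (t • X + z)) z) := by
      intro t
      have := key z h hz t X
      have e : B (t • X + z) X = t := by simp [hX, hzX]
      have e3 : B (q (t • X + z) (t • X + z)) (t • X + z)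
        = t * B (q (t • X + z) (t • X + z)) X + B (q (t • X + z) (t • X + z)) z := by
        rw [map_add, map_smul, smul_eq_mul]
      rw [e, e3, hs X (q _ _), hX] at this
      have : B z z * ((t ^ 2 + B z z) * R z z
        - 3 * (B z z * B (q (t • X + z) (t • X + z)) X - t * B (q (t • X + z) (t • X + z)) z)) = 0 := by
        linear_combination this
      rcases mul_eq_zero.1 this with h' | h'
      · exact absurd h' hp.ne'
      · linarith
    have k1 := k 1
    have k2 := k (-1)
    have k0 := k 0
    have hl := hl z hz
    rw [sq] at k1 k2 k0
    simp only [map_add, map_smul, LinearMap.add_apply, LinearMap.smul_apply, smul_eq_mul] at k1 k2 k0 hl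
    rw [hs X]
    linear_combination (k1 + k2 - 2 * k0) / 2 - 3 * hl
  have full : ∀ v, R v v = 3 * (B X (q X X) - l) * (B v v - B X v * B X v) := by
    intro v
    have := diag (v - B X v • X) (by simp [hX])
    simp [RX, hR v X, hX, hs v X] at this
    linear_combination this
  refine ⟨3 * (B X (q X X) - l), fun u w => ?_⟩
  have h1 := full (u + w)
  have h2 := full u
  have h3 := full w
  simp only [map_add, LinearMap.add_apply] at h1
  rw [hR w u, hs w u] at h1
  linear_combination (h1 - h2 - h3) / 2

/-- Elimination of the factor `P` from the spray equation: the second hypothesis is the first one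
in the direction of `v`. -/
theorem eliminate_projective_factor {α o r P Aqv Aqw Avw bq bw s : ℝ} (hα : 0 < α) (ho : α + o ≠ 0)
    (hw : 4 * (2 * o ^ 2 - α * o) * (Aqv + P * α ^ 2) * Avw
      + 4 * α ^ 2 * (α - 2 * o) * ((Aqv + P * α ^ 2) * bw + (bq + P * o) * Avw)
      + 12 * α ^ 4 * (bq + P * o) * bw + 2 * α ^ 2 * (α ^ 2 - o ^ 2) * (Aqw + P * Avw)
      = r * (2 * α ^ 2 * (α - 2 * o) * Avw + 6 * α ^ 4 * bw) + 4 * (α + o) * α ^ 4 * s)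
    (hv : 4 * (2 * o ^ 2 - α * o) * (Aqv + P * α ^ 2) * α ^ 2
      + 4 * α ^ 2 * (α - 2 * o) * ((Aqv + P * α ^ 2) * o + (bq + P * o) * α ^ 2)
      + 12 * α ^ 4 * (bq + P * o) * o + 2 * α ^ 2 * (α ^ 2 - o ^ 2) * (Aqv + P * α ^ 2)
      = r * (2 * α ^ 2 * (α - 2 * o) * α ^ 2 + 6 * α ^ 4 * o)) :
    (α ^ 2 * bw - o * Avw) * (α ^ 2 * (r - 2 * bq) + 2 * o * Aqv) + 2 * (α + o) * α ^ 4 * s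
      = (α ^ 2 - o ^ 2) * (α ^ 2 * Aqw - Aqv * Avw) := by
  -- The equation in direction `v` is linear in `P`, with the common factor `2 α² (α + o)`.
  have hP : P * (α ^ 2 * (α + o)) = α ^ 2 * r - (α - o) * Aqv - 2 * α ^ 2 * bq := by
    have : 2 * α ^ 2 * (α + o) *
        (P * (α ^ 2 * (α + o)) - (α ^ 2 * r - (α - o) * Aqv - 2 * α ^ 2 * bq)) = 0 := by
      linear_combination hv
    have h0 : 2 * α ^ 2 * (α + o) ≠ 0 := by positivity
    rcases mul_eq_zero.1 this with h | h
    · exact absurd h h0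
    · linarith
  linear_combination (-1 / 2) * hw + ((α - o) * Avw + 2 * α ^ 2 * bw) * hP

end Algebra

/-! ### Calculus of partial derivatives -/

section Partials

variable {n : ℕ}

/-- `f` is differentiable at `p` with partial derivatives `d`. -/
def HasPartials (f : Coord n → ℝ) (d : Fin n → ℝ) (p : Coord n) : Prop :=
  HasFDerivAt f (∑ i, d i • (EuclideanSpace.proj i : Coord n →L[ℝ] ℝ)) p

theorem clm_eq_sum (L : Coord n →L[ℝ] ℝ) :
    L = ∑ i, L (stdVec i) • (EuclideanSpace.proj i : Coord n →L[ℝ] ℝ) := by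
  ext v
  have hv : v = ∑ i, v i • (stdVec i : Coord n) := by
    ext j
    simp [stdVec, Pi.single_apply]
  conv_lhs => rw [hv]
  simp [mul_comm]

theorem HasPartials.of_hasFDerivAt {f : Coord n → ℝ} {L : Coord n →L[ℝ] ℝ} {p : Coord n}
    (h : HasFDerivAt f L p) : HasPartials f (fun i => L (stdVec i)) p := by
  unfold HasPartials
  rwa [← clm_eq_sum]

theorem HasPartials.of_differentiableAt {f : Coord n → ℝ} {p : Coord n}
    (h : DifferentiableAt ℝ f p) : HasPartials f (fun i => partialDeriv i f p) p :=
  HasPartials.of_hasFDerivAt h.hasFDerivAt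

namespace HasPartials

variable {f g : Coord n → ℝ} {d e : Fin n → ℝ} {p : Coord n}

theorem partialDeriv_eq (h : HasPartials f d p) (i : Fin n) : partialDeriv i f p = d i := by
  unfold partialDeriv
  rw [HasFDerivAt.fderiv h]
  simp [stdVec]

theorem differentiableAt (h : HasPartials f d p) : DifferentiableAt ℝ f p :=
  HasFDerivAt.differentiableAt h

theorem congr (h : HasPartials f d p) (hd : ∀ i, d i = e i) : HasPartials f e p := by
  rwa [show e = d from funext fun i => (hd i).symm]

theorem congr_of_eventuallyEq (h : HasPartials f d p) (hg : g =ᶠ[nhds p] f) :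
    HasPartials g d p :=
  HasFDerivAt.congr_of_eventuallyEq h hg

theorem const (c : ℝ) : HasPartials (fun _ => c) (fun _ : Fin n => 0) p := by
  simpa [HasPartials] using hasFDerivAt_const c p

theorem coord (i : Fin n) : HasPartials (fun v : Coord n => v i) (fun j => if i = j then 1 else 0) p := by
  have := HasPartials.of_hasFDerivAt (EuclideanSpace.proj i : Coord n →L[ℝ] ℝ).hasFDerivAt (p := p)
  refine this.congr fun j => ?_
  simp [stdVec]

theorem add (hf : HasPartials f d p) (hg : HasPartials g e p) :
    HasPartials (fun x => f x + g x) (fun i => d i + e i) p := by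
  refine (HasPartials.of_hasFDerivAt (HasFDerivAt.add hf hg)).congr fun i => ?_
  simp [stdVec]

theorem sub (hf : HasPartials f d p) (hg : HasPartials g e p) :
    HasPartials (fun x => f x - g x) (fun i => d i - e i) p := by
  refine (HasPartials.of_hasFDerivAt (HasFDerivAt.sub hf hg)).congr fun i => ?_
  simp [stdVec]

theorem mul (hf : HasPartials f d p) (hg : HasPartials g e p) :
    HasPartials (fun x => f x * g x) (fun i => d i * g p + f p * e i) p := by
  refine (HasPartials.of_hasFDerivAt (HasFDerivAt.mul hf hg)).congr fun i => ?_
  simp [stdVec]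
  ring

theorem const_mul (c : ℝ) (hf : HasPartials f d p) :
    HasPartials (fun x => c * f x) (fun i => c * d i) p :=
  ((const c).mul hf).congr fun i => by simp

theorem sum {ι : Type*} (s : Finset ι) {f : ι → Coord n → ℝ} {d : ι → Fin n → ℝ}
    (h : ∀ j ∈ s, HasPartials (f j) (d j) p) :
    HasPartials (fun x => ∑ j ∈ s, f j x) (fun i => ∑ j ∈ s, d j i) p := by
  refine (HasPartials.of_hasFDerivAt (HasFDerivAt.fun_sum h)).congr fun i => ?_
  simp [stdVec]

theorem comp {φ : ℝ → ℝ} {c : ℝ} (hφ : HasDerivAt φ c (f p)) (hf : HasPartials f d p) :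
    HasPartials (fun x => φ (f x)) (fun i => c * d i) p := by
  refine (HasPartials.of_hasFDerivAt (hφ.comp_hasFDerivAt p hf)).congr fun i => ?_
  simp [stdVec]

end HasPartials

end Partials

/-! ### Vertical derivatives of `F² = (α + ω)⁴ / α²` -/

section SpraySquare

variable {n : ℕ}

/-- `∂(α+ω)⁴/α²` with respect to `α²`, as a function of `α²` and `ω`. -/
def energyQ (Q o : ℝ) : ℝ := (√Q + o) ^ 3 * (√Q - o) / Q ^ 2

/-- `∂(α+ω)⁴/α²` with respect to `ω`, as a function of `α²` and `ω`. -/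
def energyO (Q o : ℝ) : ℝ := 4 * (√Q + o) ^ 3 / Q

variable {Q o : Coord n → ℝ} {d e : Fin n → ℝ} {p : Coord n}

theorem HasPartials.sqrt (hQ : HasPartials Q d p) (h : 0 < Q p) :
    HasPartials (fun x => √(Q x)) (fun i => 1 / (2 * √(Q p)) * d i) p :=
  HasPartials.comp (Real.hasDerivAt_sqrt h.ne') hQ

theorem HasPartials.pow {f : Coord n → ℝ} (m : ℕ) (hf : HasPartials f d p) :
    HasPartials (fun x => f x ^ m) (fun i => m * f p ^ (m - 1) * d i) p :=
  HasPartials.comp (φ := fun t => t ^ m) (hasDerivAt_pow m (f p)) hf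

theorem HasPartials.div {f g : Coord n → ℝ} (hf : HasPartials f d p) (hg : HasPartials g e p)
    (h : g p ≠ 0) :
    HasPartials (fun x => f x / g x) (fun i => (d i * g p - f p * e i) / g p ^ 2) p := by
  have := hf.mul (HasPartials.comp (φ := fun t => t⁻¹) (hasDerivAt_inv h) hg)
  simp only [div_eq_mul_inv]
  refine this.congr fun i => ?_
  field_simp
  ring

theorem HasPartials.energy (hQ : HasPartials Q d p) (ho : HasPartials o e p) (h : 0 < Q p) :
    HasPartials (fun x => (√(Q x) + o x) ^ 4 / Q x)
      (fun i => energyQ (Q p) (o p) * d i + energyO (Q p) (o p) * e i) p := by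
  refine ((((hQ.sqrt h).add ho).pow 4).div hQ h.ne').congr fun i => ?_
  have hs : 0 < √(Q p) := Real.sqrt_pos.2 h
  have h2 : Q p = √(Q p) ^ 2 := (Real.sq_sqrt h.le).symm
  simp only [energyQ, energyO]
  generalize √(Q p) = α at *
  rw [h2]
  field_simp
  push_cast
  ring

theorem HasPartials.energyQ (hQ : HasPartials Q d p) (ho : HasPartials o e p) (h : 0 < Q p) :
    HasPartials (fun x => energyQ (Q x) (o x))
      (fun i => (√(Q p) + o p) ^ 2 * (2 * o p ^ 2 - √(Q p) * o p) / √(Q p) ^ 6 * d i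
        + 2 * (√(Q p) + o p) ^ 2 * (√(Q p) - 2 * o p) / √(Q p) ^ 4 * e i) p := by
  refine (((((hQ.sqrt h).add ho).pow 3).mul ((hQ.sqrt h).sub ho)).div (hQ.pow 2)
    (pow_pos h 2).ne').congr fun i => ?_
  have hs : 0 < √(Q p) := Real.sqrt_pos.2 h
  have h2 : Q p = √(Q p) ^ 2 := (Real.sq_sqrt h.le).symm
  generalize √(Q p) = α at *
  rw [h2]
  field_simp
  push_cast
  ring

theorem HasPartials.energyO (hQ : HasPartials Q d p) (ho : HasPartials o e p) (h : 0 < Q p) :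
    HasPartials (fun x => energyO (Q x) (o x))
      (fun i => 2 * (√(Q p) + o p) ^ 2 * (√(Q p) - 2 * o p) / √(Q p) ^ 4 * d i
        + 12 * (√(Q p) + o p) ^ 2 / √(Q p) ^ 2 * e i) p := by
  refine (((((hQ.sqrt h).add ho).pow 3).const_mul 4).div hQ h.ne').congr fun i => ?_
  have hs : 0 < √(Q p) := Real.sqrt_pos.2 h
  have h2 : Q p = √(Q p) ^ 2 := (Real.sq_sqrt h.le).symm
  generalize √(Q p) = α at *
  rw [h2]
  field_simp
  push_cast
  ring

theorem hasPartials_quadratic (M : Matrix (Fin n) (Fin n) ℝ) (hM : ∀ i j, M i j = M j i)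
    (v : Coord n) :
    HasPartials (fun u : Coord n => u.ofLp ⬝ᵥ M *ᵥ u.ofLp) (fun i => 2 * (M *ᵥ v.ofLp) i) v := by
  simp only [dotProduct, Matrix.mulVec]
  refine (HasPartials.sum Finset.univ fun i _ => (HasPartials.coord i).mul
    (HasPartials.sum Finset.univ fun j _ => (HasPartials.coord j).const_mul (M i j))).congr
      fun i => ?_
  simp [Finset.sum_add_distrib]
  rw [two_mul]
  congr 1
  exact Finset.sum_congr rfl fun j _ => by rw [hM i j, mul_comm]

theorem hasPartials_linear (b : Fin n → ℝ) (v : Coord n) :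
    HasPartials (fun u : Coord n => b ⬝ᵥ u.ofLp) b v := by
  simp only [dotProduct]
  refine (HasPartials.sum Finset.univ fun i _ => (HasPartials.coord i).const_mul (b i)).congr
      fun i => ?_
  simp

theorem hasPartials_mulVec (M : Matrix (Fin n) (Fin n) ℝ) (l : Fin n) (v : Coord n) :
    HasPartials (fun u : Coord n => (M *ᵥ u.ofLp) l) (fun i => M l i) v :=
  hasPartials_linear (M l) v

end SpraySquare

/-! ### The spray equation of `(α + ω)² / α` -/

section Spray

variable {n : ℕ}

/-- The matrix `∂a_ij/∂xᵏ`. -/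
def dMat (A : Coord n → Matrix (Fin n) (Fin n) ℝ) (p : Coord n) (k : Fin n) :
    Matrix (Fin n) (Fin n) ℝ :=
  Matrix.of fun i j => partialDeriv k (fun q => A q i j) p

/-- `∂b_i/∂xᵏ` as a function of `i`. -/
def dVec (b : Coord n → Fin n → ℝ) (p : Coord n) (k : Fin n) : Fin n → ℝ :=
  fun i => partialDeriv k (fun q => b q i) p

variable {A : Coord n → Matrix (Fin n) (Fin n) ℝ} {b : Coord n → Fin n → ℝ} {p : Coord n}

theorem hasPartials_quadratic_base (hA : ∀ i j, DifferentiableAt ℝ (fun q => A q i j) p)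
    (v : Fin n → ℝ) :
    HasPartials (fun q => v ⬝ᵥ A q *ᵥ v) (fun k => v ⬝ᵥ dMat A p k *ᵥ v) p := by
  simp only [dotProduct, Matrix.mulVec]
  refine (HasPartials.sum Finset.univ fun i _ => (HasPartials.sum Finset.univ fun j _ =>
    (HasPartials.of_differentiableAt (hA i j)).mul (HasPartials.const (v j))).const_mul (v i)).congr fun k => ?_
  simp [dMat]

theorem hasPartials_mulVec_base (hA : ∀ i j, DifferentiableAt ℝ (fun q => A q i j) p)
    (v : Fin n → ℝ) (l : Fin n) :
    HasPartials (fun q => (A q *ᵥ v) l) (fun k => (dMat A p k *ᵥ v) l) p := by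
  simp only [dotProduct, Matrix.mulVec]
  refine (HasPartials.sum Finset.univ fun j _ =>
    (HasPartials.of_differentiableAt (hA l j)).mul (HasPartials.const (v j))).congr fun k => ?_
  simp [dMat]

theorem hasPartials_linear_base (hb : ∀ i, DifferentiableAt ℝ (fun q => b q i) p)
    (v : Fin n → ℝ) :
    HasPartials (fun q => b q ⬝ᵥ v) (fun k => dVec b p k ⬝ᵥ v) p := by
  simp only [dotProduct]
  refine (HasPartials.sum Finset.univ fun j _ =>
    (HasPartials.of_differentiableAt (hb j)).mul (HasPartials.const (v j))).congr fun k => ?_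
  simp [dVec]

/-- `γ^i_jk vʲ vᵏ`. -/
def geodesicVec (A : Coord n → Matrix (Fin n) (Fin n) ℝ) (p v : Coord n) : Fin n → ℝ :=
  fun i => ∑ j, ∑ k, christoffel A p i j k * v j * v k

/-- `r_ij vⁱ vʲ`. -/
def r00 (A : Coord n → Matrix (Fin n) (Fin n) ℝ) (b : Coord n → Fin n → ℝ) (p v : Coord n) : ℝ :=
  v.ofLp ⬝ᵥ (Matrix.of (rTensor A b p)) *ᵥ v.ofLp

/-- The difference of the two sides of the spray equation, multiplied by `α⁶ / (2 (α + ω)²)`, in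
terms of the difference `U` of the spray coefficients of `F` and `α`. -/
def sprayDefect (A : Matrix (Fin n) (Fin n) ℝ) (b v U : Fin n → ℝ) (r : ℝ)
    (s : Fin n → ℝ) (l : Fin n) : ℝ :=
  let α := √(v ⬝ᵥ A *ᵥ v)
  let o := b ⬝ᵥ v
  4 * (2 * o ^ 2 - α * o) * (U ⬝ᵥ A *ᵥ v) * (A *ᵥ v) l
    + 4 * α ^ 2 * (α - 2 * o) * ((U ⬝ᵥ A *ᵥ v) * b l + (b ⬝ᵥ U) * (A *ᵥ v) l)
    + 12 * α ^ 4 * (b ⬝ᵥ U) * b l + 2 * α ^ 2 * (α ^ 2 - o ^ 2) * (A *ᵥ U) l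
    - (r * (2 * α ^ 2 * (α - 2 * o) * (A *ᵥ v) l + 6 * α ^ 4 * b l) + 4 * (α + o) * α ^ 4 * s l)

variable (hA : ∀ i j, DifferentiableAt ℝ (fun q => A q i j) p)
  (hb : ∀ i, DifferentiableAt ℝ (fun q => b q i) p)
  (hsym : ∀ᶠ q in nhds p, ∀ i j, A q i j = A q j i)
  (hpos : ∀ᶠ q in nhds p, ∀ v, v ≠ 0 → 0 < v ⬝ᵥ A q *ᵥ v)

include hpos in
theorem isUnit_det_of_pos : IsUnit (A p).det := by
  rw [← Matrix.isUnit_iff_isUnit_det]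
  refine Matrix.mulVec_injective_iff_isUnit.1 ?_
  intro x y h
  by_contra hne
  have := hpos.self_of_nhds (x - y) (sub_ne_zero.2 hne)
  rw [Matrix.mulVec_sub, h] at this
  simp at this

include hsym in
theorem dMat_symm (k i j : Fin n) : dMat A p k i j = dMat A p k j i := by
  simp only [dMat, Matrix.of_apply, partialDeriv]
  rw [Filter.EventuallyEq.fderiv_eq (hsym.mono fun q hq => hq i j)]

include hpos in
-- Lowering the upper index cancels the inverse matrix and leaves the Christoffel symbols of the
-- first kind.
theorem mulVec_christoffel (i j k : Fin n) :
    ∑ l, A p i l * christoffel A p l j k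
      = 1 / 2 * (dMat A p j i k + dMat A p k i j - dMat A p i j k) := by
  have h := Matrix.mul_nonsing_inv _ (isUnit_det_of_pos hpos)
  unfold christoffel
  have : ∀ f : Fin n → ℝ, ∑ l, A p i l * (1 / 2 * ∑ m, (A p)⁻¹ l m * f m) = 1 / 2 * f i := by
    intro f
    have h2 : (A p *ᵥ ((A p)⁻¹ *ᵥ f)) i = f i := by
      rw [Matrix.mulVec_mulVec, h, Matrix.one_mulVec]
    rw [← h2]
    simp only [Matrix.mulVec, dotProduct, Finset.mul_sum]
    exact Finset.sum_congr rfl fun l _ => Finset.sum_congr rfl fun m _ => by ring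
  rw [this]
  simp [dMat]

include hpos in
-- Two of the three terms of the lowered Christoffel symbol agree after contraction with `vʲ vᵏ`.
theorem mulVec_geodesicVec (v : Coord n) (l : Fin n) :
    (A p *ᵥ geodesicVec A p v) l
      = ∑ k, v k * (dMat A p k *ᵥ v.ofLp) l - 1 / 2 * (v.ofLp ⬝ᵥ dMat A p l *ᵥ v.ofLp) := by
  have h1 : (A p *ᵥ geodesicVec A p v) l
      = ∑ j, ∑ k, (∑ i, A p l i * christoffel A p i j k) * v j * v k := by
    simp only [Matrix.mulVec, dotProduct, geodesicVec, Finset.mul_sum, Finset.sum_mul]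
    rw [Finset.sum_comm]
    refine Finset.sum_congr rfl fun j _ => ?_
    rw [Finset.sum_comm]
    exact Finset.sum_congr rfl fun k _ => Finset.sum_congr rfl fun i _ => by ring
  rw [h1]
  simp only [mulVec_christoffel hpos]
  have h2 : ∑ k, v k * (dMat A p k *ᵥ v.ofLp) l = ∑ j, ∑ k, dMat A p j l k * v j * v k := by
    simp only [Matrix.mulVec, dotProduct, Finset.mul_sum]
    exact Finset.sum_congr rfl fun j _ => Finset.sum_congr rfl fun k _ => by ring
  have h3 : ∑ j, ∑ k, dMat A p j l k * v j * v k = ∑ j, ∑ k, dMat A p k l j * v j * v k := by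
    rw [Finset.sum_comm]
    exact Finset.sum_congr rfl fun j _ => Finset.sum_congr rfl fun k _ => by ring
  have h4 : v.ofLp ⬝ᵥ dMat A p l *ᵥ v.ofLp = ∑ j, ∑ k, dMat A p l j k * v j * v k := by
    simp only [Matrix.mulVec, dotProduct, Finset.mul_sum]
    exact Finset.sum_congr rfl fun j _ => Finset.sum_congr rfl fun k _ => by ring
  rw [h2, h4]
  have : ∑ j, ∑ k, dMat A p j l k * v j * v k
    = 1 / 2 * (∑ j, ∑ k, dMat A p j l k * v j * v k + ∑ j, ∑ k, dMat A p k l j * v j * v k) := by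
    rw [← h3]; ring
  rw [this]
  simp only [Finset.mul_sum, ← Finset.sum_add_distrib, ← Finset.sum_sub_distrib]
  exact Finset.sum_congr rfl fun j _ => Finset.sum_congr rfl fun k _ => by ring

include hsym in
theorem christoffel_symm (i j k : Fin n) : christoffel A p i j k = christoffel A p i k j := by
  unfold christoffel
  congr 1
  refine Finset.sum_congr rfl fun l _ => ?_
  have := dMat_symm hsym l j k
  simp only [dMat, Matrix.of_apply] at this
  rw [this]
  ring

include hsym in
theorem sTensor_eq (i j : Fin n) :
    sTensor A b p i j = 1 / 2 * (dVec b p j i - dVec b p i j) := by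
  unfold sTensor covDeriv
  simp only [christoffel_symm hsym _ i j, dVec]
  ring

theorem rTensor_eq (hsym : ∀ᶠ q in nhds p, ∀ i j, A q i j = A q j i) (i j : Fin n) :
    rTensor A b p i j = 1 / 2 * (dVec b p j i + dVec b p i j) - ∑ k, christoffel A p k i j * b p k := by
  unfold rTensor covDeriv
  simp only [christoffel_symm hsym _ i j, dVec]
  ring

include hsym in
-- This trades the derivative of `ω` along `v` for the tensor `r` and a term in `γ` that will
-- cancel.
theorem r00_eq (v : Coord n) :
    r00 A b p v = ∑ k, v k * (dVec b p k ⬝ᵥ v.ofLp) - b p ⬝ᵥ geodesicVec A p v := by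
  have h1 : r00 A b p v = ∑ i, ∑ j, (1 / 2 * (dVec b p j i * v i * v j + dVec b p i j * v i * v j)
      - ∑ k, b p k * (christoffel A p k i j * v i * v j)) := by
    simp only [r00, Matrix.mulVec, dotProduct, Finset.mul_sum, Matrix.of_apply]
    refine Finset.sum_congr rfl fun j _ => Finset.sum_congr rfl fun k _ => ?_
    rw [rTensor_eq hsym, sub_mul, Finset.sum_mul, mul_sub, Finset.mul_sum]
    congr 1
    · ring
    · exact Finset.sum_congr rfl fun _ _ => by ring
  have h2 : ∑ k, v k * (dVec b p k ⬝ᵥ v.ofLp) = ∑ i, ∑ j, dVec b p i j * v i * v j := by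
    simp only [dotProduct, Finset.mul_sum]
    exact Finset.sum_congr rfl fun j _ => Finset.sum_congr rfl fun k _ => by ring
  have h3 : ∑ i, ∑ j, dVec b p j i * v i * v j = ∑ i, ∑ j, dVec b p i j * v i * v j := by
    rw [Finset.sum_comm]
    exact Finset.sum_congr rfl fun j _ => Finset.sum_congr rfl fun k _ => by ring
  have h4 : b p ⬝ᵥ geodesicVec A p v
      = ∑ i, ∑ j, ∑ k, b p k * (christoffel A p k i j * v i * v j) := by
    simp only [dotProduct, geodesicVec, Finset.mul_sum]
    rw [Finset.sum_comm]
    refine Finset.sum_congr rfl fun j _ => ?_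
    rw [Finset.sum_comm]
  rw [h1, h2, h4]
  simp only [Finset.sum_sub_distrib, ← Finset.mul_sum, Finset.sum_add_distrib]
  rw [h3]
  ring

variable {F : Coord n → Coord n → ℝ}
  (hF : ∀ᶠ q in nhds p, ∀ u : Coord n,
    F q u = (√(u.ofLp ⬝ᵥ A q *ᵥ u.ofLp) + b q ⬝ᵥ u.ofLp) ^ 2 / √(u.ofLp ⬝ᵥ A q *ᵥ u.ofLp))

include hsym hpos hF in
-- The formula is needed on a neighbourhood of `p`, because it is differentiated once more in `x`.
theorem eventually_partialDeriv_sq :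
    ∀ᶠ q in nhds p, ∀ v : Coord n, v ≠ 0 → ∀ l, partialDeriv l (fun u => F q u ^ 2) v
      = energyQ (v.ofLp ⬝ᵥ A q *ᵥ v.ofLp) (b q ⬝ᵥ v.ofLp) * (2 * (A q *ᵥ v.ofLp) l)
        + energyO (v.ofLp ⬝ᵥ A q *ᵥ v.ofLp) (b q ⬝ᵥ v.ofLp) * b q l := by
  filter_upwards [hsym, hpos, hF] with q hs hp hFq v hv l
  have hv' : v.ofLp ≠ 0 := by simpa using hv
  have e : (fun u => F q u ^ 2)
      = fun u : Coord n => (√(u.ofLp ⬝ᵥ A q *ᵥ u.ofLp) + b q ⬝ᵥ u.ofLp) ^ 4 / (u.ofLp ⬝ᵥ A q *ᵥ u.ofLp) := by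
    funext u
    have h0 : 0 ≤ u.ofLp ⬝ᵥ A q *ᵥ u.ofLp := by
      by_cases h : u.ofLp = 0
      · simp [h]
      · exact (hp _ h).le
    rw [hFq u, div_pow, ← pow_mul, Real.sq_sqrt h0]
  rw [e]
  exact ((hasPartials_quadratic (A q) hs v).energy (hasPartials_linear (b q) v)
    (hp _ hv')).partialDeriv_eq l

include hsym hpos hF in
-- With `(α + ω)²/α⁶` pulled out, the remaining bracket is polynomial in `α`, `ω` and the
-- components.
theorem fundTensor_eq {v : Coord n} (hv : v ≠ 0) (i l : Fin n) :
    let α := √(v.ofLp ⬝ᵥ A p *ᵥ v.ofLp)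
    let o := b p ⬝ᵥ v.ofLp
    fundTensor F p v i l = (α + o) ^ 2 / α ^ 6 / 2 *
      (4 * (2 * o ^ 2 - α * o) * (A p *ᵥ v.ofLp) i * (A p *ᵥ v.ofLp) l
        + 4 * α ^ 2 * (α - 2 * o) * ((A p *ᵥ v.ofLp) i * b p l + b p i * (A p *ᵥ v.ofLp) l)
        + 12 * α ^ 4 * b p i * b p l + 2 * α ^ 2 * (α ^ 2 - o ^ 2) * A p l i) := by
  intro α o
  have hv' : v.ofLp ≠ 0 := by simpa using hv
  have hQ := hpos.self_of_nhds _ hv'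
  have hsp := hsym.self_of_nhds
  have h := (eventually_partialDeriv_sq hsym hpos hF).self_of_nhds
  have e : (fun w => partialDeriv l (fun u => F p u ^ 2) w) =ᶠ[nhds v] fun w : Coord n =>
      energyQ (w.ofLp ⬝ᵥ A p *ᵥ w.ofLp) (b p ⬝ᵥ w.ofLp) * (2 * (A p *ᵥ w.ofLp) l)
        + energyO (w.ofLp ⬝ᵥ A p *ᵥ w.ofLp) (b p ⬝ᵥ w.ofLp) * b p l := by
    filter_upwards [isOpen_ne.mem_nhds hv] with w hw using h w hw l
  have hq := hasPartials_quadratic (A p) hsp v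
  have hl := hasPartials_linear (b p) v
  have := ((((hq.energyQ hl hQ).mul ((hasPartials_mulVec (A p) l v).const_mul 2)).add
    ((hq.energyO hl hQ).mul (HasPartials.const (b p l)))).congr_of_eventuallyEq e).partialDeriv_eq i
  rw [fundTensor, Matrix.of_apply, this]
  have hα : 0 < α := Real.sqrt_pos.2 hQ
  have h2 : v.ofLp ⬝ᵥ A p *ᵥ v.ofLp = α ^ 2 := (Real.sq_sqrt hQ.le).symm
  have h3 : √(v.ofLp ⬝ᵥ A p *ᵥ v.ofLp) = α := rfl
  simp only [energyQ, energyO, h3]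
  rw [h2]
  change _ = (α + o) ^ 2 / α ^ 6 / 2 * _
  rw [show b p ⬝ᵥ v.ofLp = o from rfl]
  field_simp
  ring

/-- The right-hand side of the equation that defines the spray coefficients. -/
def sprayRhs (F : Coord n → Coord n → ℝ) (p v : Coord n) (l : Fin n) : ℝ :=
  (∑ k, partialDeriv k (fun q => partialDeriv l (fun u => F q u ^ 2) v) p * v k)
      - partialDeriv l (fun q => F q v ^ 2) p

include hA hb hsym hpos hF in
theorem sprayRhs_eq {v : Coord n} (hv : v ≠ 0) (l : Fin n) :
    let α := √(v.ofLp ⬝ᵥ A p *ᵥ v.ofLp)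
    let o := b p ⬝ᵥ v.ofLp
    sprayRhs F p v l = 2 * (α + o) ^ 2 / α ^ 6 *
      ((2 * o ^ 2 - α * o) * (∑ k, v k * (v.ofLp ⬝ᵥ dMat A p k *ᵥ v.ofLp)) * (A p *ᵥ v.ofLp) l
        + α ^ 2 * (α - 2 * o) * ((∑ k, v k * (v.ofLp ⬝ᵥ dMat A p k *ᵥ v.ofLp)) * b p l
          + 2 * (∑ k, v k * (dVec b p k ⬝ᵥ v.ofLp)) * (A p *ᵥ v.ofLp) l)
        + 6 * α ^ 4 * (∑ k, v k * (dVec b p k ⬝ᵥ v.ofLp)) * b p l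
        + α ^ 2 * (α ^ 2 - o ^ 2) * (∑ k, v k * (dMat A p k *ᵥ v.ofLp) l
          - 1 / 2 * (v.ofLp ⬝ᵥ dMat A p l *ᵥ v.ofLp))
        + 2 * (α + o) * α ^ 4 * (∑ k, v k * dVec b p k l - dVec b p l ⬝ᵥ v.ofLp)) := by
  intro α o
  have hv' : v.ofLp ≠ 0 := by simpa using hv
  have hQ := hpos.self_of_nhds _ hv'
  have e : (fun q => partialDeriv l (fun u => F q u ^ 2) v) =ᶠ[nhds p] fun q =>
      energyQ (v.ofLp ⬝ᵥ A q *ᵥ v.ofLp) (b q ⬝ᵥ v.ofLp) * (2 * (A q *ᵥ v.ofLp) l)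
        + energyO (v.ofLp ⬝ᵥ A q *ᵥ v.ofLp) (b q ⬝ᵥ v.ofLp) * b q l := by
    filter_upwards [eventually_partialDeriv_sq hsym hpos hF] with q hq using hq v hv l
  have e2 : (fun q => F q v ^ 2) =ᶠ[nhds p] fun q =>
      (√(v.ofLp ⬝ᵥ A q *ᵥ v.ofLp) + b q ⬝ᵥ v.ofLp) ^ 4 / (v.ofLp ⬝ᵥ A q *ᵥ v.ofLp) := by
    filter_upwards [hF, hpos] with q hq hp
    rw [hq v, div_pow, ← pow_mul, Real.sq_sqrt (hp _ hv').le]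
  have hq := hasPartials_quadratic_base hA v.ofLp
  have hl := hasPartials_linear_base hb v.ofLp
  have h1 := ((((hq.energyQ hl hQ).mul ((hasPartials_mulVec_base hA v.ofLp l).const_mul 2)).add
    ((hq.energyO hl hQ).mul (HasPartials.of_differentiableAt (hb l)))).congr_of_eventuallyEq e).partialDeriv_eq
  have h1' := ((hq.energy hl hQ).congr_of_eventuallyEq e2).partialDeriv_eq l
  have hα : 0 < α := Real.sqrt_pos.2 hQ
  have h2 : v.ofLp ⬝ᵥ A p *ᵥ v.ofLp = α ^ 2 := (Real.sq_sqrt hQ.le).symm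
  have h3 : √(v.ofLp ⬝ᵥ A p *ᵥ v.ofLp) = α := rfl
  have h4 : b p ⬝ᵥ v.ofLp = o := rfl
  have h5 : √(α ^ 2) = α := Real.sqrt_sq hα.le
  have key : ∀ k, partialDeriv k (fun q => partialDeriv l (fun u => F q u ^ 2) v) p * v k
      = (α + o) ^ 2 / α ^ 6 * (2 * (2 * o ^ 2 - α * o) * (A p *ᵥ v.ofLp) l
          + 2 * α ^ 2 * (α - 2 * o) * b p l) * (v k * (v.ofLp ⬝ᵥ dMat A p k *ᵥ v.ofLp))
        + (α + o) ^ 2 / α ^ 6 * (4 * α ^ 2 * (α - 2 * o) * (A p *ᵥ v.ofLp) l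
          + 12 * α ^ 4 * b p l) * (v k * (dVec b p k ⬝ᵥ v.ofLp))
        + (α + o) ^ 2 / α ^ 6 * (2 * α ^ 2 * (α ^ 2 - o ^ 2)) * (v k * (dMat A p k *ᵥ v.ofLp) l)
        + (α + o) ^ 2 / α ^ 6 * (4 * (α + o) * α ^ 4) * (v k * dVec b p k l) := by
    intro k
    rw [h1]
    simp only [energyQ, energyO, h4, h2, h5]
    rw [show partialDeriv k (fun q => b q l) p = dVec b p k l from rfl]
    field_simp
    ring
  rw [sprayRhs, h1', Finset.sum_congr rfl fun k _ => key k]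
  simp only [Finset.sum_add_distrib, ← Finset.mul_sum, energyQ, energyO, h4, h2, h5]
  change _ = 2 * (α + o) ^ 2 / α ^ 6 * _
  field_simp
  ring

include hA hb hsym hpos hF in
/-- The spray equation of `F = (α + ω)² / α`. -/
theorem spray_identity {v : Coord n} (hv : v ≠ 0) (G : Fin n → ℝ) (l : Fin n) :
    let α := √(v.ofLp ⬝ᵥ A p *ᵥ v.ofLp)
    4 * (fundTensor F p v *ᵥ G) l - sprayRhs F p v l
      = 2 * (α + b p ⬝ᵥ v.ofLp) ^ 2 / α ^ 6 *
        sprayDefect (A p) (b p) v.ofLp (fun i => G i - 1 / 2 * geodesicVec A p v i) (r00 A b p v)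
          (fun l => ∑ k, sTensor A b p l k * v k) l := by
  intro α
  set o := b p ⬝ᵥ v.ofLp with ho
  set U : Fin n → ℝ := fun i => G i - 1 / 2 * geodesicVec A p v i with hU
  -- Splitting off half the geodesic vector of `α` makes all derivatives of the metric cancel.
  have hGU : G = U + (1 / 2 : ℝ) • geodesicVec A p v := by
    funext i; simp [hU]
  have hsp := hsym.self_of_nhds
  have h1 : (fundTensor F p v *ᵥ G) l = (α + o) ^ 2 / α ^ 6 / 2 *
      (4 * (2 * o ^ 2 - α * o) * (G ⬝ᵥ A p *ᵥ v.ofLp) * (A p *ᵥ v.ofLp) l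
        + 4 * α ^ 2 * (α - 2 * o) * ((G ⬝ᵥ A p *ᵥ v.ofLp) * b p l + (b p ⬝ᵥ G) * (A p *ᵥ v.ofLp) l)
        + 12 * α ^ 4 * (b p ⬝ᵥ G) * b p l + 2 * α ^ 2 * (α ^ 2 - o ^ 2) * (A p *ᵥ G) l) := by
    have e : ∀ i, fundTensor F p v l i * G i = (α + o) ^ 2 / α ^ 6 / 2 *
        ((4 * (2 * o ^ 2 - α * o) * (A p *ᵥ v.ofLp) l + 4 * α ^ 2 * (α - 2 * o) * b p l)
          * (G i * (A p *ᵥ v.ofLp) i)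
        + (4 * α ^ 2 * (α - 2 * o) * (A p *ᵥ v.ofLp) l + 12 * α ^ 4 * b p l) * (b p i * G i)
        + 2 * α ^ 2 * (α ^ 2 - o ^ 2) * (A p l i * G i)) := by
      intro i
      rw [fundTensor_eq hsym hpos hF hv l i, hsp i l]
      ring
    rw [Matrix.mulVec, dotProduct, Finset.sum_congr rfl fun i _ => e i]
    simp only [← Finset.mul_sum, Finset.sum_add_distrib]
    simp only [Matrix.mulVec, dotProduct]
    ring
  have h2 := sprayRhs_eq hA hb hsym hpos hF hv l
  simp only at h2
  -- The `x`-derivatives of `a` and `b` enter the right-hand side only through `γ`, `r_00` and `s`.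
  have e1 : ∑ k, v k * (dMat A p k *ᵥ v.ofLp) l - 1 / 2 * (v.ofLp ⬝ᵥ dMat A p l *ᵥ v.ofLp)
    = (A p *ᵥ geodesicVec A p v) l := (mulVec_geodesicVec hpos v l).symm
  have e2 : ∑ k, v k * (v.ofLp ⬝ᵥ dMat A p k *ᵥ v.ofLp)
    = 2 * (geodesicVec A p v ⬝ᵥ A p *ᵥ v.ofLp) := by
    have t1 : geodesicVec A p v ⬝ᵥ A p *ᵥ v.ofLp = v.ofLp ⬝ᵥ A p *ᵥ geodesicVec A p v := by
      rw [Matrix.dotProduct_mulVec, ← Matrix.mulVec_transpose, dotProduct_comm]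
      congr 2
      ext i j
      exact hsp j i
    have t2 : v.ofLp ⬝ᵥ A p *ᵥ geodesicVec A p v
        = ∑ i, v i * (∑ k, v k * (dMat A p k *ᵥ v.ofLp) i - 1 / 2 * (v.ofLp ⬝ᵥ dMat A p i *ᵥ v.ofLp)) :=
      Finset.sum_congr rfl fun i _ => by rw [mulVec_geodesicVec hpos v i]
    have t3 : ∑ i, v i * ∑ k, v k * (dMat A p k *ᵥ v.ofLp) i
        = ∑ k, v k * (v.ofLp ⬝ᵥ dMat A p k *ᵥ v.ofLp) := by
      simp only [Finset.mul_sum]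
      rw [Finset.sum_comm]
      refine Finset.sum_congr rfl fun k _ => ?_
      rw [dotProduct, Finset.mul_sum]
      exact Finset.sum_congr rfl fun i _ => by ring
    have t4 : ∑ i, v i * (1 / 2 * (v.ofLp ⬝ᵥ dMat A p i *ᵥ v.ofLp))
        = 1 / 2 * ∑ k, v k * (v.ofLp ⬝ᵥ dMat A p k *ᵥ v.ofLp) := by
      rw [Finset.mul_sum]
      exact Finset.sum_congr rfl fun i _ => by ring
    rw [t1, t2]
    simp only [mul_sub, Finset.sum_sub_distrib]
    rw [t3, t4]
    ring
  have e3 : ∑ k, v k * (dVec b p k ⬝ᵥ v.ofLp) = r00 A b p v + b p ⬝ᵥ geodesicVec A p v := by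
    rw [r00_eq hsym]; ring
  have e4 : ∑ k, v k * dVec b p k l - dVec b p l ⬝ᵥ v.ofLp = 2 * ∑ k, sTensor A b p l k * v k := by
    rw [Finset.mul_sum, dotProduct, ← Finset.sum_sub_distrib]
    exact Finset.sum_congr rfl fun k _ => by rw [sTensor_eq hsym]; ring
  rw [h2, h1, e1, e2, e3, e4, sprayDefect, hGU]
  simp only [Matrix.mulVec_add, Matrix.mulVec_smul, dotProduct_add, dotProduct_smul,
    add_dotProduct, smul_dotProduct, Pi.add_apply, Pi.smul_apply, smul_eq_mul]
  change _ = 2 * (α + o) ^ 2 / α ^ 6 * _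
  rw [show √(v.ofLp ⬝ᵥ A p *ᵥ v.ofLp) = α from rfl, ← ho]
  ring

end Spray

/-! ### The Douglas condition at a point for a unit form -/

section DouglasAt

variable {n : ℕ}

/-- The Douglas condition at a point of a chart. -/
def IsDouglasAt (F : Coord n → Coord n → ℝ) (p : Coord n) : Prop :=
  ∃ (Γ : Fin n → Fin n → Fin n → ℝ) (P : Coord n → ℝ),
    (∀ v, ∀ t : ℝ, 0 < t → P (t • v) = t * P v) ∧
    ∀ v : Coord n, v ≠ 0 → (fundTensor F p v).det ≠ 0 → ∀ i,
      sprayCoeff F p v i = 1 / 2 * (∑ j, ∑ k, Γ i j k * v j * v k) + P v * v i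

variable {A : Coord n → Matrix (Fin n) (Fin n) ℝ} {b : Coord n → Fin n → ℝ} {p : Coord n}
  {F : Coord n → Coord n → ℝ} {X : Fin n → ℝ}

theorem sprayCoeff_eq (F : Coord n → Coord n → ℝ) (p v : Coord n) :
    sprayCoeff F p v = (1 / 4 : ℝ) • ((fundTensor F p v)⁻¹ *ᵥ sprayRhs F p v) := by
  funext i
  simp [sprayCoeff, sprayRhs, Matrix.mulVec, dotProduct]

/-- Multiplying by `g` avoids inverting the fundamental tensor. -/
theorem sprayCoeff_eq_iff {v : Coord n} (h : (fundTensor F p v).det ≠ 0) (G : Fin n → ℝ) :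
    sprayCoeff F p v = G ↔ ∀ l, 4 * (fundTensor F p v *ᵥ G) l - sprayRhs F p v l = 0 := by
  have hu : IsUnit (fundTensor F p v).det := isUnit_iff_ne_zero.2 h
  constructor
  · rintro rfl l
    rw [sprayCoeff_eq, Matrix.mulVec_smul, Matrix.mulVec_mulVec, Matrix.mul_nonsing_inv _ hu,
      Matrix.one_mulVec]
    simp
  · intro hG
    have e : sprayRhs F p v = (4 : ℝ) • (fundTensor F p v *ᵥ G) := by
      funext l
      simp only [Pi.smul_apply, smul_eq_mul]
      linarith [hG l]
    rw [sprayCoeff_eq, e, Matrix.mulVec_smul, Matrix.mulVec_mulVec, Matrix.nonsing_inv_mul _ hu,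
      Matrix.one_mulVec, smul_smul]
    norm_num

/-- Contraction with an arbitrary `w` turns the component equations into the bilinear identity used
in the pointwise algebra. -/
theorem dotProduct_sprayDefect (M : Matrix (Fin n) (Fin n) ℝ) (c v U : Fin n → ℝ) (r : ℝ)
    (s w : Fin n → ℝ) :
    let α := √(v ⬝ᵥ M *ᵥ v)
    let o := c ⬝ᵥ v
    w ⬝ᵥ sprayDefect M c v U r s
      = 4 * (2 * o ^ 2 - α * o) * (U ⬝ᵥ M *ᵥ v) * (w ⬝ᵥ M *ᵥ v)
        + 4 * α ^ 2 * (α - 2 * o) * ((U ⬝ᵥ M *ᵥ v) * (w ⬝ᵥ c) + (c ⬝ᵥ U) * (w ⬝ᵥ M *ᵥ v))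
        + 12 * α ^ 4 * (c ⬝ᵥ U) * (w ⬝ᵥ c) + 2 * α ^ 2 * (α ^ 2 - o ^ 2) * (w ⬝ᵥ M *ᵥ U)
        - (r * (2 * α ^ 2 * (α - 2 * o) * (w ⬝ᵥ M *ᵥ v) + 6 * α ^ 4 * (w ⬝ᵥ c))
          + 4 * (α + o) * α ^ 4 * (w ⬝ᵥ s)) := by
  intro α o
  have e : sprayDefect M c v U r s
      = (4 * (2 * o ^ 2 - α * o) * (U ⬝ᵥ M *ᵥ v) + 4 * α ^ 2 * (α - 2 * o) * (c ⬝ᵥ U)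
          - r * (2 * α ^ 2 * (α - 2 * o))) • (M *ᵥ v)
        + (4 * α ^ 2 * (α - 2 * o) * (U ⬝ᵥ M *ᵥ v) + 12 * α ^ 4 * (c ⬝ᵥ U) - r * (6 * α ^ 4)) • c
        + (2 * α ^ 2 * (α ^ 2 - o ^ 2)) • (M *ᵥ U) - (4 * (α + o) * α ^ 4) • s := by
    funext l
    simp only [sprayDefect, Pi.sub_apply, Pi.add_apply, Pi.smul_apply, smul_eq_mul]
    ring
  rw [e]
  simp only [dotProduct_add, dotProduct_sub, dotProduct_smul, smul_eq_mul]
  ring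

variable (hA : ∀ i j, DifferentiableAt ℝ (fun q => A q i j) p)
  (hb : ∀ i, DifferentiableAt ℝ (fun q => b q i) p)
  (hsym : ∀ᶠ q in nhds p, ∀ i j, A q i j = A q j i)
  (hpos : ∀ᶠ q in nhds p, ∀ v, v ≠ 0 → 0 < v ⬝ᵥ A q *ᵥ v)
  (hF : ∀ᶠ q in nhds p, ∀ u : Coord n,
    F q u = (√(u.ofLp ⬝ᵥ A q *ᵥ u.ofLp) + b q ⬝ᵥ u.ofLp) ^ 2 / √(u.ofLp ⬝ᵥ A q *ᵥ u.ofLp))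
  (hX : A p *ᵥ X = b p) (hX1 : b p ⬝ᵥ X = 1)

include hA hb hsym hpos hF hX hX1 in
/-- If `ω` has unit length, is closed and `ω_{i|j} = c (a_ij - ω_i ω_j)`, then `(α + ω)² / α` is a
Douglas metric. -/
theorem isDouglasAt_of_conformal {c : ℝ} (hs : ∀ i j, sTensor A b p i j = 0)
    (hr : ∀ i j, rTensor A b p i j = c * (A p i j - b p i * b p j)) : IsDouglasAt F p := by
  -- The defect vanishes for `U = (c/3) (α² X + (α - 2ω) v)`. Its first term is quadratic in `v` and
  -- goes into `Γ`, doubled because of the factor `1/2` there; the second is the projective term.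
  refine ⟨fun i j k => christoffel A p i j k + 2 * c / 3 * A p j k * X i,
    fun v => c / 3 * (√(v.ofLp ⬝ᵥ A p *ᵥ v.ofLp) - 2 * (b p ⬝ᵥ v.ofLp)), ?_, ?_⟩
  · intro v t ht
    have : (t • v).ofLp ⬝ᵥ A p *ᵥ (t • v).ofLp = t ^ 2 * (v.ofLp ⬝ᵥ A p *ᵥ v.ofLp) := by
      simp [Matrix.mulVec_smul]
      ring
    beta_reduce
    rw [this, Real.sqrt_mul (sq_nonneg t), Real.sqrt_sq ht.le]
    simp
    ring
  intro v hv hdet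
  have hv' : v.ofLp ≠ 0 := by simpa using hv
  have hQ := hpos.self_of_nhds _ hv'
  set α := √(v.ofLp ⬝ᵥ A p *ᵥ v.ofLp) with hα
  have hQα : v.ofLp ⬝ᵥ A p *ᵥ v.ofLp = α ^ 2 := (Real.sq_sqrt hQ.le).symm
  set o := b p ⬝ᵥ v.ofLp with ho
  set U : Fin n → ℝ := (c / 3 * α ^ 2) • X + (c / 3 * (α - 2 * o)) • v.ofLp with hU
  have hG : sprayCoeff F p v = fun i => 1 / 2 * geodesicVec A p v i + U i := by
    rw [sprayCoeff_eq_iff hdet]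
    intro l
    rw [spray_identity hA hb hsym hpos hF hv]
    have e1 : (fun i => (fun i => 1 / 2 * geodesicVec A p v i + U i) i
        - 1 / 2 * geodesicVec A p v i) = U := by
      funext i; ring
    rw [e1]
    have hr0 : r00 A b p v = c * (α ^ 2 - o ^ 2) := by
      have : (Matrix.of (rTensor A b p)) = c • (A p - Matrix.vecMulVec (b p) (b p)) := by
        ext i j
        simp [hr, Matrix.vecMulVec_apply]
      rw [r00, this, Matrix.smul_mulVec, dotProduct_smul, Matrix.sub_mulVec, dotProduct_sub, hQα,
        Matrix.vecMulVec_mulVec, op_smul_eq_smul, dotProduct_smul, dotProduct_comm v.ofLp (b p), ← ho]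
      simp only [smul_eq_mul]
      ring
    have hs0 : (fun l => ∑ k, sTensor A b p l k * v k) = 0 := by
      funext l; simp [hs]
    have hXv : X ⬝ᵥ A p *ᵥ v.ofLp = o := by
      rw [Matrix.dotProduct_mulVec, ← Matrix.mulVec_transpose, ho, ← hX]
      congr 2
      ext i j
      exact hsym.self_of_nhds j i
    have hUv : U ⬝ᵥ A p *ᵥ v.ofLp = c / 3 * α ^ 2 * (α - o) := by
      rw [hU]
      simp only [add_dotProduct, smul_dotProduct, hXv, hQα, smul_eq_mul]
      ring
    have hbU : b p ⬝ᵥ U = c / 3 * (α - o) * (α + 2 * o) := by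
      rw [hU]
      simp only [dotProduct_add, dotProduct_smul, hX1, ← ho, smul_eq_mul]
      ring
    have hAU : A p *ᵥ U = (c / 3 * α ^ 2) • b p + (c / 3 * (α - 2 * o)) • (A p *ᵥ v.ofLp) := by
      rw [hU, Matrix.mulVec_add, Matrix.mulVec_smul, Matrix.mulVec_smul, hX]
    rw [hr0, hs0, sprayDefect, hUv, hbU, hAU, ← ho, ← hα]
    simp only [Pi.add_apply, Pi.smul_apply, Pi.zero_apply, smul_eq_mul]
    ring
  intro i
  rw [congrFun hG i]
  have e2 : ∑ j, ∑ k, (christoffel A p i j k + 2 * c / 3 * A p j k * X i) * v j * v k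
      = geodesicVec A p v i + 2 * c / 3 * X i * α ^ 2 := by
    rw [← hQα]
    simp only [geodesicVec, Matrix.mulVec, dotProduct, Finset.mul_sum, ← Finset.sum_add_distrib]
    exact Finset.sum_congr rfl fun j _ => Finset.sum_congr rfl fun k _ => by ring
  rw [e2, hU]
  simp only [Pi.add_apply, Pi.smul_apply, smul_eq_mul]
  ring

include hsym hpos hF in
-- For `|ω| < α` the quadratic form of `g` is positive definite, so a kernel vector is impossible.
-- This makes the Douglas condition available at every `v` not proportional to the dual vector of a
-- unit form.
theorem fundTensor_det_ne_zero {v : Coord n} (hv : (b p ⬝ᵥ v.ofLp) ^ 2 < v.ofLp ⬝ᵥ A p *ᵥ v.ofLp) :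
    (fundTensor F p v).det ≠ 0 := by
  have hQ := lt_of_le_of_lt (sq_nonneg _) hv
  have hv0 : v ≠ 0 := by
    rintro rfl
    simp at hQ
  intro hdet
  obtain ⟨w, hw0, hw⟩ := Matrix.exists_mulVec_eq_zero_iff.2 hdet
  have hww : w ⬝ᵥ fundTensor F p v *ᵥ w = 0 := by rw [hw, dotProduct_zero]
  set α := √(v.ofLp ⬝ᵥ A p *ᵥ v.ofLp) with hα
  have hQα : v.ofLp ⬝ᵥ A p *ᵥ v.ofLp = α ^ 2 := (Real.sq_sqrt hQ.le).symm
  have hαp : 0 < α := Real.sqrt_pos.2 hQ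
  set o := b p ⬝ᵥ v.ofLp with ho
  have hlt : -α < o := by
    rw [hQα] at hv
    exact (abs_lt.1 (abs_lt_of_sq_lt_sq hv hαp.le)).1
  have hsp := hsym.self_of_nhds
  set x := w ⬝ᵥ A p *ᵥ v.ofLp with hx
  set y := b p ⬝ᵥ w with hy
  set z := w ⬝ᵥ A p *ᵥ w with hz
  have e : w ⬝ᵥ fundTensor F p v *ᵥ w = (α + o) ^ 2 / α ^ 6 / 2 *
      (4 * (2 * o ^ 2 - α * o) * x ^ 2 + 8 * α ^ 2 * (α - 2 * o) * x * y + 12 * α ^ 4 * y ^ 2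
        + 2 * α ^ 2 * (α ^ 2 - o ^ 2) * z) := by
    have e1 : fundTensor F p v = ((α + o) ^ 2 / α ^ 6 / 2) •
        ((4 * (2 * o ^ 2 - α * o)) • Matrix.vecMulVec (A p *ᵥ v.ofLp) (A p *ᵥ v.ofLp)
          + (4 * α ^ 2 * (α - 2 * o)) • (Matrix.vecMulVec (A p *ᵥ v.ofLp) (b p)
            + Matrix.vecMulVec (b p) (A p *ᵥ v.ofLp))
          + (12 * α ^ 4) • Matrix.vecMulVec (b p) (b p)
          + (2 * α ^ 2 * (α ^ 2 - o ^ 2)) • A p) := by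
      ext i l
      rw [fundTensor_eq hsym hpos hF hv0 i l, hsp l i]
      simp only [Matrix.smul_apply, Matrix.add_apply, Matrix.vecMulVec_apply, smul_eq_mul]
      change (α + o) ^ 2 / α ^ 6 / 2 * _ = _
      ring
    rw [e1]
    simp only [Matrix.smul_mulVec, Matrix.add_mulVec, dotProduct_smul, dotProduct_add,
      Matrix.vecMulVec_mulVec, op_smul_eq_smul, dotProduct_smul, smul_eq_mul]
    rw [dotProduct_comm _ w, dotProduct_comm w (b p), ← hx, ← hy, ← hz]
    ring
  have hcs : x ^ 2 ≤ α ^ 2 * z := by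
    have hnn : ∀ y : Fin n → ℝ, 0 ≤ y ⬝ᵥ A p *ᵥ y := by
      intro y
      by_cases hy : y = 0
      · simp [hy]
      · exact (hpos.self_of_nhds y hy).le
    have hx' : v.ofLp ⬝ᵥ A p *ᵥ w = x := by
      rw [Matrix.dotProduct_mulVec, ← Matrix.mulVec_transpose, dotProduct_comm, hx]
      congr 2
      ext i j
      exact hsp j i
    -- This vector is `α²` times the part of `w` orthogonal to `v`; its nonnegative square is the
    -- Cauchy–Schwarz inequality.
    have h := hnn (α ^ 2 • w - x • v.ofLp)
    simp only [Matrix.mulVec_sub, Matrix.mulVec_smul, dotProduct_sub, sub_dotProduct,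
      dotProduct_smul, smul_dotProduct, smul_eq_mul, hQα, ← hx, ← hz, hx'] at h
    have h' : 0 ≤ α ^ 2 * (α ^ 2 * z - x ^ 2) := by linarith
    linarith [nonneg_of_mul_nonneg_right h' (by positivity)]
  have hpos2 : 0 < (α + o) ^ 2 / α ^ 6 / 2 := by
    have : 0 < α + o := by linarith
    positivity
  rw [e] at hww
  have h0 := (mul_eq_zero.1 hww).resolve_left hpos2.ne'
  have hao : 0 < α + o := by linarith
  have hpo : 0 < α ^ 2 - o ^ 2 := by rw [← hQα]; linarith
  -- Completing the square in `y` leaves nonnegative terms. Their sum being zero forces `x = 0`, and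
  -- then the `z` term alone is positive.
  have hsos : 3 * (4 * (2 * o ^ 2 - α * o) * x ^ 2 + 8 * α ^ 2 * (α - 2 * o) * x * y
      + 12 * α ^ 4 * y ^ 2 + 2 * α ^ 2 * (α ^ 2 - o ^ 2) * z)
      = (6 * α ^ 2 * y + 2 * (α - 2 * o) * x) ^ 2 + 2 * (α + o) ^ 2 * x ^ 2
        + 6 * (α ^ 2 - o ^ 2) * (α ^ 2 * z - x ^ 2) := by ring
  have hzp : 0 < z := hpos.self_of_nhds w hw0
  have h1 : 0 ≤ 6 * (α ^ 2 - o ^ 2) * (α ^ 2 * z - x ^ 2) :=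
    mul_nonneg (by linarith) (by linarith)
  have hx0 : x = 0 := by
    have h2 : 2 * (α + o) ^ 2 * x ^ 2 ≤ 0 := by nlinarith [sq_nonneg (6 * α ^ 2 * y + 2 * (α - 2 * o) * x)]
    have h3 : 0 < 2 * (α + o) ^ 2 := by positivity
    have h4 : x ^ 2 ≤ 0 := by
      by_contra hc
      push Not at hc
      have := mul_pos h3 hc
      linarith
    exact pow_eq_zero_iff two_ne_zero |>.1 (le_antisymm h4 (sq_nonneg x))
  rw [hx0] at h0
  have h5 : 0 < 2 * α ^ 2 * (α ^ 2 - o ^ 2) * z := by positivity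
  have h6 : 0 ≤ 12 * α ^ 4 * y ^ 2 := by positivity
  nlinarith

include hA hb hsym hpos hF hX hX1 in
/-- If `ω` has unit length and `(α + ω)² / α` is a Douglas metric, then `ω` is closed and
`ω_{i|j} = c (a_ij - ω_i ω_j)`. -/
theorem conformal_of_isDouglasAt
    (hunit : ∀ j, ∑ i, X i * (rTensor A b p i j + sTensor A b p i j) = 0) (h : IsDouglasAt F p) :
    (∀ i j, sTensor A b p i j = 0) ∧
      ∃ c, ∀ i j, rTensor A b p i j = c * (A p i j - b p i * b p j) := by
  obtain ⟨Γ, P, -, hG⟩ := h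
  have hsp := hsym.self_of_nhds
  let B : LinearMap.BilinForm ℝ (Fin n → ℝ) := Matrix.toBilin' (A p)
  let S : LinearMap.BilinForm ℝ (Fin n → ℝ) := Matrix.toBilin' (Matrix.of (sTensor A b p))
  let R : LinearMap.BilinForm ℝ (Fin n → ℝ) := Matrix.toBilin' (Matrix.of (rTensor A b p))
  -- With `q` half of the difference of `Γ` and the Christoffel symbols, the Douglas condition reads
  -- `G - γ/2 = q(v, v) + P v`.
  let q : (Fin n → ℝ) →ₗ[ℝ] (Fin n → ℝ) →ₗ[ℝ] (Fin n → ℝ) :=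
    LinearMap.mk₂ ℝ (fun u w i => 1 / 2 * ∑ j, ∑ k, (Γ i j k - christoffel A p i j k) * u j * w k)
      (by intros; funext i; simp [mul_add, add_mul, Finset.sum_add_distrib])
      (by intros; funext i; simp [Finset.mul_sum]; exact Finset.sum_congr rfl fun _ _ => Finset.sum_congr rfl fun _ _ => by ring)
      (by intros; funext i; simp [mul_add, Finset.sum_add_distrib])
      (by intros; funext i; simp [Finset.mul_sum]; exact Finset.sum_congr rfl fun _ _ => Finset.sum_congr rfl fun _ _ => by ring)
  have hB : ∀ u w, B u w = u ⬝ᵥ A p *ᵥ w := fun u w => Matrix.toBilin'_apply' _ _ _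
  have hS : ∀ u w, S u w = u ⬝ᵥ (Matrix.of (sTensor A b p)) *ᵥ w := fun u w => Matrix.toBilin'_apply' _ _ _
  have hR : ∀ u w, R u w = u ⬝ᵥ (Matrix.of (rTensor A b p)) *ᵥ w := fun u w => Matrix.toBilin'_apply' _ _ _
  have transp : ∀ (M : Matrix (Fin n) (Fin n) ℝ) u w, u ⬝ᵥ M *ᵥ w = w ⬝ᵥ Mᵀ *ᵥ u := by
    intro M u w
    rw [Matrix.dotProduct_mulVec, ← Matrix.mulVec_transpose, dotProduct_comm]
  have hBs : ∀ u w, B u w = B w u := by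
    intro u w
    rw [hB, hB, transp]
    congr 2
    ext i j
    exact hsp j i
  have hBX : ∀ w, B X w = b p ⬝ᵥ w := by
    intro w
    rw [hBs, hB, hX, dotProduct_comm]
  have hSv : ∀ v, S v v = 0 := by
    intro v
    have : S v v = -S v v := by
      rw [hS]
      conv_lhs => rw [transp]
      rw [← dotProduct_neg, ← Matrix.neg_mulVec]
      congr 2
      ext i j
      simp [sTensor]
      ring
    linarith
  have main := skew_eq_zero_and_exists_conformal B S R q hBs
    (fun v hv => by rw [hB]; exact hpos.self_of_nhds v hv) X (by rw [hBX, hX1])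
    (fun u w => by
      rw [hS, hS, transp, ← dotProduct_neg, ← Matrix.neg_mulVec]
      congr 2
      ext i j
      simp [sTensor]
      ring)
    (fun u w => by
      rw [hR, hR, transp]
      congr 2
      ext i j
      simp [rTensor]
      ring)
    (fun w => by
      rw [hR, hS, ← dotProduct_add, ← Matrix.add_mulVec, Matrix.dotProduct_mulVec]
      have : X ᵥ* (Matrix.of (rTensor A b p) + Matrix.of (sTensor A b p)) = 0 := by
        funext j
        simpa [Matrix.vecMul, dotProduct] using hunit j
      rw [this, zero_dotProduct])
    (by
      intro v hv w
      rw [hBX v, hB v v] at hv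
      set v' : Coord n := WithLp.toLp 2 v with hv'
      have hQ := lt_of_le_of_lt (sq_nonneg _) hv
      have hv0 : v' ≠ 0 := by
        rintro h0
        have : v = 0 := by simpa [hv'] using h0
        simp [this] at hQ
      set α := √(v ⬝ᵥ A p *ᵥ v) with hα
      have hQα : v ⬝ᵥ A p *ᵥ v = α ^ 2 := (Real.sq_sqrt hQ.le).symm
      have hαp : 0 < α := Real.sqrt_pos.2 hQ
      set o := b p ⬝ᵥ v with ho
      have hlt : 0 < α + o := by
        rw [hQα] at hv
        linarith [(abs_lt.1 (abs_lt_of_sq_lt_sq hv hαp.le)).1]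
      have hdet := fundTensor_det_ne_zero hsym hpos hF (v := v') hv
      have hG' := hG v' hv0 hdet
      have hU : (fun i => sprayCoeff F p v' i - 1 / 2 * geodesicVec A p v' i) = q v v + P v' • v := by
        funext i
        rw [hG' i]
        simp [q, geodesicVec, hv', sub_mul, Finset.sum_sub_distrib]
        ring
      have hz : sprayDefect (A p) (b p) v (q v v + P v' • v) (r00 A b p v')
          (fun l => ∑ k, sTensor A b p l k * v k) = 0 := by
        funext l
        have := (sprayCoeff_eq_iff hdet _).1 rfl l
        rw [spray_identity hA hb hsym hpos hF hv0, hU] at this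
        refine (mul_eq_zero.1 this).resolve_left ?_
        change 2 * (α + o) ^ 2 / α ^ 6 ≠ 0
        positivity
      have hz' : ∀ w, w ⬝ᵥ sprayDefect (A p) (b p) v (q v v + P v' • v) (r00 A b p v')
          (fun l => ∑ k, sTensor A b p l k * v k) = 0 := fun w => by rw [hz, dotProduct_zero]
      have hsS : ∀ w, w ⬝ᵥ (fun l => ∑ k, sTensor A b p l k * v k) = S w v := by
        intro w
        rw [hS]
        rfl
      have hr0 : r00 A b p v' = R v v := (hR v v).symm
      simp only [dotProduct_sprayDefect, hsS, ← hB, hr0] at hz'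
      simp only [dotProduct_comm _ (b p), ← hBX] at hz'
      have hvv : B v v = α ^ 2 := by rw [hB, hQα]
      have hXv : B X v = o := hBX v
      have hsq : √(B v v) = α := by rw [hB]
      rw [hsq] at hz'
      simp only [hXv, map_add, map_smul, LinearMap.add_apply, LinearMap.smul_apply,
        smul_eq_mul] at hz'
      -- In direction `v` the `s` term drops out by skew-symmetry; this instance serves to eliminate
      -- `P`.
      have h1 := hz' w
      have h2 := hz' v
      rw [hvv, hXv, hSv v, hBs v (q v v)] at h2
      rw [hBs w v, hBs w (q v v)] at h1
      rw [hsq, hvv, hXv]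
      have := eliminate_projective_factor (r := R v v) (P := P v') (Aqv := B (q v v) v)
        (Aqw := B (q v v) w) (Avw := B v w) (bq := B X (q v v)) (bw := B X w) (s := S w v) hαp hlt.ne'
        (by rw [hvv] at h1; linear_combination h1) (by linear_combination h2)
      linear_combination this)
  refine ⟨fun i j => ?_, ?_⟩
  · simpa [S, Matrix.toBilin'_single] using main.1 (Pi.single i 1) (Pi.single j 1)
  · obtain ⟨c, hc⟩ := main.2
    refine ⟨c, fun i j => ?_⟩
    simpa [R, B, Matrix.toBilin'_single, hBX] using hc (Pi.single i 1) (Pi.single j 1)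

end DouglasAt

/-! ### The tensor `r_ij` as a Lie derivative -/

section LieDerivative

variable {n : ℕ}

/-- The derivative of `f` at `p` in the direction of the vector with components `X`. -/
def dirDeriv (f : Coord n → ℝ) (p : Coord n) (X : Fin n → ℝ) : ℝ :=
  ∑ l, X l * partialDeriv l f p

/-- The components of the Lie derivative of `a_ij` along the vector field `X`. -/
def lieMat (A : Coord n → Matrix (Fin n) (Fin n) ℝ) (X : Coord n → Fin n → ℝ) (p : Coord n)
    (i j : Fin n) : ℝ :=
  ∑ l, (X p l * dMat A p l i j + A p i l * dVec X p j l + A p l j * dVec X p i l)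

variable {A : Coord n → Matrix (Fin n) (Fin n) ℝ} {b : Coord n → Fin n → ℝ}
  {X : Coord n → Fin n → ℝ} {p : Coord n}

variable (hA : ∀ i j, DifferentiableAt ℝ (fun q => A q i j) p)
  (hXd : ∀ i, DifferentiableAt ℝ (fun q => X q i) p)
  (hsym : ∀ᶠ q in nhds p, ∀ i j, A q i j = A q j i)
  (hpos : ∀ᶠ q in nhds p, ∀ v, v ≠ 0 → 0 < v ⬝ᵥ A q *ᵥ v)
  (hX : ∀ᶠ q in nhds p, A q *ᵥ X q = b q)

include hA hXd hX in
theorem hasPartials_of_dual (i : Fin n) :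
    HasPartials (fun q => b q i)
      (fun k => ∑ l, (dMat A p k i l * X p l + A p i l * dVec X p k l)) p :=
  (HasPartials.sum Finset.univ fun l _ => (HasPartials.of_differentiableAt (hA i l)).mul
    (HasPartials.of_differentiableAt (hXd l))).congr_of_eventuallyEq
      (hX.mono fun _q hq => (congrFun hq i).symm)

include hA hXd hX in
theorem dVec_of_dual (i k : Fin n) :
    dVec b p k i = ∑ l, (dMat A p k i l * X p l + A p i l * dVec X p k l) :=
  (hasPartials_of_dual hA hXd hX i).partialDeriv_eq k

include hsym hpos hX in
theorem sum_christoffel_mul (i j : Fin n) :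
    ∑ k, christoffel A p k i j * b p k
      = ∑ l, X p l * (1 / 2 * (dMat A p i l j + dMat A p j l i - dMat A p l i j)) := by
  have h1 : ∀ k, b p k = ∑ l, A p l k * X p l := by
    intro k
    rw [← hX.self_of_nhds, Matrix.mulVec, dotProduct]
    exact Finset.sum_congr rfl fun l _ => by rw [hsym.self_of_nhds k l]
  simp only [h1, Finset.mul_sum]
  rw [Finset.sum_comm]
  refine Finset.sum_congr rfl fun l _ => ?_
  rw [← mulVec_christoffel hpos, Finset.mul_sum]
  exact Finset.sum_congr rfl fun k _ => by ring

include hA hXd hsym hpos hX in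
-- Expressing `b_i` through the dual field cancels the Christoffel symbols. In this form `r` obeys
-- Leibniz' rule and transforms naturally between charts.
theorem two_mul_rTensor (i j : Fin n) : 2 * rTensor A b p i j = lieMat A X p i j := by
  rw [rTensor_eq hsym, sum_christoffel_mul hsym hpos hX, dVec_of_dual hA hXd hX,
    dVec_of_dual hA hXd hX, lieMat]
  rw [← Finset.sum_add_distrib, Finset.mul_sum, ← Finset.sum_sub_distrib, Finset.mul_sum]
  refine Finset.sum_congr rfl fun l _ => ?_
  rw [dMat_symm hsym j i l, dMat_symm hsym i j l, hsym.self_of_nhds j l]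
  ring

include hA hXd hsym hpos hX in
/-- `∂_j b² = 2 (r_j + s_j)`. -/
theorem hasPartials_dual_normSq :
    HasPartials (fun q => b q ⬝ᵥ X q)
      (fun j => 2 * ∑ i, X p i * (rTensor A b p i j + sTensor A b p i j)) p := by
  have h0 := HasPartials.sum Finset.univ fun i _ => (hasPartials_of_dual hA hXd hX i).mul
    (HasPartials.of_differentiableAt (hXd i))
  refine h0.congr fun j => ?_
  have hsp := hsym.self_of_nhds
  have e1 : ∀ i, rTensor A b p i j + sTensor A b p i j
      = dVec b p j i - ∑ k, christoffel A p k i j * b p k := by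
    intro i
    rw [rTensor_eq hsym, sTensor_eq hsym]
    ring
  simp only [e1, sum_christoffel_mul hsym hpos hX]
  have e2 : ∑ i, X p i * dVec b p j i
      = ∑ i, ∑ l, (dMat A p j i l * X p i * X p l + A p i l * dVec X p j l * X p i) := by
    refine Finset.sum_congr rfl fun i _ => ?_
    rw [dVec_of_dual hA hXd hX, Finset.mul_sum]
    exact Finset.sum_congr rfl fun l _ => by ring
  have e3 : ∑ i, b p i * dVec X p j i = ∑ i, ∑ l, A p i l * dVec X p j l * X p i := by
    rw [Finset.sum_comm]
    refine Finset.sum_congr rfl fun i _ => ?_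
    rw [← hX.self_of_nhds, Matrix.mulVec, dotProduct, Finset.sum_mul]
    exact Finset.sum_congr rfl fun l _ => by rw [hsp i l]; ring
  -- Contracting twice with `X` cancels the two metric derivatives that are exchanged by swapping
  -- the summation indices.
  have e4 : ∑ i, X p i * ∑ l, X p l * (1 / 2 * (dMat A p i l j + dMat A p j l i - dMat A p l i j))
      = 1 / 2 * ∑ i, ∑ l, dMat A p j i l * X p i * X p l := by
    have t : ∑ i, ∑ l, dMat A p i l j * X p i * X p l = ∑ i, ∑ l, dMat A p l i j * X p i * X p l := by
      rw [Finset.sum_comm]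
      exact Finset.sum_congr rfl fun l _ => Finset.sum_congr rfl fun k _ => by ring
    have t2 : ∑ i, X p i * ∑ l, X p l * (1 / 2 * (dMat A p i l j + dMat A p j l i - dMat A p l i j))
        = 1 / 2 * (∑ i, ∑ l, dMat A p j i l * X p i * X p l + (∑ i, ∑ l, dMat A p i l j * X p i * X p l
          - ∑ i, ∑ l, dMat A p l i j * X p i * X p l)) := by
      simp only [Finset.mul_sum, ← Finset.sum_add_distrib, ← Finset.sum_sub_distrib]
      exact Finset.sum_congr rfl fun i _ => Finset.sum_congr rfl fun l _ => by
        rw [dMat_symm hsym j l i]; ring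
    rw [t2, t, sub_self, add_zero]
  have e5 : ∑ i, (∑ l, (dMat A p j i l * X p l + A p i l * dVec X p j l)) * X p i
      = ∑ i, X p i * dVec b p j i := by
    refine Finset.sum_congr rfl fun i _ => ?_
    rw [dVec_of_dual hA hXd hX, mul_comm]
  rw [Finset.sum_add_distrib]
  change _ + ∑ i, b p i * dVec X p j i = _
  have e6 : ∀ c : Fin n → ℝ, ∑ i, X p i * (dVec b p j i - c i)
      = ∑ i, X p i * dVec b p j i - ∑ i, X p i * c i := by
    intro c
    simp only [mul_sub, Finset.sum_sub_distrib]
  rw [e6, e5, e4, e3, e2]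
  simp only [Finset.sum_add_distrib]
  ring

include hpos hX in
theorem inv_mulVec_of_dual : (A p)⁻¹ *ᵥ b p = X p := by
  rw [← hX.self_of_nhds, Matrix.mulVec_mulVec, Matrix.nonsing_inv_mul _ (isUnit_det_of_pos hpos),
    Matrix.one_mulVec]

include hpos hX in
theorem sForm_eq (i : Fin n) : sForm A b p i = ∑ j, X p j * sTensor A b p j i := by
  rw [← inv_mulVec_of_dual hpos hX]
  rfl

end LieDerivative

/-! ### Change of the pair to `(f a + k ω⊗ω, g ω)` -/

section PairChange

variable {n : ℕ} {A A' : Coord n → Matrix (Fin n) (Fin n) ℝ} {w b' : Coord n → Fin n → ℝ}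
  {X : Coord n → Fin n → ℝ} {p : Coord n} {f k g h : Coord n → ℝ}

variable (hA : ∀ i j, DifferentiableAt ℝ (fun q => A q i j) p)
  (hXd : ∀ i, DifferentiableAt ℝ (fun q => X q i) p)
  (hsym : ∀ᶠ q in nhds p, ∀ i j, A q i j = A q j i)
  (hpos : ∀ᶠ q in nhds p, ∀ v, v ≠ 0 → 0 < v ⬝ᵥ A q *ᵥ v)
  (hX : ∀ᶠ q in nhds p, A q *ᵥ X q = w q)
  (hunit : ∀ᶠ q in nhds p, w q ⬝ᵥ X q = 1)
  (hclosed : ∀ i j, sTensor A w p i j = 0)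
  (hf : DifferentiableAt ℝ f p) (hk : DifferentiableAt ℝ k p) (hg : DifferentiableAt ℝ g p)
  (hh : DifferentiableAt ℝ h p)
  (hA' : ∀ᶠ q in nhds p, ∀ i j, A' q i j = f q * A q i j + k q * (w q i * w q j))
  (hb' : ∀ᶠ q in nhds p, ∀ i, b' q i = g q * w q i)
  (hgh : ∀ᶠ q in nhds p, g q = h q * (f q + k q))
  (hpos' : ∀ᶠ q in nhds p, ∀ v, v ≠ 0 → 0 < v ⬝ᵥ A' q *ᵥ v)

include hX hunit hA' hb' hgh in
-- As `ω(X) = 1`, the new metric sends `X` to `(f + k) ω`; hence the condition `g = h (f + k)`.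
theorem dual_of_pairChange : ∀ᶠ q in nhds p, A' q *ᵥ (fun i => h q * X q i) = b' q := by
  filter_upwards [hX, hunit, hA', hb', hgh] with q h1 h2 h3 h4 h5
  funext i
  have e : (A' q *ᵥ fun i => h q * X q i) i
      = h q * f q * (A q *ᵥ X q) i + h q * k q * w q i * (w q ⬝ᵥ X q) := by
    simp only [Matrix.mulVec, dotProduct, h3, Finset.mul_sum, ← Finset.sum_add_distrib]
    exact Finset.sum_congr rfl fun l _ => by ring
  rw [e, h1, h2, h4, h5]
  ring

include hsym hA' in
theorem symm_of_pairChange : ∀ᶠ q in nhds p, ∀ i j, A' q i j = A' q j i := by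
  filter_upwards [hsym, hA'] with q h1 h2 i j
  rw [h2, h2, h1 i j, mul_comm (w q i)]

include hA hXd hX hf hk hA' in
theorem differentiableAt_of_pairChange (i j : Fin n) :
    DifferentiableAt ℝ (fun q => A' q i j) p := by
  have hw := fun i => (hasPartials_of_dual hA hXd hX i).differentiableAt
  exact ((hf.mul (hA i j)).add (hk.mul ((hw i).mul (hw j)))).congr_of_eventuallyEq
    (hA'.mono fun q hq => hq i j)

include hA hXd hsym hpos hX hunit hclosed hf hk hh hA' hb' hgh hpos' in
/-- The tensor `r_ij` of the pair `(f a + k ω ⊗ ω, g ω)`, for a closed form `ω` of unit length. -/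
theorem rTensor_pairChange (i j : Fin n) :
    rTensor A' b' p i j = h p * f p * rTensor A w p i j
      + 1 / 2 * h p * (dirDeriv f p (X p) * A p i j + dirDeriv k p (X p) * (w p i * w p j))
      + 1 / 2 * (f p + k p) * (partialDeriv i h p * w p j + w p i * partialDeriv j h p) := by
  have hw := fun i => (hasPartials_of_dual hA hXd hX i).differentiableAt
  have hdA' : ∀ l i j, dMat A' p l i j = partialDeriv l f p * A p i j + f p * dMat A p l i j
      + (partialDeriv l k p * (w p i * w p j)
        + k p * (dVec w p l i * w p j + w p i * dVec w p l j)) := by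
    intro l i j
    exact ((((HasPartials.of_differentiableAt hf).mul (HasPartials.of_differentiableAt (hA i j))).add
      ((HasPartials.of_differentiableAt hk).mul ((HasPartials.of_differentiableAt (hw i)).mul
        (HasPartials.of_differentiableAt (hw j))))).congr_of_eventuallyEq
          (hA'.mono fun q hq => hq i j)).partialDeriv_eq l
  have hdX : ∀ l i, dVec (fun q i => h q * X q i) p l i
      = partialDeriv l h p * X p i + h p * dVec X p l i := fun l i =>
    ((HasPartials.of_differentiableAt hh).mul
      (HasPartials.of_differentiableAt (hXd i))).partialDeriv_eq l
  have hr' := two_mul_rTensor (differentiableAt_of_pairChange hA hXd hX hf hk hA')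
    (X := fun q i => h q * X q i) (fun i => hh.mul (hXd i)) (symm_of_pairChange hsym hA') hpos'
    (dual_of_pairChange hX hunit hA' hb' hgh) i j
  have hr := two_mul_rTensor hA hXd hsym hpos hX i j
  have hcl : ∀ i j, dVec w p i j = dVec w p j i := by
    intro i j
    have := hclosed i j
    rw [sTensor_eq hsym] at this
    linarith
  -- Cartan's formula: `L_X ω = d(ω(X)) + i_X dω` vanishes for a closed form of unit length.
  have hwX : ∀ i, ∑ l, (X p l * dVec w p l i + w p l * dVec X p i l) = 0 := by
    intro i
    have h1 := (HasPartials.sum Finset.univ fun l _ => (HasPartials.of_differentiableAt (hw l)).mul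
      (HasPartials.of_differentiableAt (hXd l))).partialDeriv_eq i
    have h2 := ((HasPartials.const (n := n) (p := p) 1).congr_of_eventuallyEq hunit).partialDeriv_eq i
    simp only [dotProduct] at h2
    rw [h2] at h1
    rw [h1]
    refine Finset.sum_congr rfl fun l _ => ?_
    rw [hcl l i, dVec, dVec]
    ring
  have hAX : ∀ i, ∑ l, A p i l * X p l = w p i := fun i => congrFun hX.self_of_nhds i
  have hAX' : ∀ i, ∑ l, A p l i * X p l = w p i := fun i => by
    rw [← hAX i]
    exact Finset.sum_congr rfl fun l _ => by rw [hsym.self_of_nhds i l]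
  have hwX1 : ∑ l, w p l * X p l = 1 := hunit.self_of_nhds
  have hAp := hA'.self_of_nhds
  -- Leibniz' rule for the Lie derivative of `f a + k ω⊗ω` along `h X`: the third line collects `L_X
  -- ω`, the last two the derivatives of `h`.
  have e : lieMat A' (fun q i => h q * X q i) p i j
      = h p * f p * lieMat A X p i j
        + h p * (dirDeriv f p (X p) * A p i j + dirDeriv k p (X p) * (w p i * w p j))
        + h p * k p * (w p j * ∑ l, (X p l * dVec w p l i + w p l * dVec X p i l)
          + w p i * ∑ l, (X p l * dVec w p l j + w p l * dVec X p j l))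
        + partialDeriv j h p * (f p * ∑ l, A p i l * X p l + k p * w p i * ∑ l, w p l * X p l)
        + partialDeriv i h p * (f p * ∑ l, A p l j * X p l + k p * w p j * ∑ l, w p l * X p l) := by
    simp only [lieMat, dirDeriv, hdA', hdX, hAp, Finset.mul_sum, Finset.sum_mul,
      ← Finset.sum_add_distrib]
    exact Finset.sum_congr rfl fun l _ => by ring
  rw [hwX, hwX, hAX, hAX', hwX1] at e
  rw [e, ← hr] at hr'
  linear_combination hr' / 2

include hA hXd hsym hX hclosed hg hA' hb' in
-- For closed `ω` only `dg ∧ ω` contributes to `d(g ω)`.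
theorem sTensor_pairChange (i j : Fin n) :
    sTensor A' b' p i j = 1 / 2 * (partialDeriv j g p * w p i - partialDeriv i g p * w p j) := by
  have hw := fun i => (hasPartials_of_dual hA hXd hX i).differentiableAt
  have hb : ∀ l i, dVec b' p l i = partialDeriv l g p * w p i + g p * dVec w p l i := fun l i =>
    (((HasPartials.of_differentiableAt hg).mul
      (HasPartials.of_differentiableAt (hw i))).congr_of_eventuallyEq
        (hb'.mono fun q hq => hq i)).partialDeriv_eq l
  have h1 := hclosed i j
  rw [sTensor_eq hsym] at h1
  rw [sTensor_eq (symm_of_pairChange hsym hA'), hb, hb]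
  linear_combination g p * h1

include hA hXd hsym hX hunit hclosed hg hA' hb' hgh hpos' in
theorem sForm_pairChange (i : Fin n) :
    sForm A' b' p i = 1 / 2 * h p * (partialDeriv i g p - dirDeriv g p (X p) * w p i) := by
  rw [sForm_eq hpos' (dual_of_pairChange hX hunit hA' hb' hgh)]
  simp only [sTensor_pairChange hA hXd hsym hX hclosed hg hA' hb']
  have hwX1 : ∑ l, w p l * X p l = 1 := hunit.self_of_nhds
  have : partialDeriv i g p = ∑ l, w p l * X p l * partialDeriv i g p := by
    rw [← Finset.sum_mul, hwX1, one_mul]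
  rw [dirDeriv]
  conv_rhs => rw [this]
  simp only [Finset.sum_mul, Finset.mul_sum, ← Finset.sum_sub_distrib]
  exact Finset.sum_congr rfl fun l _ => by ring

end PairChange

/-! ### Invariance of the Lie derivative under coordinate changes -/

section Transition

variable {n : ℕ}

theorem dirDeriv_eq_fderiv (f : Coord n → ℝ) (p : Coord n) (v : Fin n → ℝ) :
    dirDeriv f p v = fderiv ℝ f p (WithLp.toLp 2 v) := by
  conv_rhs => rw [clm_eq_sum (fderiv ℝ f p)]
  simp [dirDeriv, partialDeriv, mul_comm]

theorem dirDeriv_eq_of_hasFDerivAt {f : Coord n → ℝ} {L : Coord n →L[ℝ] ℝ} {p : Coord n}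
    (h : HasFDerivAt f L p) (v : Fin n → ℝ) : dirDeriv f p v = L (WithLp.toLp 2 v) := by
  rw [dirDeriv_eq_fderiv, h.fderiv]

variable {A A₂ : Coord n → Matrix (Fin n) (Fin n) ℝ} {X X₂ : Coord n → Fin n → ℝ}
  {p : Coord n} {τ : Coord n → Coord n}

theorem lieMat_quadratic (hA : ∀ i j, DifferentiableAt ℝ (fun q => A q i j) p)
    (hs : ∀ i j, A p i j = A p j i) (u : Fin n → ℝ) :
    u ⬝ᵥ Matrix.of (lieMat A X p) *ᵥ u = dirDeriv (fun q => u ⬝ᵥ A q *ᵥ u) p (X p)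
      + 2 * (u ⬝ᵥ A p *ᵥ fun l => dirDeriv (fun q => X q l) p u) := by
  have e1 : dirDeriv (fun q => u ⬝ᵥ A q *ᵥ u) p (X p)
      = ∑ i, ∑ j, ∑ l, X p l * dMat A p l i j * u i * u j := by
    simp only [dirDeriv, (hasPartials_quadratic_base hA u).partialDeriv_eq]
    simp only [Matrix.mulVec, dotProduct, Finset.mul_sum]
    rw [Finset.sum_comm]
    refine Finset.sum_congr rfl fun i _ => ?_
    rw [Finset.sum_comm]
    exact Finset.sum_congr rfl fun j _ => Finset.sum_congr rfl fun l _ => by ring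
  have e2 : (u ⬝ᵥ A p *ᵥ fun l => dirDeriv (fun q => X q l) p u)
      = ∑ i, ∑ j, ∑ l, A p i l * dVec X p j l * u i * u j := by
    simp only [Matrix.mulVec, dotProduct, Finset.mul_sum, dirDeriv]
    refine Finset.sum_congr rfl fun i _ => ?_
    rw [Finset.sum_comm]
    exact Finset.sum_congr rfl fun j _ => Finset.sum_congr rfl fun l _ => by
      rw [dVec]; ring
  have e3 : ∑ i, ∑ j, ∑ l, A p l j * dVec X p i l * u i * u j
      = ∑ i, ∑ j, ∑ l, A p i l * dVec X p j l * u i * u j := by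
    rw [Finset.sum_comm]
    exact Finset.sum_congr rfl fun j _ => Finset.sum_congr rfl fun i _ =>
      Finset.sum_congr rfl fun l _ => by rw [hs l j]; ring
  have e4 : u ⬝ᵥ Matrix.of (lieMat A X p) *ᵥ u
      = ∑ i, ∑ j, ∑ l, X p l * dMat A p l i j * u i * u j
        + ∑ i, ∑ j, ∑ l, A p i l * dVec X p j l * u i * u j
        + ∑ i, ∑ j, ∑ l, A p l j * dVec X p i l * u i * u j := by
    simp only [Matrix.mulVec, dotProduct, lieMat, Matrix.of_apply, Finset.mul_sum, Finset.sum_mul,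
      ← Finset.sum_add_distrib]
    exact Finset.sum_congr rfl fun j _ => Finset.sum_congr rfl fun i _ =>
      Finset.sum_congr rfl fun l _ => by ring
  rw [e4, e3, e2, e1]
  ring

/-- The Lie derivative of a metric is a tensor. -/
theorem lieMat_transition (hA : ∀ i j, DifferentiableAt ℝ (fun q => A q i j) p)
    (hs : ∀ i j, A p i j = A p j i)
    (hA₂ : ∀ i j, DifferentiableAt ℝ (fun q => A₂ q i j) (τ p))
    (hs₂ : ∀ i j, A₂ (τ p) i j = A₂ (τ p) j i)
    (hX : ∀ i, DifferentiableAt ℝ (fun q => X q i) p)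
    (hX₂ : ∀ i, DifferentiableAt ℝ (fun q => X₂ q i) (τ p))
    (hτ : ContDiffAt ℝ 2 τ p)
    (hAA : ∀ᶠ q in nhds p, ∀ u v : Coord n, u.ofLp ⬝ᵥ A q *ᵥ v.ofLp
      = (fderiv ℝ τ q u).ofLp ⬝ᵥ A₂ (τ q) *ᵥ (fderiv ℝ τ q v).ofLp)
    (hXX : ∀ᶠ q in nhds p, X₂ (τ q) = (fderiv ℝ τ q (WithLp.toLp 2 (X q))).ofLp) (u : Coord n) :
    u.ofLp ⬝ᵥ Matrix.of (lieMat A X p) *ᵥ u.ofLp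
      = (fderiv ℝ τ p u).ofLp ⬝ᵥ Matrix.of (lieMat A₂ X₂ (τ p)) *ᵥ (fderiv ℝ τ p u).ofLp := by
  have hT : HasFDerivAt τ (fderiv ℝ τ p) p := (hτ.differentiableAt (by norm_num)).hasFDerivAt
  have hT2 : HasFDerivAt (fderiv ℝ τ) (fderiv ℝ (fderiv ℝ τ) p) p :=
    ((hτ.fderiv_right (m := 1) (by norm_num)).differentiableAt (by norm_num)).hasFDerivAt
  have hsymm := hτ.isSymmSndFDerivAt (by simp)
  set T := fderiv ℝ τ p with hTdef
  set D := fderiv ℝ (fderiv ℝ τ) p with hD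
  set Y : Coord n := T u with hY
  have hYi : ∀ i, HasFDerivAt (fun q => (fderiv ℝ τ q u) i)
      ((EuclideanSpace.proj i : Coord n →L[ℝ] ℝ) ∘L (D.flip u)) p := fun i =>
    ((EuclideanSpace.proj i : Coord n →L[ℝ] ℝ).hasFDerivAt).comp p (hT2.clm_apply (hasFDerivAt_const u p) |>.congr_fderiv (by ext; simp))
  have hAi : ∀ i j, HasFDerivAt (fun q => A₂ (τ q) i j)
      ((fderiv ℝ (fun q => A₂ q i j) (τ p)) ∘L T) p := fun i j =>
    (hA₂ i j).hasFDerivAt.comp p hT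
  set V : Coord n := WithLp.toLp 2 (X p) with hV
  have hXp : WithLp.toLp 2 (X₂ (τ p)) = T V := by
    rw [hXX.self_of_nhds]
  -- the derivative of the metric
  have d1 : dirDeriv (fun q => u.ofLp ⬝ᵥ A q *ᵥ u.ofLp) p (X p)
      = dirDeriv (fun q => Y.ofLp ⬝ᵥ A₂ q *ᵥ Y.ofLp) (τ p) (X₂ (τ p))
        + 2 * (Y.ofLp ⬝ᵥ A₂ (τ p) *ᵥ (D V u).ofLp) := by
    have h := (HasFDerivAt.fun_sum (u := Finset.univ) fun i _ => (hYi i).mul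
      (HasFDerivAt.fun_sum (u := Finset.univ) fun j _ => (hAi i j).mul (hYi j)))
    have h' := h.congr_of_eventuallyEq (hAA.mono fun q hq => hq u u)
    have h2 := HasFDerivAt.fun_sum (u := Finset.univ) fun i _ =>
      (HasFDerivAt.fun_sum (u := Finset.univ) fun j _ =>
        ((hA₂ i j).hasFDerivAt.mul_const (Y j))).const_mul (Y i)
    rw [dirDeriv_eq_of_hasFDerivAt h',
      dirDeriv_eq_of_hasFDerivAt (f := fun q => Y.ofLp ⬝ᵥ A₂ q *ᵥ Y.ofLp) h2, hXp, ← hV]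
    have e : (Y.ofLp ⬝ᵥ A₂ (τ p) *ᵥ (D V u).ofLp) = ((D V u).ofLp ⬝ᵥ A₂ (τ p) *ᵥ Y.ofLp) := by
      rw [Matrix.dotProduct_mulVec, ← Matrix.mulVec_transpose, dotProduct_comm]
      congr 2
      ext i j
      exact hs₂ j i
    rw [two_mul]
    conv_rhs => rw [← add_assoc]; arg 2; rw [e]
    simp only [Matrix.mulVec, dotProduct]
    simp [Finset.mul_sum, Finset.sum_mul, ← Finset.sum_add_distrib]
    simp only [← hTdef, ← hY]
    exact Finset.sum_congr rfl fun i _ => Finset.sum_congr rfl fun j _ => by ring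
  -- Differentiating `X₂ ∘ τ = Dτ(X)` along `u` produces the second derivative `D u V`, to be set
  -- against `D V u` from the metric.
  have d2 : (u.ofLp ⬝ᵥ A p *ᵥ fun l => dirDeriv (fun q => X q l) p u.ofLp)
      = Y.ofLp ⬝ᵥ A₂ (τ p) *ᵥ (fun l => dirDeriv (fun q => X₂ q l) (τ p) Y.ofLp)
        - Y.ofLp ⬝ᵥ A₂ (τ p) *ᵥ (D u V).ofLp := by
    have hXL : HasFDerivAt (fun q => WithLp.toLp 2 (X q)) (fderiv ℝ (fun q => WithLp.toLp 2 (X q)) p) p := by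
      refine DifferentiableAt.hasFDerivAt ?_
      rw [differentiableAt_euclidean]
      exact hX
    set L := fderiv ℝ (fun q => WithLp.toLp 2 (X q)) p with hL
    have c1 : ∀ l, dirDeriv (fun q => X q l) p u.ofLp = (L u) l := by
      intro l
      have := ((EuclideanSpace.proj l : Coord n →L[ℝ] ℝ).hasFDerivAt).comp p hXL
      exact dirDeriv_eq_of_hasFDerivAt (f := fun q => X q l) this u.ofLp
    have c2 : ∀ l, dirDeriv (fun q => X₂ q l) (τ p) Y.ofLp = (D u V) l + (T (L u)) l := by
      intro l
      have h1 := (hX₂ l).hasFDerivAt.comp p hT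
      have h2 := ((EuclideanSpace.proj l : Coord n →L[ℝ] ℝ).hasFDerivAt).comp p (hT2.clm_apply hXL)
      have h3 := h2.congr_of_eventuallyEq (f₁ := fun q => X₂ (τ q) l)
        (hXX.mono fun q hq => congrFun hq l)
      have h4 := DFunLike.congr_fun (h1.unique h3) u
      rw [dirDeriv_eq_fderiv]
      simp at h4
      rw [h4]
      exact add_comm _ _
    simp only [c1, c2]
    have h := hAA.self_of_nhds u (L u)
    rw [← dotProduct_sub, ← Matrix.mulVec_sub]
    refine h.trans ?_
    congr 2
    funext l
    simp [← hTdef]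
  -- The two second-derivative terms cancel because `D` is symmetric.
  rw [lieMat_quadratic hA hs, lieMat_quadratic hA₂ hs₂, d1, d2, hsymm V u]
  ring

end Transition

/-! ### Components in charts and their transformation -/

section Charts

variable {n : ℕ} {M : Type*} [TopologicalSpace M] [ChartedSpace (Coord n) M]
  {φ ψ : OpenPartialHomeomorph M (Coord n)} {p : Coord n}

/-- The components `b^i = a^ij b_j` of the vector field dual to `β`. -/
def chartDual (φ : OpenPartialHomeomorph M (Coord n)) (a : BilinField n M) (β : OneForm n M)
    (p : Coord n) : Fin n → ℝ :=
  (metricComp φ a p)⁻¹ *ᵥ formComp φ β p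

theorem euclidean_eq_sum (v : Coord n) : v = ∑ i, v i • (stdVec i : Coord n) := by
  ext j
  simp [stdVec, Pi.single_apply]

theorem bilin_eq_dotProduct (B : Coord n →L[ℝ] Coord n →L[ℝ] ℝ) (L : Coord n →L[ℝ] Coord n)
    (v w : Coord n) :
    B (L v) (L w) = v.ofLp ⬝ᵥ (Matrix.of fun i j => B (L (stdVec i)) (L (stdVec j))) *ᵥ w.ofLp := by
  conv_lhs => rw [euclidean_eq_sum v, euclidean_eq_sum w]
  simp [Matrix.mulVec, dotProduct, Finset.mul_sum]
  rw [Finset.sum_comm]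
  exact Finset.sum_congr rfl fun i _ => Finset.sum_congr rfl fun j _ => by ring

theorem linear_eq_dotProduct (B : Coord n →L[ℝ] ℝ) (L : Coord n →L[ℝ] Coord n) (v : Coord n) :
    B (L v) = (fun i => B (L (stdVec i))) ⬝ᵥ v.ofLp := by
  conv_lhs => rw [euclidean_eq_sum v]
  simp [dotProduct, mul_comm]

theorem metric_coordVec (φ : OpenPartialHomeomorph M (Coord n)) (a : BilinField n M)
    (p v w : Coord n) :
    a (φ.symm p) (coordVec φ p v) (coordVec φ p w) = v.ofLp ⬝ᵥ metricComp φ a p *ᵥ w.ofLp :=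
  bilin_eq_dotProduct (a (φ.symm p)) (mfderiv (𝓡 n) (𝓡 n) φ.symm p) v w

theorem form_coordVec (φ : OpenPartialHomeomorph M (Coord n)) (β : OneForm n M) (p v : Coord n) :
    β (φ.symm p) (coordVec φ p v) = formComp φ β p ⬝ᵥ v.ofLp :=
  linear_eq_dotProduct (β (φ.symm p)) (mfderiv (𝓡 n) (𝓡 n) φ.symm p) v

theorem mdifferentiable_of_mem_maximalAtlas (hφ : φ ∈ IsManifold.maximalAtlas (𝓡 n) ∞ M) :
    φ.MDifferentiable (𝓡 n) (𝓡 n) :=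
  ⟨(contMDiffOn_of_mem_maximalAtlas hφ).mdifferentiableOn (by simp),
    (contMDiffOn_symm_of_mem_maximalAtlas hφ).mdifferentiableOn (by simp)⟩

theorem coordVec_bijective (hφ : φ ∈ IsManifold.maximalAtlas (𝓡 n) ∞ M) (hp : p ∈ φ.target) :
    Function.Bijective (coordVec φ p) :=
  (mdifferentiable_of_mem_maximalAtlas hφ).symm.mfderiv_bijective hp

section Pointwise

variable {a : BilinField n M} {β : OneForm n M} {x : M}

theorem isUnit_det_of_posDef {A : Matrix (Fin n) (Fin n) ℝ}
    (h : ∀ v, v ≠ 0 → 0 < v ⬝ᵥ A *ᵥ v) : IsUnit A.det :=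
  isUnit_det_of_pos (A := fun _ => A) (p := 0) (Filter.Eventually.of_forall fun _ => h)

theorem gram_pos (hpos : ∀ v, v ≠ 0 → 0 < a x v v) {L : Coord n →L[ℝ] Coord n}
    (hL : Function.Injective L) (v : Fin n → ℝ) (hv : v ≠ 0) :
    0 < v ⬝ᵥ (Matrix.of fun i j => (a x (L (stdVec i)) (L (stdVec j)) : ℝ)) *ᵥ v := by
  have h := bilin_eq_dotProduct (a x) L (WithLp.toLp 2 v) (WithLp.toLp 2 v)
  refine lt_of_lt_of_eq (hpos (L (WithLp.toLp 2 v)) fun h0 => hv ?_) h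
  have h1 : L (WithLp.toLp 2 v) = L 0 := by rw [map_zero]; exact h0
  simpa using hL h1

/-- `b²` is the value of the form on the dual vector. -/
theorem normSq_eq_of_dual (hsymm : ∀ v w, a x v w = a x w v) (hpos : ∀ v, v ≠ 0 → 0 < a x v v)
    {Y : TangentSpace (𝓡 n) x} (hY : ∀ w, a x Y w = β x w) : normSq a β x = β x Y := by
  set G : Matrix (Fin n) (Fin n) ℝ :=
    Matrix.of fun k l : Fin n => a x (tangentBasis x k) (tangentBasis x l) with hG
  set y : Coord n := Y
  have hb : (fun i => β x (tangentBasis x i)) = G *ᵥ y.ofLp := by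
    funext i
    rw [← hY, hsymm]
    have := bilin_eq_dotProduct (a x) (ContinuousLinearMap.id ℝ (Coord n)) (stdVec i) y
    refine this.trans ?_
    change (stdVec i : Coord n).ofLp ⬝ᵥ G *ᵥ y.ofLp = _
    simp [stdVec]
  have hdet : IsUnit G.det := isUnit_det_of_posDef
    (gram_pos hpos (L := ContinuousLinearMap.id ℝ (Coord n)) fun _ _ h => h)
  have h1 : normSq a β x = (fun i => β x (tangentBasis x i)) ⬝ᵥ G⁻¹ *ᵥ
      (fun i => β x (tangentBasis x i)) := by
    simp only [normSq, dotProduct, Matrix.mulVec, Finset.mul_sum]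
    exact Finset.sum_congr rfl fun i _ => Finset.sum_congr rfl fun j _ => by rw [hG]; ring
  rw [h1]
  conv_lhs => arg 2; rw [hb]
  rw [Matrix.mulVec_mulVec, Matrix.nonsing_inv_mul _ hdet, Matrix.one_mulVec]
  exact (linear_eq_dotProduct (β x) (ContinuousLinearMap.id ℝ (Coord n)) y).symm

theorem exists_dual (hsymm : ∀ v w, a x v w = a x w v) (hpos : ∀ v, v ≠ 0 → 0 < a x v v)
    (β : OneForm n M) : ∃ Y : TangentSpace (𝓡 n) x, ∀ w, a x Y w = β x w := by
  set G : Matrix (Fin n) (Fin n) ℝ :=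
    Matrix.of fun k l : Fin n => a x (tangentBasis x k) (tangentBasis x l) with hG
  have hdet : IsUnit G.det := isUnit_det_of_posDef
    (gram_pos hpos (L := ContinuousLinearMap.id ℝ (Coord n)) fun _ _ h => h)
  set c : Fin n → ℝ := fun i => β x (tangentBasis x i) with hc
  refine ⟨(WithLp.toLp 2 (G⁻¹ *ᵥ c) : Coord n), fun w => (hsymm _ _).trans ?_⟩
  have h1 := bilin_eq_dotProduct (a x) (ContinuousLinearMap.id ℝ (Coord n)) w
    (WithLp.toLp 2 (G⁻¹ *ᵥ c))
  have h2 := linear_eq_dotProduct (β x) (ContinuousLinearMap.id ℝ (Coord n)) w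
  refine h1.trans (Eq.trans ?_ h2.symm)
  change w.ofLp ⬝ᵥ G *ᵥ (G⁻¹ *ᵥ c) = c ⬝ᵥ w.ofLp
  rw [Matrix.mulVec_mulVec, Matrix.mul_nonsing_inv _ hdet, Matrix.one_mulVec, dotProduct_comm]

theorem metricComp_pos (hφ : φ ∈ IsManifold.maximalAtlas (𝓡 n) ∞ M) (hp : p ∈ φ.target)
    (hpos : ∀ v, v ≠ 0 → 0 < a (φ.symm p) v v) (v : Fin n → ℝ) (hv : v ≠ 0) :
    0 < v ⬝ᵥ metricComp φ a p *ᵥ v :=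
  gram_pos hpos (L := mfderiv (𝓡 n) (𝓡 n) φ.symm p) (coordVec_bijective hφ hp).1 v hv

theorem metricComp_mulVec_chartDual (hφ : φ ∈ IsManifold.maximalAtlas (𝓡 n) ∞ M)
    (hp : p ∈ φ.target) (hpos : ∀ v, v ≠ 0 → 0 < a (φ.symm p) v v) :
    metricComp φ a p *ᵥ chartDual φ a β p = formComp φ β p := by
  rw [chartDual, Matrix.mulVec_mulVec,
    Matrix.mul_nonsing_inv _ (isUnit_det_of_posDef (metricComp_pos hφ hp hpos)), Matrix.one_mulVec]

theorem dual_coordVec_chartDual (hφ : φ ∈ IsManifold.maximalAtlas (𝓡 n) ∞ M)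
    (hp : p ∈ φ.target) (hsymm : ∀ v w, a (φ.symm p) v w = a (φ.symm p) w v)
    (hpos : ∀ v, v ≠ 0 → 0 < a (φ.symm p) v v) (w : TangentSpace (𝓡 n) (φ.symm p)) :
    a (φ.symm p) (coordVec φ p (WithLp.toLp 2 (chartDual φ a β p))) w = β (φ.symm p) w := by
  obtain ⟨u, rfl⟩ := (coordVec_bijective hφ hp).2 w
  rw [hsymm, metric_coordVec, form_coordVec]
  change u.ofLp ⬝ᵥ metricComp φ a p *ᵥ chartDual φ a β p = _
  rw [metricComp_mulVec_chartDual hφ hp hpos, dotProduct_comm]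

/-- Both the definition in the standard basis and the chart expression compute the value of `β` on
its dual vector. -/
theorem normSq_chart (hφ : φ ∈ IsManifold.maximalAtlas (𝓡 n) ∞ M) (hp : p ∈ φ.target)
    (hsymm : ∀ v w, a (φ.symm p) v w = a (φ.symm p) w v)
    (hpos : ∀ v, v ≠ 0 → 0 < a (φ.symm p) v v) :
    normSq a β (φ.symm p) = formComp φ β p ⬝ᵥ chartDual φ a β p := by
  rw [normSq_eq_of_dual hsymm hpos (dual_coordVec_chartDual hφ hp hsymm hpos), form_coordVec]

end Pointwise

section TransitionMaps

theorem contDiffAt_transition (hφ : φ ∈ IsManifold.maximalAtlas (𝓡 n) ∞ M)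
    (hψ : ψ ∈ IsManifold.maximalAtlas (𝓡 n) ∞ M) (hp : p ∈ φ.target)
    (hp' : φ.symm p ∈ ψ.source) : ContDiffAt ℝ ∞ (ψ ∘ φ.symm) p := by
  rw [← contMDiffAt_iff_contDiffAt]
  exact (contMDiffAt_of_mem_maximalAtlas hψ hp').comp p (contMDiffAt_symm_of_mem_maximalAtlas hφ hp)

theorem fderiv_transition (hφ : φ ∈ IsManifold.maximalAtlas (𝓡 n) ∞ M)
    (hψ : ψ ∈ IsManifold.maximalAtlas (𝓡 n) ∞ M) (hp : p ∈ φ.target)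
    (hp' : φ.symm p ∈ ψ.source) (v : Coord n) :
    fderiv ℝ (ψ ∘ φ.symm) p v
      = mfderiv (𝓡 n) (𝓡 n) ψ (φ.symm p) (coordVec φ p v) := by
  rw [← mfderiv_eq_fderiv]
  have := mfderiv_comp (I := 𝓡 n) (I' := 𝓡 n) (I'' := 𝓡 n) p
    ((mdifferentiable_of_mem_maximalAtlas hψ).mdifferentiableAt hp')
    ((mdifferentiable_of_mem_maximalAtlas hφ).mdifferentiableAt_symm hp)
  exact DFunLike.congr_fun this v

theorem coordVec_transition (hφ : φ ∈ IsManifold.maximalAtlas (𝓡 n) ∞ M)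
    (hψ : ψ ∈ IsManifold.maximalAtlas (𝓡 n) ∞ M) (hp : p ∈ φ.target)
    (hp' : φ.symm p ∈ ψ.source) (v : Coord n) :
    (coordVec ψ (ψ (φ.symm p)) (fderiv ℝ (ψ ∘ φ.symm) p v) : Coord n) = coordVec φ p v := by
  rw [fderiv_transition hφ hψ hp hp']
  exact DFunLike.congr_fun ((mdifferentiable_of_mem_maximalAtlas hψ).symm_comp_deriv hp')
    (coordVec φ p v)

theorem fderiv_transition_bijective (hφ : φ ∈ IsManifold.maximalAtlas (𝓡 n) ∞ M)
    (hψ : ψ ∈ IsManifold.maximalAtlas (𝓡 n) ∞ M) (hp : p ∈ φ.target)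
    (hp' : φ.symm p ∈ ψ.source) : Function.Bijective (fderiv ℝ (ψ ∘ φ.symm) p) := by
  have h := ((mdifferentiable_of_mem_maximalAtlas hψ).mfderiv_bijective hp').comp
    (coordVec_bijective hφ hp)
  have e : ⇑(fderiv ℝ (ψ ∘ φ.symm) p) = fun v => mfderiv (𝓡 n) (𝓡 n) ψ (φ.symm p) (coordVec φ p v) :=
    funext fun v => fderiv_transition hφ hψ hp hp' v
  rw [e]
  exact h

variable {a : BilinField n M} {β : OneForm n M}

theorem metricComp_transition (hφ : φ ∈ IsManifold.maximalAtlas (𝓡 n) ∞ M)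
    (hψ : ψ ∈ IsManifold.maximalAtlas (𝓡 n) ∞ M) (hp : p ∈ φ.target)
    (hp' : φ.symm p ∈ ψ.source) (v w : Coord n) :
    v.ofLp ⬝ᵥ metricComp φ a p *ᵥ w.ofLp = (fderiv ℝ (ψ ∘ φ.symm) p v).ofLp ⬝ᵥ
      metricComp ψ a ((ψ ∘ φ.symm) p) *ᵥ (fderiv ℝ (ψ ∘ φ.symm) p w).ofLp := by
  rw [← metric_coordVec, ← metric_coordVec]
  have key : ∀ (y : M) (_ : y = φ.symm p) (V W V' W' : Coord n), V = V' → W = W' →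
      (a (φ.symm p) : Coord n →L[ℝ] Coord n →L[ℝ] ℝ) V W
        = (a y : Coord n →L[ℝ] Coord n →L[ℝ] ℝ) V' W' := by
    rintro _ rfl V W _ _ rfl rfl
    rfl
  exact key _ (ψ.left_inv hp') _ _ _ _ (coordVec_transition hφ hψ hp hp' v).symm
    (coordVec_transition hφ hψ hp hp' w).symm

theorem formComp_transition (hφ : φ ∈ IsManifold.maximalAtlas (𝓡 n) ∞ M)
    (hψ : ψ ∈ IsManifold.maximalAtlas (𝓡 n) ∞ M) (hp : p ∈ φ.target)
    (hp' : φ.symm p ∈ ψ.source) (v : Coord n) :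
    formComp φ β p ⬝ᵥ v.ofLp
      = formComp ψ β ((ψ ∘ φ.symm) p) ⬝ᵥ (fderiv ℝ (ψ ∘ φ.symm) p v).ofLp := by
  rw [← form_coordVec, ← form_coordVec]
  have key : ∀ (y : M) (_ : y = φ.symm p) (V V' : Coord n), V = V' →
      (β (φ.symm p) : Coord n →L[ℝ] ℝ) V = (β y : Coord n →L[ℝ] ℝ) V' := by
    rintro _ rfl V _ rfl
    rfl
  exact key _ (ψ.left_inv hp') _ _ (coordVec_transition hφ hψ hp hp' v).symm

/-- The dual field is the unique solution of `A X = b`, and the transported vector solves this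
equation in the second chart. -/
theorem chartDual_transition (hφ : φ ∈ IsManifold.maximalAtlas (𝓡 n) ∞ M)
    (hψ : ψ ∈ IsManifold.maximalAtlas (𝓡 n) ∞ M) (hp : p ∈ φ.target)
    (hp' : φ.symm p ∈ ψ.source) (ha : IsRiemannianOn Set.univ a) :
    chartDual ψ a β ((ψ ∘ φ.symm) p)
      = (fderiv ℝ (ψ ∘ φ.symm) p (WithLp.toLp 2 (chartDual φ a β p))).ofLp := by
  set T := fderiv ℝ (ψ ∘ φ.symm) p with hT
  have hpt : (ψ ∘ φ.symm) p ∈ ψ.target := ψ.map_source hp'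
  have hposψ := metricComp_pos hψ hpt (ha.pos _ trivial)
  have h1 : metricComp ψ a ((ψ ∘ φ.symm) p) *ᵥ (T (WithLp.toLp 2 (chartDual φ a β p))).ofLp
      = formComp ψ β ((ψ ∘ φ.symm) p) := by
    refine (dotProduct_eq_iff.1 fun w => ?_)
    obtain ⟨u, hu⟩ := (fderiv_transition_bijective hφ hψ hp hp').2 (WithLp.toLp 2 w)
    have hw : w = (T u).ofLp := by rw [hT, hu]
    rw [hw, ← formComp_transition hφ hψ hp hp', dotProduct_comm,
      ← metricComp_transition hφ hψ hp hp', metricComp_mulVec_chartDual hφ hp (ha.pos _ trivial),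
      dotProduct_comm]
  rw [chartDual, ← h1, Matrix.mulVec_mulVec,
    Matrix.nonsing_inv_mul _ (isUnit_det_of_posDef hposψ), Matrix.one_mulVec]

end TransitionMaps

end Charts

/-! ### Smoothness of components and of `b²` -/

section Smoothness

variable {n : ℕ}

theorem contDiffAt_det {A : Coord n → Matrix (Fin n) (Fin n) ℝ} {p : Coord n}
    (hA : ∀ i j, ContDiffAt ℝ ∞ (fun q => A q i j) p) : ContDiffAt ℝ ∞ (fun q => (A q).det) p := by
  simp only [Matrix.det_apply']
  exact ContDiffAt.sum fun σ _ => contDiffAt_const.mul (contDiffAt_prod fun i _ => hA _ _)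

/-- By Cramer's rule the entries of the inverse are quotients of determinants. -/
theorem contDiffAt_inv {A : Coord n → Matrix (Fin n) (Fin n) ℝ} {p : Coord n}
    (hA : ∀ i j, ContDiffAt ℝ ∞ (fun q => A q i j) p) (h : (A p).det ≠ 0) (i j : Fin n) :
    ContDiffAt ℝ ∞ (fun q => (A q)⁻¹ i j) p := by
  simp only [Matrix.inv_def, Matrix.smul_apply, Ring.inverse_eq_inv', smul_eq_mul,
    Matrix.adjugate_apply]
  refine ((contDiffAt_det hA).inv h).mul (contDiffAt_det fun k l => ?_)
  simp only [Matrix.updateRow_apply]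
  split_ifs
  · exact contDiffAt_const
  · exact hA _ _

theorem contDiffAt_partialDeriv {f : Coord n → ℝ} {p : Coord n} (hf : ContDiffAt ℝ ∞ f p)
    (i : Fin n) : ContDiffAt ℝ ∞ (partialDeriv i f) p :=
  (hf.fderiv_right (m := ∞) (by simp)).clm_apply contDiffAt_const

theorem contDiffAt_dirDeriv {f : Coord n → ℝ} {X : Coord n → Fin n → ℝ} {p : Coord n}
    (hf : ContDiffAt ℝ ∞ f p) (hX : ∀ i, ContDiffAt ℝ ∞ (fun q => X q i) p) :
    ContDiffAt ℝ ∞ (fun q => dirDeriv f q (X q)) p :=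
  ContDiffAt.sum fun i _ => (hX i).mul (contDiffAt_partialDeriv hf i)

theorem contDiffAt_lieMat {A : Coord n → Matrix (Fin n) (Fin n) ℝ} {X : Coord n → Fin n → ℝ}
    {p : Coord n} (hA : ∀ i j, ContDiffAt ℝ ∞ (fun q => A q i j) p)
    (hX : ∀ i, ContDiffAt ℝ ∞ (fun q => X q i) p) (i j : Fin n) :
    ContDiffAt ℝ ∞ (fun q => lieMat A X q i j) p :=
  ContDiffAt.sum fun l _ => (((hX l).mul (contDiffAt_partialDeriv (hA i j) l)).add
    ((hA i l).mul (contDiffAt_partialDeriv (hX l) j))).add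
      ((hA l j).mul (contDiffAt_partialDeriv (hX l) i))

variable {M : Type*} [TopologicalSpace M] [ChartedSpace (Coord n) M]
  {φ ψ : OpenPartialHomeomorph M (Coord n)} {p : Coord n} {a : BilinField n M} {β : OneForm n M}

omit [ChartedSpace (Coord n) M] in
theorem eventually_mem_chart (hp : p ∈ φ.target) {U : Set M} (hU : IsOpen U) (hpU : φ.symm p ∈ U) :
    ∀ᶠ q in nhds p, q ∈ φ.target ∧ φ.symm q ∈ U :=
  (φ.symm.isOpen_inter_preimage hU).mem_nhds ⟨hp, hpU⟩

/-- What is needed about the components of a pair at a point of a chart. -/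
structure IsPairAt (A : Coord n → Matrix (Fin n) (Fin n) ℝ) (b X : Coord n → Fin n → ℝ)
    (p : Coord n) : Prop where
  metric : ∀ i j, ContDiffAt ℝ ∞ (fun q => A q i j) p
  form : ∀ i, ContDiffAt ℝ ∞ (fun q => b q i) p
  field : ∀ i, ContDiffAt ℝ ∞ (fun q => X q i) p
  symm : ∀ᶠ q in nhds p, ∀ i j, A q i j = A q j i
  pos : ∀ᶠ q in nhds p, ∀ v, v ≠ 0 → 0 < v ⬝ᵥ A q *ᵥ v
  dual : ∀ᶠ q in nhds p, A q *ᵥ X q = b q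

theorem IsPairAt.metric_diff {A : Coord n → Matrix (Fin n) (Fin n) ℝ} {b X : Coord n → Fin n → ℝ}
    (h : IsPairAt A b X p) (i j : Fin n) : DifferentiableAt ℝ (fun q => A q i j) p :=
  (h.metric i j).differentiableAt (by simp)

theorem IsPairAt.form_diff {A : Coord n → Matrix (Fin n) (Fin n) ℝ} {b X : Coord n → Fin n → ℝ}
    (h : IsPairAt A b X p) (i : Fin n) : DifferentiableAt ℝ (fun q => b q i) p :=
  (h.form i).differentiableAt (by simp)

theorem IsPairAt.field_diff {A : Coord n → Matrix (Fin n) (Fin n) ℝ} {b X : Coord n → Fin n → ℝ}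
    (h : IsPairAt A b X p) (i : Fin n) : DifferentiableAt ℝ (fun q => X q i) p :=
  (h.field i).differentiableAt (by simp)

theorem isPairAt_chart {U : Set M} (hU : IsOpen U) (ha : IsRiemannianOn U a)
    (hβ : IsSmoothFormOn U β) (hφ : φ ∈ IsManifold.maximalAtlas (𝓡 n) ∞ M) (hp : p ∈ φ.target)
    (hpU : φ.symm p ∈ U) : IsPairAt (metricComp φ a) (formComp φ β) (chartDual φ a β) p := by
  have hev := eventually_mem_chart hp hU hpU
  have hA : ∀ i j, ContDiffAt ℝ ∞ (fun q => metricComp φ a q i j) p := fun i j =>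
    (ha.smooth φ hφ i j).contDiffAt hev
  have hb : ∀ i, ContDiffAt ℝ ∞ (fun q => formComp φ β q i) p := fun i =>
    (hβ φ hφ i).contDiffAt hev
  have hpos : ∀ᶠ q in nhds p, ∀ v, v ≠ 0 → 0 < v ⬝ᵥ metricComp φ a q *ᵥ v :=
    hev.mono fun q hq => metricComp_pos hφ hq.1 (ha.pos _ hq.2)
  refine ⟨hA, hb, fun i => ?_, hev.mono fun q hq i j => ha.symm _ hq.2 _ _, hpos,
    hev.mono fun q hq => metricComp_mulVec_chartDual hφ hq.1 (ha.pos _ hq.2)⟩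
  simp only [chartDual, Matrix.mulVec, dotProduct]
  exact ContDiffAt.sum fun j _ =>
    (contDiffAt_inv hA (isUnit_det_of_posDef hpos.self_of_nhds).ne_zero i j).mul (hb j)

theorem normSq_chart_eventuallyEq {U : Set M} (hU : IsOpen U) (ha : IsRiemannianOn U a)
    (hφ : φ ∈ IsManifold.maximalAtlas (𝓡 n) ∞ M) (hp : p ∈ φ.target) (hpU : φ.symm p ∈ U) :
    (fun q => normSq a β (φ.symm q)) =ᶠ[nhds p] fun q => formComp φ β q ⬝ᵥ chartDual φ a β q :=
  (eventually_mem_chart hp hU hpU).mono fun _q hq =>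
    normSq_chart hφ hq.1 (ha.symm _ hq.2) (ha.pos _ hq.2)

/-- `f` is smooth on `U` in all charts. -/
def IsSmoothFunOn (U : Set M) (f : M → ℝ) : Prop :=
  ∀ φ ∈ IsManifold.maximalAtlas (𝓡 n) ∞ M, ∀ p ∈ φ.target, φ.symm p ∈ U →
    ContDiffAt ℝ ∞ (fun q => f (φ.symm q)) p

theorem isSmoothFunOn_normSq {U : Set M} (hU : IsOpen U) (ha : IsRiemannianOn U a)
    (hβ : IsSmoothFormOn U β) : IsSmoothFunOn (n := n) U (normSq a β) := by
  intro φ hφ p hp hpU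
  have h := isPairAt_chart hU ha hβ hφ hp hpU
  refine ContDiffAt.congr_of_eventuallyEq ?_ (normSq_chart_eventuallyEq hU ha hφ hp hpU)
  exact ContDiffAt.sum fun i _ => (h.form i).mul (h.field i)

theorem IsSmoothFunOn.comp {U : Set M} {f : M → ℝ} (hf : IsSmoothFunOn (n := n) U f) {g : ℝ → ℝ}
    (hg : ∀ x ∈ U, ContDiffAt ℝ ∞ g (f x)) : IsSmoothFunOn (n := n) U fun x => g (f x) :=
  fun φ hφ p hp hpU => ContDiffAt.comp p (hg _ hpU) (hf φ hφ p hp hpU)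

end Smoothness

/-! ### The fields `f a + k θ⊗θ` and `g θ` -/

section PairFields

variable {n : ℕ} {M : Type*} [TopologicalSpace M] [ChartedSpace (Coord n) M]
  {φ : OpenPartialHomeomorph M (Coord n)} {p : Coord n} {a : BilinField n M} {θ : OneForm n M}
  {f k g h : M → ℝ} {U : Set M}

/-- The field of bilinear forms `f a + k θ ⊗ θ`. -/
def pairMetric (f k : M → ℝ) (a : BilinField n M) (θ : OneForm n M) : BilinField n M :=
  fun x => f x • a x + k x • (θ x).smulRight (θ x)

/-- The `1`-form `g θ`. -/
def pairForm (g : M → ℝ) (θ : OneForm n M) : OneForm n M := fun x => g x • θ x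

@[simp]
theorem pairMetric_apply (x : M) (v w : TangentSpace (𝓡 n) x) :
    pairMetric f k a θ x v w = f x * a x v w + k x * (θ x v * θ x w) := by
  simp [pairMetric]

@[simp]
theorem pairForm_apply (x : M) (v : TangentSpace (𝓡 n) x) :
    pairForm g θ x v = g x * θ x v := by
  simp [pairForm]

theorem metricComp_pairMetric (i j : Fin n) :
    metricComp φ (pairMetric f k a θ) p i j = f (φ.symm p) * metricComp φ a p i j
      + k (φ.symm p) * (formComp φ θ p i * formComp φ θ p j) :=
  pairMetric_apply _ _ _

theorem formComp_pairForm (i : Fin n) :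
    formComp φ (pairForm g θ) p i = g (φ.symm p) * formComp φ θ p i :=
  pairForm_apply _ _

theorem isSmoothFormOn_pairForm (hθ : IsSmoothFormOn Set.univ θ)
    (hg : IsSmoothFunOn (n := n) U g) : IsSmoothFormOn U (pairForm g θ) := by
  intro φ hφ i p hp
  simp only [formComp_pairForm]
  have h1 : ContDiffAt ℝ ∞ (fun q => formComp φ θ q i) p :=
    (hθ φ hφ i).contDiffAt (eventually_mem_chart hp.1 isOpen_univ trivial)
  exact ((hg φ hφ p hp.1 hp.2).mul h1).contDiffWithinAt

theorem isRiemannianOn_pairMetric (ha : IsRiemannianOn Set.univ a)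
    (hθ : IsSmoothFormOn Set.univ θ) (hf : IsSmoothFunOn (n := n) U f)
    (hk : IsSmoothFunOn (n := n) U k)
    (hpos : ∀ x ∈ U, ∀ v, v ≠ 0 → 0 < f x * a x v v + k x * (θ x v * θ x v)) :
    IsRiemannianOn U (pairMetric f k a θ) := by
  refine ⟨fun x _ v w => ?_, fun x hx v hv => ?_, fun φ hφ i j p hp => ?_⟩
  · rw [pairMetric_apply, pairMetric_apply, ha.symm x trivial v w, mul_comm (θ x v)]
  · rw [pairMetric_apply]
    exact hpos x hx v hv
  · simp only [metricComp_pairMetric]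
    have h1 : ∀ i, ContDiffAt ℝ ∞ (fun q => formComp φ θ q i) p := fun i =>
      (hθ φ hφ i).contDiffAt (eventually_mem_chart hp.1 isOpen_univ trivial)
    have h2 : ContDiffAt ℝ ∞ (fun q => metricComp φ a q i j) p :=
      (ha.smooth φ hφ i j).contDiffAt (eventually_mem_chart hp.1 isOpen_univ trivial)
    exact (((hf φ hφ p hp.1 hp.2).mul h2).add
      ((hk φ hφ p hp.1 hp.2).mul ((h1 i).mul (h1 j)))).contDiffWithinAt

/-- Cauchy–Schwarz. -/
theorem form_sq_le {x : M} {β : OneForm n M} (hsymm : ∀ v w, a x v w = a x w v)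
    (hpos : ∀ v, v ≠ 0 → 0 < a x v v) (v : TangentSpace (𝓡 n) x) :
    β x v * β x v ≤ normSq a β x * a x v v := by
  obtain ⟨Y, hY⟩ := exists_dual hsymm hpos β
  have hN := normSq_eq_of_dual hsymm hpos hY
  have hnn : ∀ u, 0 ≤ a x u u := fun u => by
    by_cases hu : u = 0
    · simp [hu]
    · exact (hpos u hu).le
  by_cases hv : v = 0
  · simp [hv]
  have hvp := hpos v hv
  -- With `Y` the dual vector, this is `a(v,v)` times the part of `Y` orthogonal to `v`.
  have h := hnn (a x v v • Y - β x v • v)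
  have e : a x (a x v v • Y - β x v • v) (a x v v • Y - β x v • v)
      = a x v v * (normSq a β x * a x v v - β x v * β x v) := by
    simp only [map_sub, map_smul, sub_apply, smul_apply,
      smul_eq_mul, hsymm v Y, hY, hN]
    ring
  rw [e] at h
  linarith [nonneg_of_mul_nonneg_right h hvp]

theorem normSq_nonneg {x : M} {β : OneForm n M} (hsymm : ∀ v w, a x v w = a x w v)
    (hpos : ∀ v, v ≠ 0 → 0 < a x v v) : 0 ≤ normSq a β x := by
  obtain ⟨Y, hY⟩ := exists_dual hsymm hpos β
  rw [normSq_eq_of_dual hsymm hpos hY, ← hY]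
  by_cases hu : Y = 0
  · simp [hu]
  · exact (hpos Y hu).le

theorem normSq_pos {x : M} {β : OneForm n M} (hsymm : ∀ v w, a x v w = a x w v)
    (hpos : ∀ v, v ≠ 0 → 0 < a x v v) (hβ : β x ≠ 0) : 0 < normSq a β x := by
  obtain ⟨Y, hY⟩ := exists_dual hsymm hpos β
  rw [normSq_eq_of_dual hsymm hpos hY, ← hY]
  refine hpos Y ?_
  rintro rfl
  refine hβ (ContinuousLinearMap.ext fun w => ?_)
  rw [← hY]
  simp

/-- The length of `g θ` with respect to `f a + k θ ⊗ θ`. -/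
theorem normSq_pairMetric {x : M} {a' : BilinField n M} {β' β : OneForm n M}
    (hsymm : ∀ v w, a x v w = a x w v) (hpos : ∀ v, v ≠ 0 → 0 < a x v v)
    {f k g h : ℝ}
    (ha' : ∀ v w, a' x v w = f * a x v w + k * (β x v * β x w)) (hβ' : ∀ v, β' x v = g * β x v)
    (hpos' : ∀ v, v ≠ 0 → 0 < a' x v v) (hh : h * (f + k * normSq a β x) = g) :
    normSq a' β' x = g * h * normSq a β x := by
  obtain ⟨Y, hY⟩ := exists_dual hsymm hpos β
  have hN := normSq_eq_of_dual hsymm hpos hY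
  -- The condition on `h` says that `h Y` is dual to the new form.
  have h1 : ∀ w, a' x (h • Y) w = β' x w := by
    intro w
    rw [ha', hβ', map_smul, map_smul, smul_apply, hY, ← hN, ← hh]
    simp only [smul_eq_mul]
    ring
  rw [normSq_eq_of_dual (fun v w => by rw [ha', ha', hsymm v w, mul_comm (β x v)]) hpos' h1, hβ',
    map_smul, hN, smul_eq_mul]
  ring

end PairFields

/-! ### Douglas metrics from unit forms, and the conformal factor -/

section UnitPair

variable {n : ℕ} {M : Type*} [TopologicalSpace M] [ChartedSpace (Coord n) M]
  {φ ψ : OpenPartialHomeomorph M (Coord n)} {p : Coord n}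

/-- A Riemannian metric and a smooth `1`-form of unit length. -/
structure IsUnitPair (a : BilinField n M) (θ : OneForm n M) : Prop where
  riemannian : IsRiemannianOn Set.univ a
  smooth : IsSmoothFormOn Set.univ θ
  unit : ∀ x, normSq a θ x = 1

/-- `θ` is closed at the point with coordinates `p`, and `θ_{i|j} = c (a_ij - θ_i θ_j)` there. -/
def IsConformalAt (a : BilinField n M) (θ : OneForm n M) (φ : OpenPartialHomeomorph M (Coord n))
    (p : Coord n) (c : ℝ) : Prop :=
  (∀ i j, sTensor (metricComp φ a) (formComp φ θ) p i j = 0) ∧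
    ∀ i j, rTensor (metricComp φ a) (formComp φ θ) p i j
      = c * (metricComp φ a p i j - formComp φ θ p i * formComp φ θ p j)

/-- The metric `(α + θ)² / α`. -/
def unitSquare (a : BilinField n M) (θ : OneForm n M) (x : M) (y : TangentSpace (𝓡 n) x) : ℝ :=
  (√(a x y y) + θ x y) ^ 2 / √(a x y y)

variable {a : BilinField n M} {θ : OneForm n M}

theorem finslerComp_unitSquare (q u : Coord n) :
    finslerComp φ (unitSquare a θ) q u
      = (√(u.ofLp ⬝ᵥ metricComp φ a q *ᵥ u.ofLp) + formComp φ θ q ⬝ᵥ u.ofLp) ^ 2 /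
        √(u.ofLp ⬝ᵥ metricComp φ a q *ᵥ u.ofLp) := by
  rw [finslerComp, unitSquare, metric_coordVec, form_coordVec]

theorem IsUnitPair.isPairAt (h : IsUnitPair a θ) (hφ : φ ∈ IsManifold.maximalAtlas (𝓡 n) ∞ M)
    (hp : p ∈ φ.target) : IsPairAt (metricComp φ a) (formComp φ θ) (chartDual φ a θ) p :=
  isPairAt_chart isOpen_univ h.riemannian h.smooth hφ hp trivial

theorem IsUnitPair.eventually_unit (h : IsUnitPair a θ)
    (hφ : φ ∈ IsManifold.maximalAtlas (𝓡 n) ∞ M) (hp : p ∈ φ.target) :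
    ∀ᶠ q in nhds p, formComp φ θ q ⬝ᵥ chartDual φ a θ q = 1 :=
  (normSq_chart_eventuallyEq (β := θ) isOpen_univ h.riemannian hφ hp trivial).mono fun _q hq =>
    hq.symm.trans (h.unit _)

theorem isDouglas_of_isConformalAt (h : IsUnitPair a θ)
    (hc : ∀ φ ∈ IsManifold.maximalAtlas (𝓡 n) ∞ M, ∀ p ∈ φ.target, ∃ c, IsConformalAt a θ φ p c) :
    IsDouglas (unitSquare a θ) := by
  intro φ hφ
  have key : ∀ p, ∃ (Γ : Fin n → Fin n → Fin n → ℝ) (P : Coord n → ℝ), p ∈ φ.target →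
      (∀ v, ∀ t : ℝ, 0 < t → P (t • v) = t * P v) ∧
      ∀ v : Coord n, v ≠ 0 → (fundTensor (finslerComp φ (unitSquare a θ)) p v).det ≠ 0 → ∀ i,
        sprayCoeff (finslerComp φ (unitSquare a θ)) p v i
          = 1 / 2 * (∑ j, ∑ k, Γ i j k * v j * v k) + P v * v i := by
    intro p
    by_cases hp : p ∈ φ.target
    · obtain ⟨c, hs, hr⟩ := hc φ hφ p hp
      have hP := h.isPairAt hφ hp
      obtain ⟨Γ, P, h1⟩ := isDouglasAt_of_conformal hP.metric_diff hP.form_diff hP.symm hP.pos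
        (Filter.Eventually.of_forall fun q u => finslerComp_unitSquare q u) hP.dual.self_of_nhds
        (h.eventually_unit hφ hp).self_of_nhds hs hr
      exact ⟨Γ, P, fun _ => h1⟩
    · exact ⟨0, 0, fun h => absurd h hp⟩
  choose Γ P hΓ using key
  exact ⟨Γ, P, fun p hp => (hΓ p hp).1, fun p hp => (hΓ p hp).2⟩

theorem exists_isConformalAt_of_isDouglas (h : IsUnitPair a θ) (hD : IsDouglas (unitSquare a θ))
    (hφ : φ ∈ IsManifold.maximalAtlas (𝓡 n) ∞ M) (hp : p ∈ φ.target) :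
    ∃ c, IsConformalAt a θ φ p c := by
  have hP := h.isPairAt hφ hp
  obtain ⟨Γ, P, h1, h2⟩ := hD φ hφ
  have hu := h.eventually_unit hφ hp
  -- Since the length is constant, its derivative `2 Xⁱ (r_ij + s_ij)` vanishes, as the pointwise
  -- result requires.
  have := conformal_of_isDouglasAt hP.metric_diff hP.form_diff hP.symm hP.pos
    (Filter.Eventually.of_forall fun q u => finslerComp_unitSquare q u) hP.dual.self_of_nhds
    hu.self_of_nhds (fun j => by
      have e1 := (hasPartials_dual_normSq hP.metric_diff hP.field_diff hP.symm hP.pos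
        hP.dual).partialDeriv_eq j
      have e2 := ((HasPartials.const (n := n) (p := p) 1).congr_of_eventuallyEq hu).partialDeriv_eq j
      rw [e2] at e1
      linarith) ⟨Γ p, P p, h1 p hp, h2 p hp⟩
  exact ⟨this.2.choose, this.1, this.2.choose_spec⟩

theorem exists_ne_zero_dotProduct_eq_zero (hn : 2 ≤ n) (w : Fin n → ℝ) :
    ∃ u : Fin n → ℝ, u ≠ 0 ∧ w ⬝ᵥ u = 0 := by
  obtain ⟨i, j, hij⟩ : ∃ i j : Fin n, i ≠ j :=
    ⟨⟨0, by omega⟩, ⟨1, by omega⟩, by simp⟩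
  by_cases hi : w i = 0
  · exact ⟨Pi.single i 1, by simp, by simp [hi]⟩
  · refine ⟨Pi.single i (w j) - Pi.single j (w i), fun h => hi ?_, by simp [dotProduct_sub, mul_comm]⟩
    have := congrFun h j
    simpa [hij.symm, Pi.single_apply] using this

/-- The contraction of `2 r_ij` with a vector. -/
theorem IsConformalAt.lieMat_quadratic {c : ℝ} (h : IsUnitPair a θ)
    (hφ : φ ∈ IsManifold.maximalAtlas (𝓡 n) ∞ M) (hp : p ∈ φ.target)
    (hc : IsConformalAt a θ φ p c) (u : Fin n → ℝ) :
    u ⬝ᵥ Matrix.of (lieMat (metricComp φ a) (chartDual φ a θ) p) *ᵥ u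
      = 2 * c * (u ⬝ᵥ metricComp φ a p *ᵥ u - (formComp φ θ p ⬝ᵥ u) ^ 2) := by
  have hP := h.isPairAt hφ hp
  have e : Matrix.of (lieMat (metricComp φ a) (chartDual φ a θ) p)
      = (2 * c) • (metricComp φ a p - Matrix.vecMulVec (formComp φ θ p) (formComp φ θ p)) := by
    ext i j
    rw [Matrix.of_apply, ← two_mul_rTensor hP.metric_diff hP.field_diff hP.symm hP.pos hP.dual,
      hc.2]
    simp [Matrix.vecMulVec_apply]
    ring
  rw [e, Matrix.smul_mulVec, dotProduct_smul, Matrix.sub_mulVec, dotProduct_sub,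
    Matrix.vecMulVec_mulVec, op_smul_eq_smul, dotProduct_smul,
    dotProduct_comm u (formComp φ θ p), smul_eq_mul, smul_eq_mul]
  ring

variable [IsManifold (𝓡 n) ∞ M]

/-- The factor `c` does not depend on the chart. -/
theorem exists_isConformalAt_global (hn : 2 ≤ n) (h : IsUnitPair a θ)
    (hD : IsDouglas (unitSquare a θ)) :
    ∃ c : M → ℝ, ∀ φ ∈ IsManifold.maximalAtlas (𝓡 n) ∞ M, ∀ p ∈ φ.target,
      IsConformalAt a θ φ p (c (φ.symm p)) := by
  have key : ∀ x : M, ∃ c, IsConformalAt a θ (chartAt (Coord n) x) (chartAt (Coord n) x x) c :=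
    fun x => exists_isConformalAt_of_isDouglas h hD (IsManifold.chart_mem_maximalAtlas x)
      (mem_chart_target _ x)
  choose c hc using key
  refine ⟨c, fun φ hφ p hp => ?_⟩
  obtain ⟨d, hd⟩ := exists_isConformalAt_of_isDouglas h hD hφ hp
  set ψ := chartAt (Coord n) (φ.symm p)
  have hψm : ψ ∈ IsManifold.maximalAtlas (𝓡 n) ∞ M := IsManifold.chart_mem_maximalAtlas _
  have hps : φ.symm p ∈ ψ.source := mem_chart_source _ _
  have hpt : (ψ ∘ φ.symm) p ∈ ψ.target := ψ.map_source hps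
  have hP := h.isPairAt hφ hp
  have hPψ := h.isPairAt hψm hpt
  -- On a nonzero `u ⊥ θ` the Lie derivative of the metric is `2 c a(u, u)`. Both sides of this are
  -- tensorial, so `u` detects equality of the factors of two charts.
  obtain ⟨u, hu0, hu⟩ := exists_ne_zero_dotProduct_eq_zero hn (formComp φ θ p)
  have hev := eventually_mem_chart hp ψ.open_source hps
  have hl := lieMat_transition hP.metric_diff hP.symm.self_of_nhds hPψ.metric_diff
    hPψ.symm.self_of_nhds hP.field_diff hPψ.field_diff
    (contDiffAt_infty.1 (contDiffAt_transition hφ hψm hp hps) 2)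
    (hev.mono fun q hq => metricComp_transition hφ hψm hq.1 hq.2)
    (hev.mono fun q hq => chartDual_transition hφ hψm hq.1 hq.2 h.riemannian) (WithLp.toLp 2 u)
  rw [hd.lieMat_quadratic h hφ hp, (hc (φ.symm p)).lieMat_quadratic h hψm hpt] at hl
  have e1 := metricComp_transition (a := a) hφ hψm hp hps (WithLp.toLp 2 u) (WithLp.toLp 2 u)
  have e2 := formComp_transition (β := θ) hφ hψm hp hps (WithLp.toLp 2 u)
  simp only [Function.comp_apply] at hl e1 e2
  rw [← e1, ← e2] at hl
  simp only [hu] at hl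
  have hpos := hP.pos.self_of_nhds u hu0
  have hdc : d = c (φ.symm p) := by
    have : (d - c (φ.symm p)) * (u ⬝ᵥ metricComp φ a p *ᵥ u) = 0 := by linear_combination hl / 2
    rcases mul_eq_zero.1 this with h0 | h0
    · linarith
    · exact absurd h0 hpos.ne'
  rwa [← hdc]

omit [IsManifold (𝓡 n) ∞ M] in
-- Near each point the factor is a quotient of smooth functions: the Lie derivative of the metric
-- evaluated at a fixed `u`, divided by `2 (a(u,u) - θ(u)²)`, with `u ⊥ θ` at the point in question.
theorem isSmoothFunOn_conformal_factor (hn : 2 ≤ n) (h : IsUnitPair a θ) {c : M → ℝ}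
    (hc : ∀ φ ∈ IsManifold.maximalAtlas (𝓡 n) ∞ M, ∀ p ∈ φ.target,
      IsConformalAt a θ φ p (c (φ.symm p))) : IsSmoothFunOn (n := n) Set.univ c := by
  intro φ hφ p hp _
  have hP := h.isPairAt hφ hp
  obtain ⟨u, hu0, hu⟩ := exists_ne_zero_dotProduct_eq_zero hn (formComp φ θ p)
  set den : Coord n → ℝ := fun q => 2 * (u ⬝ᵥ metricComp φ a q *ᵥ u - (formComp φ θ q ⬝ᵥ u) ^ 2)
  have hden : ContDiffAt ℝ ∞ den p := by
    refine contDiffAt_const.mul (ContDiffAt.sub ?_ (ContDiffAt.pow ?_ 2))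
    · simp only [dotProduct, Matrix.mulVec]
      exact ContDiffAt.sum fun i _ => contDiffAt_const.mul
        (ContDiffAt.sum fun j _ => (hP.metric i j).mul contDiffAt_const)
    · exact ContDiffAt.sum fun i _ => (hP.form i).mul contDiffAt_const
  have hnum : ContDiffAt ℝ ∞
      (fun q => u ⬝ᵥ Matrix.of (lieMat (metricComp φ a) (chartDual φ a θ) q) *ᵥ u) p := by
    simp only [dotProduct, Matrix.mulVec, Matrix.of_apply]
    exact ContDiffAt.sum fun i _ => contDiffAt_const.mul
      (ContDiffAt.sum fun j _ => (contDiffAt_lieMat hP.metric hP.field i j).mul contDiffAt_const)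
  have h0 : den p ≠ 0 := by
    simp only [den, hu]
    have := hP.pos.self_of_nhds u hu0
    simpa using this.ne'
  refine (hnum.div hden h0).congr_of_eventuallyEq ?_
  filter_upwards [hden.continuousAt.eventually_ne h0, φ.open_target.mem_nhds hp] with q hq hqt
  change c (φ.symm q)
    = (u ⬝ᵥ Matrix.of (lieMat (metricComp φ a) (chartDual φ a θ) q) *ᵥ u) / den q
  rw [(hc φ hφ q hqt).lieMat_quadratic h hφ hqt, eq_div_iff hq]
  simp only [den]
  ring

end UnitPair

/-! ### Antiderivatives and functions of a submersion -/

section Analysis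

/-- A smooth function on an open set of real numbers has an antiderivative. -/
theorem exists_antiderivative {J : Set ℝ} (hJ : IsOpen J) {ψ : ℝ → ℝ} (hψ : ContDiffOn ℝ ∞ ψ J) :
    ∃ Φ : ℝ → ℝ, ContDiffOn ℝ ∞ Φ J ∧ ∀ s ∈ J, HasDerivAt Φ (ψ s) s := by
  have hch : ∀ C : Set ℝ, ∃ c, C.Nonempty → c ∈ C := fun C => by
    by_cases h : C.Nonempty
    · exact ⟨h.some, fun _ => h.some_mem⟩
    · exact ⟨0, fun h' => absurd h' h⟩
  -- The base point depends only on the connected component, so near each point the antiderivative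
  -- is one integral with a fixed lower limit.
  choose base hbase using hch
  set Φ : ℝ → ℝ := fun s => ∫ u in base (connectedComponentIn J s)..s, ψ u with hΦ
  have hderiv : ∀ s ∈ J, HasDerivAt Φ (ψ s) s := by
    intro s hs
    set C := connectedComponentIn J s with hC
    have hCo : IsOpen C := hJ.connectedComponentIn
    have hCJ : C ⊆ J := connectedComponentIn_subset J s
    have hsC : s ∈ C := mem_connectedComponentIn hs
    have hord : C.OrdConnected := isPreconnected_connectedComponentIn.ordConnected
    have hbC : base C ∈ C := hbase C ⟨s, hsC⟩
    have hint : IntervalIntegrable ψ MeasureTheory.volume (base C) s :=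
      (hψ.continuousOn.mono ((hord.uIcc_subset hbC hsC).trans hCJ)).intervalIntegrable
    have h1 := intervalIntegral.integral_hasDerivAt_right hint
      (hψ.continuousOn.stronglyMeasurableAtFilter hJ s hs) (hψ.continuousOn.continuousAt
        (hJ.mem_nhds hs))
    refine h1.congr_of_eventuallyEq ?_
    filter_upwards [hCo.mem_nhds hsC] with t ht
    simp only [hΦ, ← connectedComponentIn_eq ht, ← hC]
  refine ⟨Φ, ?_, hderiv⟩
  rw [contDiffOn_infty_iff_deriv_of_isOpen hJ]
  exact ⟨fun s hs => (hderiv s hs).differentiableAt.differentiableWithinAt,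
    hψ.congr fun s hs => (hderiv s hs).deriv⟩

/-- A function with nonzero derivative has a local section. -/
theorem exists_local_section {n : ℕ} {f : Coord n → ℝ} {p v : Coord n} (hf : ContDiffAt ℝ ∞ f p)
    (hv : fderiv ℝ f p v ≠ 0) :
    ∃ γ : ℝ → Coord n, ContDiffAt ℝ ∞ γ (f p) ∧ γ (f p) = p ∧ ∀ᶠ t in nhds (f p), f (γ t) = t := by
  -- Restricting `f` to the line through `p` along `v` reduces the claim to the inverse function
  -- theorem in one variable.
  set g : ℝ → ℝ := fun s => f (p + s • v) with hg
  have hg0 : g 0 = f p := by simp [hg]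
  have hl : ContDiffAt ℝ ∞ (fun s : ℝ => p + s • v) 0 :=
    contDiffAt_const.add (contDiffAt_id.smul contDiffAt_const)
  have hgc : ContDiffAt ℝ ∞ g 0 := by
    refine ContDiffAt.comp (0 : ℝ) ?_ hl
    simpa using hf
  have hld : HasDerivAt (fun s : ℝ => p + s • v) v 0 := by
    simpa using ((hasDerivAt_id (0 : ℝ)).smul_const v).const_add p
  have hgd : HasDerivAt g (fderiv ℝ f p v) 0 := by
    have h1 : HasFDerivAt f (fderiv ℝ f p) (p + (0 : ℝ) • v) := by
      simpa using (hf.differentiableAt (by simp)).hasFDerivAt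
    exact h1.comp_hasDerivAt (0 : ℝ) hld
  have hgf := hgd.hasFDerivAt_equiv hv
  have hs := hgc.to_localInverse hgf (by simp)
  have h0 := hgc.localInverse_apply_image hgf (by simp)
  have hr := (hgc.hasStrictFDerivAt' hgf (by simp)).eventually_right_inverse
  rw [hg0] at hs h0 hr
  refine ⟨fun t => p + hgc.localInverse hgf (by simp) t • v,
    contDiffAt_const.add (hs.smul contDiffAt_const), by simp [h0], hr⟩

variable {n : ℕ} {M : Type*} [TopologicalSpace M] [ChartedSpace (Coord n) M]

/-- A smooth function `R` that is constant on the level sets of a submersion `N` is a smooth function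
of `N`. -/
theorem exists_smooth_factor {U : Set M} (hU : IsOpen U) {N R : M → ℝ}
    (hN : IsSmoothFunOn (n := n) U N) (hR : IsSmoothFunOn (n := n) U R)
    (hsub : ∀ x ∈ U, ∃ φ ∈ IsManifold.maximalAtlas (𝓡 n) ∞ M, ∃ p ∈ φ.target, φ.symm p = x ∧
      ∃ v, fderiv ℝ (fun q => N (φ.symm q)) p v ≠ 0)
    (hlevel : ∀ x ∈ U, ∀ y ∈ U, N x = N y → R x = R y) :
    ∃ (J : Set ℝ) (ψ : ℝ → ℝ), IsOpen J ∧ (∀ x ∈ U, N x ∈ J) ∧ (∀ t ∈ J, ∃ x ∈ U, N x = t) ∧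
      ContDiffOn ℝ ∞ ψ J ∧ ∀ x ∈ U, R x = ψ (N x) := by
  have hch : ∀ t : ℝ, ∃ r, ∀ x ∈ U, N x = t → R x = r := by
    intro t
    by_cases h : ∃ y ∈ U, N y = t
    · obtain ⟨y, hy, rfl⟩ := h
      exact ⟨R y, fun x hx hxy => hlevel x hx y hy hxy⟩
    · exact ⟨0, fun x hx hxt => absurd ⟨x, hx, hxt⟩ h⟩
  choose ψ hψ using hch
  -- Composing with a local section `γ` of `N` shows that `N` is open at `x` and that `ψ = R ∘ γ` is
  -- smooth near `N x`.
  have key : ∀ x ∈ U, (∀ᶠ t in nhds (N x), t ∈ N '' U) ∧ ContDiffAt ℝ ∞ ψ (N x) := by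
    intro x hx
    obtain ⟨φ, hφ, p, hp, rfl, v, hv⟩ := hsub x hx
    obtain ⟨γ, hγ, hγp, hγr⟩ := exists_local_section (hN φ hφ p hp hx) hv
    have hmem : ∀ᶠ t in nhds (N (φ.symm p)), φ.symm (γ t) ∈ U := by
      have h1 : Filter.Tendsto γ (nhds (N (φ.symm p))) (nhds p) := by
        have := hγ.continuousAt.tendsto
        rwa [hγp] at this
      exact (h1.eventually (eventually_mem_chart hp hU hx)).mono fun t ht => ht.2
    refine ⟨?_, ?_⟩
    · filter_upwards [hmem, hγr] with t h1 h2
      exact ⟨_, h1, h2⟩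
    · have h1 : ContDiffAt ℝ ∞ (fun t => R (φ.symm (γ t))) (N (φ.symm p)) := by
        refine ContDiffAt.comp (g := fun q => R (φ.symm q)) (N (φ.symm p)) ?_ hγ
        rw [hγp]
        exact hR φ hφ p hp hx
      refine h1.congr_of_eventuallyEq ?_
      filter_upwards [hmem, hγr] with t h1 h2
      exact (hψ t _ h1 h2).symm
  refine ⟨N '' U, ψ, isOpen_iff_mem_nhds.2 ?_, fun x hx => ⟨x, hx, rfl⟩, fun t ht => ht, ?_,
    fun x hx => hψ _ x hx rfl⟩
  · rintro _ ⟨x, hx, rfl⟩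
    exact (key x hx).1
  · rintro _ ⟨x, hx, rfl⟩
    exact (key x hx).2.contDiffWithinAt

end Analysis

/-! ### The derivative along the dual field -/

section FieldDeriv

variable {n : ℕ} {M : Type*} [TopologicalSpace M] [ChartedSpace (Coord n) M]
  {φ : OpenPartialHomeomorph M (Coord n)} {p : Coord n} {a : BilinField n M} {θ : OneForm n M}

/-- The derivative of `f` along the vector field dual to `θ`. -/
def fieldDeriv (a : BilinField n M) (θ : OneForm n M) (f : M → ℝ) (x : M) : ℝ :=
  dirDeriv (fun q => f ((chartAt (Coord n) x).symm q)) (chartAt (Coord n) x x)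
    (chartDual (chartAt (Coord n) x) a θ (chartAt (Coord n) x x))

/-- The preferred chart at the point plays no role, since the dual field transforms by the
differential of the transition map. -/
theorem dirDeriv_chart [IsManifold (𝓡 n) ∞ M] (ha : IsRiemannianOn Set.univ a) {f : M → ℝ}
    (hf : IsSmoothFunOn (n := n) Set.univ f) (hφ : φ ∈ IsManifold.maximalAtlas (𝓡 n) ∞ M)
    (hp : p ∈ φ.target) :
    dirDeriv (fun q => f (φ.symm q)) p (chartDual φ a θ p) = fieldDeriv a θ f (φ.symm p) := by
  set ψ := chartAt (Coord n) (φ.symm p)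
  have hψm : ψ ∈ IsManifold.maximalAtlas (𝓡 n) ∞ M := IsManifold.chart_mem_maximalAtlas _
  have hps : φ.symm p ∈ ψ.source := mem_chart_source _ _
  have hpt : (ψ ∘ φ.symm) p ∈ ψ.target := ψ.map_source hps
  have hev := eventually_mem_chart hp ψ.open_source hps
  have h1 : (fun q => f (φ.symm q)) =ᶠ[nhds p] (fun q => f (ψ.symm q)) ∘ (ψ ∘ φ.symm) :=
    hev.mono fun q hq => by simp [ψ.left_inv hq.2]
  have h2 : DifferentiableAt ℝ (fun q => f (ψ.symm q)) ((ψ ∘ φ.symm) p) :=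
    (hf ψ hψm _ hpt trivial).differentiableAt (by simp)
  have h3 : DifferentiableAt ℝ (ψ ∘ φ.symm) p :=
    (contDiffAt_transition hφ hψm hp hps).differentiableAt (by simp)
  change _ = dirDeriv (fun q => f (ψ.symm q)) ((ψ ∘ φ.symm) p) (chartDual ψ a θ ((ψ ∘ φ.symm) p))
  rw [dirDeriv_eq_fderiv, dirDeriv_eq_fderiv, h1.fderiv_eq, fderiv_comp p h2 h3,
    chartDual_transition hφ hψm hp hps ha]
  rfl

theorem isSmoothFunOn_fieldDeriv [IsManifold (𝓡 n) ∞ M] (ha : IsRiemannianOn Set.univ a)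
    (hθ : IsSmoothFormOn Set.univ θ) {f : M → ℝ} (hf : IsSmoothFunOn (n := n) Set.univ f) :
    IsSmoothFunOn (n := n) Set.univ (fieldDeriv a θ f) := by
  intro φ hφ p hp _
  have hP := isPairAt_chart isOpen_univ ha hθ hφ hp trivial
  refine (contDiffAt_dirDeriv (hf φ hφ p hp trivial) hP.field).congr_of_eventuallyEq ?_
  filter_upwards [φ.open_target.mem_nhds hp] with q hq
  exact (dirDeriv_chart ha hf hφ hq).symm

theorem isOpen_ne_zero [IsManifold (𝓡 n) ∞ M] {f : M → ℝ}
    (hf : IsSmoothFunOn (n := n) Set.univ f) : IsOpen {x | f x ≠ 0} := by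
  refine isOpen_iff_mem_nhds.2 fun x hx => ?_
  set ψ := chartAt (Coord n) x
  have hs : x ∈ ψ.source := mem_chart_source _ x
  have h1 : ContinuousAt (fun q => f (ψ.symm q)) (ψ x) :=
    (hf ψ (IsManifold.chart_mem_maximalAtlas x) _ (ψ.map_source hs) trivial).continuousAt
  have h2 : ContinuousAt (fun y => f (ψ.symm (ψ y))) x :=
    ContinuousAt.comp (g := fun q => f (ψ.symm q)) h1 (ψ.continuousAt hs)
  have h3 : f (ψ.symm (ψ x)) ≠ 0 := by rwa [ψ.left_inv hs]
  filter_upwards [h2.eventually_ne h3, ψ.open_source.mem_nhds hs] with y hy hys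
  rwa [ψ.left_inv hys] at hy

end FieldDeriv

/-! ### Pairs `(f(o) a + k(o) θ⊗θ, g(o) θ)` over a conformal unit pair -/

section Radial

variable {n : ℕ} {M : Type*} [TopologicalSpace M] [ChartedSpace (Coord n) M]
  {φ : OpenPartialHomeomorph M (Coord n)} {p : Coord n} {a : BilinField n M} {θ : OneForm n M}

/-- A Riemannian metric and a closed `1`-form `θ` of unit length such that
`θ_{i|j} = c (a_ij - θ_i θ_j)`. -/
structure IsConformalPair (a : BilinField n M) (θ : OneForm n M) (c : M → ℝ) : Prop where
  unitPair : IsUnitPair a θ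
  conformal : ∀ φ ∈ IsManifold.maximalAtlas (𝓡 n) ∞ M, ∀ p ∈ φ.target,
    IsConformalAt a θ φ p (c (φ.symm p))

/-- Write `f a + k θ² = f (a - θ²) + (f + k) θ²`, where `a - θ² ≥ 0` by Cauchy–Schwarz. -/
theorem IsUnitPair.pos_combination (h : IsUnitPair a θ) {f k : ℝ} (hf : 0 < f) (hfk : 0 < f + k)
    (x : M) (v : TangentSpace (𝓡 n) x) (hv : v ≠ 0) : 0 < f * a x v v + k * (θ x v * θ x v) := by
  have h1 := form_sq_le (β := θ) (h.riemannian.symm x trivial) (h.riemannian.pos x trivial) v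
  rw [h.unit, one_mul] at h1
  have h2 := h.riemannian.pos x trivial v hv
  by_cases h0 : θ x v = 0
  · rw [h0]
    simpa using mul_pos hf h2
  · have h3 : 0 < θ x v * θ x v := mul_self_pos.2 h0
    nlinarith [mul_pos hfk h3, mul_nonneg hf.le (sub_nonneg.2 h1)]

/-- The functions `f, k, g, h` of a real variable define the pair `(f(o) a + k(o) θ ⊗ θ, g(o) θ)` over
`U`, with dual vector field `h(o) X`. -/
structure IsRadialChange (U : Set M) (o : M → ℝ) (f k g h : ℝ → ℝ) : Prop where
  isOpen : IsOpen U
  smooth : IsSmoothFunOn (n := n) U o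
  smooth_f : ∀ x ∈ U, ContDiffAt ℝ ∞ f (o x)
  smooth_k : ∀ x ∈ U, ContDiffAt ℝ ∞ k (o x)
  smooth_g : ∀ x ∈ U, ContDiffAt ℝ ∞ g (o x)
  pos_f : ∀ x ∈ U, 0 < f (o x)
  pos_fk : ∀ x ∈ U, 0 < f (o x) + k (o x)
  dual : ∀ x ∈ U, g (o x) = h (o x) * (f (o x) + k (o x))

variable {U : Set M} {o c : M → ℝ} {f k g h : ℝ → ℝ}

/-- The metric `f(o) a + k(o) θ ⊗ θ`. -/
abbrev radialMetric (o : M → ℝ) (f k : ℝ → ℝ) (a : BilinField n M) (θ : OneForm n M) :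
    BilinField n M := pairMetric (fun x => f (o x)) (fun x => k (o x)) a θ

/-- The `1`-form `g(o) θ`. -/
abbrev radialForm (o : M → ℝ) (g : ℝ → ℝ) (θ : OneForm n M) : OneForm n M :=
  pairForm (fun x => g (o x)) θ

theorem hasPartials_radial {U : Set M} {o : M → ℝ} {f : ℝ → ℝ} {f' : ℝ}
    (ho : IsSmoothFunOn (n := n) U o) (hφ : φ ∈ IsManifold.maximalAtlas (𝓡 n) ∞ M)
    (hp : p ∈ φ.target) (hpU : φ.symm p ∈ U) (hf : HasDerivAt f f' (o (φ.symm p))) :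
    HasPartials (fun q => f (o (φ.symm q)))
      (fun i => f' * partialDeriv i (fun q => o (φ.symm q)) p) p :=
  (HasPartials.of_differentiableAt ((ho φ hφ p hp hpU).differentiableAt (by simp))).comp
    (f := fun q => o (φ.symm q)) hf

theorem dirDeriv_radial {U : Set M} {o : M → ℝ} {f : ℝ → ℝ} {f' : ℝ}
    (ho : IsSmoothFunOn (n := n) U o) (hφ : φ ∈ IsManifold.maximalAtlas (𝓡 n) ∞ M)
    (hp : p ∈ φ.target) (hpU : φ.symm p ∈ U) (hf : HasDerivAt f f' (o (φ.symm p)))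
    (X : Fin n → ℝ) : dirDeriv (fun q => f (o (φ.symm q))) p X
      = f' * dirDeriv (fun q => o (φ.symm q)) p X := by
  simp only [dirDeriv, (hasPartials_radial ho hφ hp hpU hf).partialDeriv_eq, Finset.mul_sum]
  exact Finset.sum_congr rfl fun i _ => by ring

theorem isRiemannianOn_radialMetric (H : IsUnitPair a θ)
    (hR : IsRadialChange (n := n) U o f k g h) : IsRiemannianOn U (radialMetric o f k a θ) :=
  isRiemannianOn_pairMetric H.riemannian H.smooth (hR.smooth.comp hR.smooth_f)
    (hR.smooth.comp hR.smooth_k)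
    fun x hx v hv => H.pos_combination (hR.pos_f x hx) (hR.pos_fk x hx) x v hv

theorem isSmoothFormOn_radialForm (H : IsUnitPair a θ)
    (hR : IsRadialChange (n := n) U o f k g h) : IsSmoothFormOn U (radialForm o g θ) :=
  isSmoothFormOn_pairForm H.smooth (hR.smooth.comp hR.smooth_g)

theorem normSq_radial (H : IsUnitPair a θ) (hR : IsRadialChange (n := n) U o f k g h) {x : M}
    (hx : x ∈ U) :
    normSq (radialMetric o f k a θ) (radialForm o g θ) x = g (o x) * h (o x) := by
  have := normSq_pairMetric (h := h (o x)) (H.riemannian.symm x trivial) (H.riemannian.pos x trivial)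
    (fun v w => pairMetric_apply (f := fun x => f (o x)) (k := fun x => k (o x)) (θ := θ) x v w)
    (fun v => pairForm_apply (g := fun x => g (o x)) (θ := θ) x v)
    ((isRiemannianOn_radialMetric H hR).pos x hx)
    (by rw [H.unit, mul_one, hR.dual x hx])
  rw [this, H.unit, mul_one]

section

variable (H : IsConformalPair a θ c) (hR : IsRadialChange (n := n) U o f k g h)
  (hφ : φ ∈ IsManifold.maximalAtlas (𝓡 n) ∞ M) (hp : p ∈ φ.target) (hpU : φ.symm p ∈ U)

include hR hp hpU in
theorem IsRadialChange.eventually_dual :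
    ∀ᶠ q in nhds p, g (o (φ.symm q)) = h (o (φ.symm q)) * (f (o (φ.symm q)) + k (o (φ.symm q))) :=
  (eventually_mem_chart hp hR.isOpen hpU).mono fun _q hq => hR.dual _ hq.2

include H hR hφ hp hpU in
theorem eventually_radial_pos :
    ∀ᶠ q in nhds p, ∀ v, v ≠ 0 → 0 < v ⬝ᵥ metricComp φ (radialMetric o f k a θ) q *ᵥ v :=
  (eventually_mem_chart hp hR.isOpen hpU).mono fun _q hq =>
    metricComp_pos hφ hq.1 ((isRiemannianOn_radialMetric H.unitPair hR).pos _ hq.2)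

include H hR hφ hp hpU in
theorem rTensor_radial {f' k' h' : ℝ} (hf : HasDerivAt f f' (o (φ.symm p)))
    (hk : HasDerivAt k k' (o (φ.symm p))) (hh : HasDerivAt h h' (o (φ.symm p))) (i j : Fin n) :
    rTensor (metricComp φ (radialMetric o f k a θ)) (formComp φ (radialForm o g θ)) p i j
      = h (o (φ.symm p)) * f (o (φ.symm p)) * (c (φ.symm p)
          * (metricComp φ a p i j - formComp φ θ p i * formComp φ θ p j))
        + 1 / 2 * h (o (φ.symm p)) * dirDeriv (fun q => o (φ.symm q)) p (chartDual φ a θ p)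
          * (f' * metricComp φ a p i j + k' * (formComp φ θ p i * formComp φ θ p j))
        + 1 / 2 * (f (o (φ.symm p)) + k (o (φ.symm p))) * h'
          * (partialDeriv i (fun q => o (φ.symm q)) p * formComp φ θ p j
            + formComp φ θ p i * partialDeriv j (fun q => o (φ.symm q)) p) := by
  have hP := H.unitPair.isPairAt hφ hp
  have hpf := hasPartials_radial hR.smooth hφ hp hpU hf
  have hpk := hasPartials_radial hR.smooth hφ hp hpU hk
  have hph := hasPartials_radial hR.smooth hφ hp hpU hh
  obtain ⟨hs, hr⟩ := H.conformal φ hφ p hp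
  rw [rTensor_pairChange hP.metric_diff hP.field_diff hP.symm hP.pos hP.dual
    (H.unitPair.eventually_unit hφ hp) hs hpf.differentiableAt hpk.differentiableAt
    hph.differentiableAt (Filter.Eventually.of_forall fun q i j => metricComp_pairMetric i j)
    (Filter.Eventually.of_forall fun q i => formComp_pairForm i)
    (hR.eventually_dual hp hpU) (eventually_radial_pos H hR hφ hp hpU) i j, hr,
    hph.partialDeriv_eq, hph.partialDeriv_eq, dirDeriv_radial hR.smooth hφ hp hpU hf,
    dirDeriv_radial hR.smooth hφ hp hpU hk]
  ring

include H hR hφ hp hpU in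
theorem sTensor_radial {g' : ℝ} (hg : HasDerivAt g g' (o (φ.symm p))) (i j : Fin n) :
    sTensor (metricComp φ (radialMetric o f k a θ)) (formComp φ (radialForm o g θ)) p i j
      = 1 / 2 * g' * (partialDeriv j (fun q => o (φ.symm q)) p * formComp φ θ p i
        - partialDeriv i (fun q => o (φ.symm q)) p * formComp φ θ p j) := by
  have hP := H.unitPair.isPairAt hφ hp
  have hpg := hasPartials_radial hR.smooth hφ hp hpU hg
  obtain ⟨hs, -⟩ := H.conformal φ hφ p hp
  rw [sTensor_pairChange hP.metric_diff hP.field_diff hP.symm hP.dual hs hpg.differentiableAt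
    (Filter.Eventually.of_forall fun q i j => metricComp_pairMetric i j)
    (Filter.Eventually.of_forall fun q i => formComp_pairForm i), hpg.partialDeriv_eq,
    hpg.partialDeriv_eq]
  ring

include H hR hφ hp hpU in
theorem sForm_radial {g' : ℝ} (hg : HasDerivAt g g' (o (φ.symm p))) (i : Fin n) :
    sForm (metricComp φ (radialMetric o f k a θ)) (formComp φ (radialForm o g θ)) p i
      = 1 / 2 * h (o (φ.symm p)) * g' * (partialDeriv i (fun q => o (φ.symm q)) p
        - dirDeriv (fun q => o (φ.symm q)) p (chartDual φ a θ p) * formComp φ θ p i) := by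
  have hP := H.unitPair.isPairAt hφ hp
  have hpg := hasPartials_radial hR.smooth hφ hp hpU hg
  obtain ⟨hs, -⟩ := H.conformal φ hφ p hp
  rw [sForm_pairChange hP.metric_diff hP.field_diff hP.symm hP.dual
    (H.unitPair.eventually_unit hφ hp) hs hpg.differentiableAt
    (Filter.Eventually.of_forall fun q i j => metricComp_pairMetric i j)
    (Filter.Eventually.of_forall fun q i => formComp_pairForm i) (hR.eventually_dual hp hpU)
    (eventually_radial_pos H hR hφ hp hpU), hpg.partialDeriv_eq,
    dirDeriv_radial hR.smooth hφ hp hpU hg]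
  ring

end

/-- Here `s_ij` is a multiple of `do ∧ θ`, while `s_i` is a multiple of `do - X(o) θ`; the second
term disappears in the wedge with `θ`, and the length is `b² = g h`. -/
theorem skewEqOn_radial (H : IsConformalPair a θ c) (hR : IsRadialChange (n := n) U o f k g h)
    (h0 : ∀ x ∈ U, g (o x) * h (o x) ≠ 0) :
    SkewEqOn U (radialMetric o f k a θ) (radialForm o g θ) := by
  intro φ hφ p hp hpU i j
  have hg := ((hR.smooth_g _ hpU).differentiableAt (by simp)).hasDerivAt
  rw [sTensor_radial H hR hφ hp hpU hg, sForm_radial H hR hφ hp hpU hg,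
    sForm_radial H hR hφ hp hpU hg, normSq_radial H.unitPair hR hpU, formComp_pairForm,
    formComp_pairForm]
  have := h0 _ hpU
  have h1 := left_ne_zero_of_mul this
  have h2 := right_ne_zero_of_mul this
  field_simp
  ring

end Radial

/-! ### The structure equations of the radial pairs needed -/

section Cases

variable {n : ℕ} {M : Type*} [TopologicalSpace M] [ChartedSpace (Coord n) M]
  {a : BilinField n M} {θ : OneForm n M} {o c : M → ℝ} {U : Set M}

theorem contDiffAt_pow_inv {m : ℕ} {t : ℝ} (ht : 0 < t) :
    ContDiffAt ℝ ∞ (fun t : ℝ => (t ^ m)⁻¹) t :=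
  (contDiffAt_id.pow m).inv (pow_pos ht m).ne'

theorem hasDerivAt_pow_four_inv {t : ℝ} (ht : 0 < t) :
    HasDerivAt (fun t : ℝ => (t ^ 4)⁻¹) (-4 * (t ^ 5)⁻¹) t := by
  refine ((hasDerivAt_pow 4 t).inv (pow_pos ht 4).ne').congr_deriv ?_
  field_simp
  push_cast
  ring

/-- For `o = b` this undoes the normalization `(b⁴ a, b β)`; the dual field of the original form is
`b³ X`. -/
theorem isRadialChange_original (ho : IsSmoothFunOn (n := n) Set.univ o) (hpos : ∀ x, 0 < o x) :
    IsRadialChange (n := n) Set.univ o (fun t => (t ^ 4)⁻¹) (fun _ => 0) (fun t => (t ^ 1)⁻¹)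
      (fun t => t ^ 3) where
  isOpen := isOpen_univ
  smooth := ho
  smooth_f x _ := contDiffAt_pow_inv (hpos x)
  smooth_k _ _ := contDiffAt_const
  smooth_g x _ := contDiffAt_pow_inv (hpos x)
  pos_f x _ := inv_pos.2 (pow_pos (hpos x) 4)
  pos_fk x _ := by simpa using pow_pos (hpos x) 4
  dual x _ := by
    have := hpos x
    field_simp
    ring

/-- The formula for `s_i`, solved for `do`, converts the terms with `dh` into the `s` terms and a
multiple of `X(o)`. The coefficients combine to `c + b² d = o² X(o)`. -/
theorem structureEqOn_original [IsManifold (𝓡 n) ∞ M] (H : IsConformalPair a θ c)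
    (ho : IsSmoothFunOn (n := n) Set.univ o) (hpos : ∀ x, 0 < o x) :
    StructureEqOn Set.univ (radialMetric o (fun t => (t ^ 4)⁻¹) (fun _ => 0) a θ)
      (radialForm o (fun t => (t ^ 1)⁻¹) θ)
      (fun x => o x ^ 3 * c x - 2 * o x ^ 2 * fieldDeriv a θ o x)
      (fun x => 3 * fieldDeriv a θ o x - o x * c x) := by
  intro φ hφ p hp hpU i j
  beta_reduce
  have hR := isRadialChange_original ho hpos
  have h0 := hpos (φ.symm p)
  have hg : HasDerivAt (fun t : ℝ => (t ^ 1)⁻¹) (-(o (φ.symm p) ^ 2)⁻¹) (o (φ.symm p)) := by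
    simpa using hasDerivAt_inv h0.ne'
  rw [rTensor_radial H hR hφ hp hpU (hasDerivAt_pow_four_inv h0) (hasDerivAt_const _ _)
    (hasDerivAt_pow 3 _), sForm_radial H hR hφ hp hpU hg, sForm_radial H hR hφ hp hpU hg,
    normSq_radial H.unitPair hR hpU, formComp_pairForm, formComp_pairForm, metricComp_pairMetric,
    dirDeriv_chart H.unitPair.riemannian ho hφ hp]
  field_simp
  ring

/-- Form (ii) of the original pair `(o⁻⁴ a, o⁻¹ θ)` has `β̄ = o³ β = o² θ` and `ᾱ = o³ α`, hence
metric `o² a`. -/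
theorem isRadialChange_sq (hU : IsOpen U) (ho : IsSmoothFunOn (n := n) U o)
    (hpos : ∀ x ∈ U, 0 < o x) :
    IsRadialChange (n := n) U o (fun t => t ^ 2) (fun _ => 0) (fun t => t ^ 2) (fun _ => 1) where
  isOpen := hU
  smooth := ho
  smooth_f _ _ := contDiffAt_id.pow 2
  smooth_k _ _ := contDiffAt_const
  smooth_g _ _ := contDiffAt_id.pow 2
  pos_f x hx := pow_pos (hpos x hx) 2
  pos_fk x hx := by simpa using pow_pos (hpos x hx) 2
  dual x _ := by ring

/-- Since `h = 1` there is no `dh` term, and `X(o) = 0` removes the derivatives of `f`; what remains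
is `o² c (a - θ⊗θ)`. -/
theorem transverseConformalOn_sq (H : IsConformalPair a θ c) (hU : IsOpen U)
    (ho : IsSmoothFunOn (n := n) U o) (hpos : ∀ x ∈ U, 0 < o x)
    (hX : ∀ φ ∈ IsManifold.maximalAtlas (𝓡 n) ∞ M, ∀ p ∈ φ.target, φ.symm p ∈ U →
      dirDeriv (fun q => o (φ.symm q)) p (chartDual φ a θ p) = 0) :
    TransverseConformalOn U (radialMetric o (fun t => t ^ 2) (fun _ => 0) a θ)
      (radialForm o (fun t => t ^ 2) θ) (fun x => c x / o x ^ 2) := by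
  intro φ hφ p hp hpU i j
  beta_reduce
  have hR := isRadialChange_sq hU ho hpos
  have h0 := hpos (φ.symm p) hpU
  rw [rTensor_radial H hR hφ hp hpU (hasDerivAt_pow 2 _) (hasDerivAt_const _ _)
    (hasDerivAt_const _ _), normSq_radial H.unitPair hR hpU, formComp_pairForm, formComp_pairForm,
    metricComp_pairMetric, hX φ hφ p hp hpU]
  field_simp
  ring

/-- These functions come from solving case (i) for the barred pair when `α² = o⁻⁴ a` and `β = o⁻¹
θ`. -/
theorem isRadialChange_caseI (hU : IsOpen U) (ho : IsSmoothFunOn (n := n) U o)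
    (hpos : ∀ x ∈ U, 0 < o x) :
    IsRadialChange (n := n) U o (fun t => (t ^ 4)⁻¹) (fun t => t ^ 2 - (t ^ 4)⁻¹) (fun t => t ^ 2)
      (fun _ => 1) where
  isOpen := hU
  smooth := ho
  smooth_f x hx := contDiffAt_pow_inv (hpos x hx)
  smooth_k x hx := (contDiffAt_id.pow 2).sub (contDiffAt_pow_inv (hpos x hx))
  smooth_g _ _ := contDiffAt_id.pow 2
  pos_f x hx := inv_pos.2 (pow_pos (hpos x hx) 4)
  pos_fk x hx := by simpa using pow_pos (hpos x hx) 2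
  dual x _ := by ring

/-- The condition `X(o) = o c / 3` is what makes `r` proportional to the new metric, in the `a` and
the `θ⊗θ` coefficients simultaneously. -/
theorem conformalOn_caseI (H : IsConformalPair a θ c) (hU : IsOpen U)
    (ho : IsSmoothFunOn (n := n) U o) (hpos : ∀ x ∈ U, 0 < o x)
    (hX : ∀ φ ∈ IsManifold.maximalAtlas (𝓡 n) ∞ M, ∀ p ∈ φ.target, φ.symm p ∈ U →
      dirDeriv (fun q => o (φ.symm q)) p (chartDual φ a θ p)
        = o (φ.symm p) * c (φ.symm p) / 3) :
    ConformalOn U (radialMetric o (fun t => (t ^ 4)⁻¹) (fun t => t ^ 2 - (t ^ 4)⁻¹) a θ)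
      (radialForm o (fun t => t ^ 2) θ) (fun x => c x / 3) := by
  intro φ hφ p hp hpU i j
  beta_reduce
  have hR := isRadialChange_caseI hU ho hpos
  have h0 := hpos (φ.symm p) hpU
  rw [rTensor_radial H hR hφ hp hpU (hasDerivAt_pow_four_inv h0)
    ((hasDerivAt_pow 2 _).sub (hasDerivAt_pow_four_inv h0)) (hasDerivAt_const _ _),
    metricComp_pairMetric, hX φ hφ p hp hpU]
  field_simp
  push_cast
  ring

end Cases

/-! ### Normalization to a form of unit length -/

section Normalization

variable {n : ℕ} {M : Type*} [TopologicalSpace M] [ChartedSpace (Coord n) M]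
  {a : BilinField n M} {β : OneForm n M}

/-- The metric `b⁴ a`, with respect to which `b β` has unit length. -/
def normMetric (a : BilinField n M) (β : OneForm n M) : BilinField n M :=
  pairMetric (fun x => len a β x ^ 4) (fun _ => 0) a β

/-- The `1`-form `b β`. -/
def normForm (a : BilinField n M) (β : OneForm n M) : OneForm n M := pairForm (len a β) β

theorem normMetric_apply (x : M) (v w : TangentSpace (𝓡 n) x) :
    normMetric a β x v w = len a β x ^ 4 * a x v w := by
  simp [normMetric]

theorem normForm_apply (x : M) (v : TangentSpace (𝓡 n) x) :
    normForm a β x v = len a β x * β x v :=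
  pairForm_apply _ _

variable (ha : IsRiemannianOn Set.univ a) (hβ : IsSmoothFormOn Set.univ β) (hβ0 : ∀ x, β x ≠ 0)

theorem len_pos {x : M} (hsymm : ∀ v w, a x v w = a x w v) (hpos : ∀ v, v ≠ 0 → 0 < a x v v)
    (h0 : β x ≠ 0) : 0 < len a β x :=
  Real.sqrt_pos.2 (normSq_pos hsymm hpos h0)

theorem len_sq {x : M} (hsymm : ∀ v w, a x v w = a x w v) (hpos : ∀ v, v ≠ 0 → 0 < a x v v) :
    len a β x ^ 2 = normSq a β x :=
  Real.sq_sqrt (normSq_nonneg hsymm hpos)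

include ha hβ hβ0 in
theorem isSmoothFunOn_len : IsSmoothFunOn (n := n) Set.univ (len a β) :=
  (isSmoothFunOn_normSq isOpen_univ ha hβ).comp fun x hx =>
    Real.contDiffAt_sqrt (normSq_pos (ha.symm x hx) (ha.pos x hx) (hβ0 x)).ne'

include ha hβ hβ0 in
theorem isUnitPair_norm : IsUnitPair (normMetric a β) (normForm a β) := by
  have hlen := isSmoothFunOn_len ha hβ hβ0
  have hp : ∀ x, 0 < len a β x := fun x => len_pos (ha.symm x trivial) (ha.pos x trivial) (hβ0 x)
  have hpos : ∀ x ∈ Set.univ, ∀ v, v ≠ 0 → 0 < len a β x ^ 4 * a x v v + 0 * (β x v * β x v) :=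
    fun x hx v hv => by
      rw [zero_mul, add_zero]
      exact mul_pos (pow_pos (hp x) 4) (ha.pos x hx v hv)
  have hR : IsRiemannianOn Set.univ (normMetric a β) :=
    isRiemannianOn_pairMetric ha hβ (hlen.comp (g := fun t => t ^ 4) fun _ _ => contDiffAt_id.pow 4)
      (hlen.comp (g := fun _ => 0) fun _ _ => contDiffAt_const) hpos
  refine ⟨hR, isSmoothFormOn_pairForm hβ hlen, fun x => ?_⟩
  have h1 := normSq_pairMetric (h := (len a β x ^ 3)⁻¹) (ha.symm x trivial) (ha.pos x trivial)
    (fun v w => pairMetric_apply (f := fun x => len a β x ^ 4) (k := fun _ => 0) (θ := β) x v w)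
    (fun v => normForm_apply x v) (hR.pos x trivial) (by
      have := hp x
      field_simp
      ring)
  have h2 := hp x
  refine h1.trans ?_
  rw [← len_sq (ha.symm x trivial) (ha.pos x trivial)]
  field_simp

include ha hβ0 in
theorem radialMetric_norm : radialMetric (len a β) (fun t => (t ^ 4)⁻¹) (fun _ => 0)
    (normMetric a β) (normForm a β) = a := by
  funext x
  ext v w
  have := len_pos (ha.symm x trivial) (ha.pos x trivial) (hβ0 x)
  rw [pairMetric_apply, normMetric_apply]
  field_simp
  simp

include ha hβ0 in
theorem radialForm_norm : radialForm (len a β) (fun t => (t ^ 1)⁻¹) (normForm a β) = β := by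
  funext x
  ext v
  have := len_pos (ha.symm x trivial) (ha.pos x trivial) (hβ0 x)
  rw [pairForm_apply, normForm_apply]
  field_simp

/-- Multiplying `α` by `b²` and `β` by `b` clears the factor `b`: `(b²α + bβ)² / (b²α) = (bα + β)² /
α`. -/
theorem singSquare_eq_unitSquare {a₁ : BilinField n M} {θ : OneForm n M} {x : M}
    (hlen : 0 < len a β x) {y : TangentSpace (𝓡 n) x}
    (ha₁ : a₁ x y y = len a β x ^ 4 * a x y y) (hθ : θ x y = len a β x * β x y) :
    singSquare a β x y = unitSquare a₁ θ x y := by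
  have e : √(len a β x ^ 4 * a x y y) = len a β x ^ 2 * √(a x y y) := by
    rw [Real.sqrt_mul (by positivity), show len a β x ^ 4 = (len a β x ^ 2) ^ 2 by ring,
      Real.sqrt_sq (by positivity)]
  rw [singSquare, unitSquare, ha₁, hθ, e, alpha]
  -- Where `α(y) = 0` both quotients have zero denominator and take the value `0`.
  by_cases h0 : √(a x y y) = 0
  · simp [h0]
  · field_simp

include ha hβ0 in
theorem singSquare_eq_norm : singSquare a β = unitSquare (normMetric a β) (normForm a β) := by
  funext x y
  exact singSquare_eq_unitSquare (len_pos (ha.symm x trivial) (ha.pos x trivial) (hβ0 x))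
    (normMetric_apply x y y) (normForm_apply x y)

end Normalization

/-! ### Reduction of a Douglas metric to the two cases -/

section Reduction

variable {n : ℕ} {M : Type*} [TopologicalSpace M] [ChartedSpace (Coord n) M]
  {a : BilinField n M} {β : OneForm n M} {c : M → ℝ} {U : Set M}

theorem deformMetric_apply (ρ : ℝ → ℝ) (x : M) (v w : TangentSpace (𝓡 n) x) :
    deformMetric ρ a β x v w = Real.exp (2 * ρ (normSq a β x)) * a x v w := by
  simp [deformMetric]

theorem deformForm_apply (ρ : ℝ → ℝ) (x : M) (v : TangentSpace (𝓡 n) x) :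
    deformForm ρ a β x v = Real.exp (ρ (normSq a β x) / 2) * β x v := by
  simp [deformForm]

variable (ha : IsRiemannianOn Set.univ a) (hβ : IsSmoothFormOn Set.univ β) (hβ0 : ∀ x, β x ≠ 0)
  (H : IsConformalPair (normMetric a β) (normForm a β) c)

/-- With `ρ(b²) = log b² - 2s` and `B = eˢ`, the deformation leads to the pair `(B⁻⁴ ã, B⁻¹ θ)`
built on the unit pair `(ã, θ)`; `s = 0` is the normalization itself. -/
theorem exp_log_deform {b : ℝ} (hb : 0 < b) (s : ℝ) :
    Real.exp (2 * (Real.log (b ^ 2) - 2 * s)) = b ^ 4 * (Real.exp s ^ 4)⁻¹ ∧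
      Real.exp ((Real.log (b ^ 2) - 2 * s) / 2) = b * (Real.exp s)⁻¹ := by
  have h1 : Real.log (b ^ 2) = 2 * Real.log b := by simp
  constructor
  · rw [h1, show 2 * (2 * Real.log b - 2 * s) = ((4 : ℕ) : ℝ) * Real.log b - ((4 : ℕ) : ℝ) * s by
      push_cast; ring, Real.exp_sub, Real.exp_nat_mul, Real.exp_nat_mul, Real.exp_log hb,
      div_eq_mul_inv]
  · rw [h1, show (2 * Real.log b - 2 * s) / 2 = Real.log b - s by ring, Real.exp_sub,
      Real.exp_log hb, div_eq_mul_inv]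

include ha hβ0 H in
-- The unit pair, reached with `ρ = log`, is its own barred pair: `b̄ = 1`, `τ̄ = c`, and all `s`
-- terms vanish.
theorem reducesToCaseII_univ : ReducesToCaseII Set.univ a β := by
  have hN : ∀ x, 0 < normSq a β x := fun x => normSq_pos (ha.symm x trivial) (ha.pos x trivial) (hβ0 x)
  have hlen : ∀ x, len (normMetric a β) (normForm a β) x = 1 := fun x => by
    rw [len, H.unitPair.unit, Real.sqrt_one]
  have hb : ∀ x, 0 < len a β x := fun x => len_pos (ha.symm x trivial) (ha.pos x trivial) (hβ0 x)
  have hb2 : ∀ x, len a β x ^ 2 = normSq a β x := fun x => len_sq (ha.symm x trivial) (ha.pos x trivial)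
  have hexp : ∀ x, Real.exp (2 * Real.log (normSq a β x)) = len a β x ^ 4 ∧
      Real.exp (Real.log (normSq a β x) / 2) = len a β x := fun x => by
    simpa [hb2] using exp_log_deform (hb x) 0
  refine ⟨Real.log, ⟨Set.Ioi 0, isOpen_Ioi, fun x _ => hN x, fun t ht =>
    (Real.contDiffAt_log.2 ht.ne').contDiffWithinAt⟩, normMetric a β, normForm a β, c,
    H.unitPair.riemannian, H.unitPair.smooth, fun x _ y => ?_, fun x _ y => ?_,
    fun φ hφ p hp _ i j => ?_, fun φ hφ p hp _ i j => ?_⟩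
  · rw [hlen, one_zpow, one_mul, alpha, alpha, deformMetric_apply, normMetric_apply, (hexp x).1]
  · rw [hlen, one_zpow, one_mul, deformForm_apply, normForm_apply, (hexp x).2]
  · beta_reduce
    rw [(H.conformal φ hφ p hp).2, H.unitPair.unit, one_mul]
  · have h0 := (H.conformal φ hφ p hp).1
    simp [sForm, h0]

include ha hβ hβ0 H in
theorem structureEqOn_univ [IsManifold (𝓡 n) ∞ M] : StructureEqOn Set.univ a β
    (fun x => len a β x ^ 3 * c x
      - 2 * len a β x ^ 2 * fieldDeriv (normMetric a β) (normForm a β) (len a β) x)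
    (fun x => 3 * fieldDeriv (normMetric a β) (normForm a β) (len a β) x - len a β x * c x) := by
  have := structureEqOn_original H (isSmoothFunOn_len ha hβ hβ0)
    fun x => len_pos (ha.symm x trivial) (ha.pos x trivial) (hβ0 x)
  rwa [radialMetric_norm ha hβ0, radialForm_norm ha hβ0] at this

include ha hβ hβ0 H in
theorem skewEqOn_univ : SkewEqOn Set.univ a β := by
  have hb : ∀ x, 0 < len a β x := fun x => len_pos (ha.symm x trivial) (ha.pos x trivial) (hβ0 x)
  have := skewEqOn_radial H (isRadialChange_original (isSmoothFunOn_len ha hβ hβ0) hb)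
    fun x _ => by have := hb x; positivity
  rwa [radialMetric_norm ha hβ0, radialForm_norm ha hβ0] at this

include ha hβ hβ0 H in
-- No deformation is needed: when `b` is constant along the dual field, the barred pair `(b² ã, b²
-- θ)` built on the unit pair `(ã, θ)` satisfies the equations of (ii).
theorem isCaseII_of_fieldDeriv_eq_zero [IsManifold (𝓡 n) ∞ M] (hU : IsOpen U)
    (hX : ∀ x ∈ U, fieldDeriv (normMetric a β) (normForm a β) (len a β) x = 0) :
    ∃ a' β' τ, IsCaseII U a β a' β' τ := by
  have hb : ∀ x, 0 < len a β x := fun x => len_pos (ha.symm x trivial) (ha.pos x trivial) (hβ0 x)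
  have hs := isSmoothFunOn_len ha hβ hβ0
  have hsU : IsSmoothFunOn (n := n) U (len a β) := fun φ hφ p hp _ => hs φ hφ p hp trivial
  have hR := isRadialChange_sq hU hsU fun x _ => hb x
  have hlen : ∀ x ∈ U, len (radialMetric (len a β) (fun t => t ^ 2) (fun _ => 0) (normMetric a β)
      (normForm a β)) (radialForm (len a β) (fun t => t ^ 2) (normForm a β)) x = len a β x := by
    intro x hx
    rw [len, normSq_radial H.unitPair hR hx, mul_one, Real.sqrt_sq (hb x).le]
  refine ⟨_, _, _, isRiemannianOn_radialMetric H.unitPair hR,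
    isSmoothFormOn_radialForm H.unitPair hR, fun x hx y => ?_, fun x hx y => ?_,
    transverseConformalOn_sq H hU hsU (fun x _ => hb x) fun φ hφ p hp hpU => ?_,
    skewEqOn_radial H hR fun x _ => by have := hb x; positivity⟩
  · have h0 := hb x
    rw [hlen x hx, alpha, alpha, pairMetric_apply, normMetric_apply, zero_mul, add_zero,
      show len a β x ^ 2 * (len a β x ^ 4 * a x y y) = (len a β x ^ 3) ^ 2 * a x y y by ring,
      Real.sqrt_mul (by positivity), Real.sqrt_sq (by positivity), zpow_neg]
    norm_cast
    field_simp
  · have h0 := hb x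
    rw [hlen x hx, pairForm_apply, normForm_apply, zpow_neg]
    norm_cast
    field_simp
  · rw [dirDeriv_chart H.unitPair.riemannian hs hφ hp, hX _ hpU]

include ha hβ hβ0 H in
-- The new length is sought as `B = exp(Φ(b))`. The requirement `X(B) = B c / 3` becomes `Φ'(b) = c
-- / (3 X(b))`, solvable because the right side depends only on `b`.
theorem reducesToCaseI_of_fieldDeriv_ne_zero [IsManifold (𝓡 n) ∞ M]
    (hc : IsSmoothFunOn (n := n) Set.univ c)
    (hlevel : ∀ x y, len a β x = len a β y →
      c x * fieldDeriv (normMetric a β) (normForm a β) (len a β) y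
        = c y * fieldDeriv (normMetric a β) (normForm a β) (len a β) x) :
    ReducesToCaseI {x | fieldDeriv (normMetric a β) (normForm a β) (len a β) x ≠ 0} a β := by
  have hb : ∀ x, 0 < len a β x := fun x => len_pos (ha.symm x trivial) (ha.pos x trivial) (hβ0 x)
  have hb2 : ∀ x, len a β x ^ 2 = normSq a β x := fun x => len_sq (ha.symm x trivial) (ha.pos x trivial)
  have hs := isSmoothFunOn_len ha hβ hβ0
  have hR := H.unitPair.riemannian
  set D := fieldDeriv (normMetric a β) (normForm a β) (len a β) with hD
  have hDs : IsSmoothFunOn (n := n) Set.univ D := isSmoothFunOn_fieldDeriv hR H.unitPair.smooth hs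
  set U : Set M := {x | D x ≠ 0} with hUdef
  have hU : IsOpen U := isOpen_ne_zero hDs
  have hsU : IsSmoothFunOn (n := n) U (len a β) := fun φ hφ p hp _ => hs φ hφ p hp trivial
  have hQ : IsSmoothFunOn (n := n) U fun x => c x / (3 * D x) := fun φ hφ p hp hpU =>
    (hc φ hφ p hp trivial).div (contDiffAt_const.mul (hDs φ hφ p hp trivial))
      (mul_ne_zero three_ne_zero hpU)
  -- On `U` the derivative of `b` along the dual field is nonzero, so `b` is a submersion there and
  -- the quotient descends to a smooth function of `b`.
  obtain ⟨J, ψ, hJ, hNJ, -, hψ, hψe⟩ := exists_smooth_factor hU hsU hQ (fun x hx =>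
    ⟨chartAt (Coord n) x, IsManifold.chart_mem_maximalAtlas x, chartAt (Coord n) x x,
      mem_chart_target _ x, (chartAt (Coord n) x).left_inv (mem_chart_source _ x), _, by
        rw [← dirDeriv_eq_fderiv]; exact hx⟩) (fun x hx y hy hxy => by
      rw [div_eq_div_iff (mul_ne_zero three_ne_zero hx) (mul_ne_zero three_ne_zero hy)]
      linear_combination 3 * hlevel x y hxy)
  obtain ⟨Φ, hΦ, hΦd⟩ := exists_antiderivative hJ hψ
  set B : M → ℝ := fun x => Real.exp (Φ (len a β x)) with hB
  have hBpos : ∀ x ∈ U, 0 < B x := fun x _ => Real.exp_pos _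
  have hBs : IsSmoothFunOn (n := n) U B := hsU.comp (g := fun t => Real.exp (Φ t)) fun x hx =>
    (hΦ.contDiffAt (hJ.mem_nhds (hNJ x hx))).exp
  have hBR := isRadialChange_caseI hU hBs hBpos
  have hlenB : ∀ x ∈ U, len (radialMetric B (fun t => (t ^ 4)⁻¹) (fun t => t ^ 2 - (t ^ 4)⁻¹)
      (normMetric a β) (normForm a β)) (radialForm B (fun t => t ^ 2) (normForm a β)) x = B x := by
    intro x hx
    rw [len, normSq_radial H.unitPair hBR hx, mul_one, Real.sqrt_sq (hBpos x hx).le]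
  have hexp : ∀ x, Real.exp (2 * (Real.log (normSq a β x) - 2 * Φ √(normSq a β x)))
        = len a β x ^ 4 * (B x ^ 4)⁻¹ ∧
      Real.exp ((Real.log (normSq a β x) - 2 * Φ √(normSq a β x)) / 2) = len a β x * (B x)⁻¹ := by
    intro x
    have := exp_log_deform (hb x) (Φ (len a β x))
    rwa [hb2] at this
  -- The factor is a function of `t = b²`, hence `Φ` is evaluated at `√t`.
  refine ⟨fun t => Real.log t - 2 * Φ √t, ⟨Set.Ioi 0 ∩ Real.sqrt ⁻¹' J,
    isOpen_Ioi.inter (hJ.preimage Real.continuous_sqrt), fun x hx => ⟨?_, hNJ x hx⟩,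
    fun t ht => ?_⟩, _, _, _, isRiemannianOn_radialMetric H.unitPair hBR,
    isSmoothFormOn_radialForm H.unitPair hBR, fun x hx y => ?_, fun x hx y => ?_,
    conformalOn_caseI H hU hBs hBpos fun φ hφ p hp hpU => ?_,
    skewEqOn_radial H hBR fun x hx => by have := hBpos x hx; positivity⟩
  · rw [← hb2]
    exact pow_pos (hb x) 2
  · have h1 : t ≠ 0 := (Set.mem_Ioi.1 ht.1).ne'
    exact ((Real.contDiffAt_log.2 h1).sub (contDiffAt_const.mul
      ((hΦ.contDiffAt (hJ.mem_nhds ht.2)).comp t (Real.contDiffAt_sqrt h1)))).contDiffWithinAt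
  · have h0 := hBpos x hx
    have hp := (isRiemannianOn_radialMetric H.unitPair hBR).pos x hx
    have hnn : 0 ≤ radialMetric B (fun t => (t ^ 4)⁻¹) (fun t => t ^ 2 - (t ^ 4)⁻¹)
        (normMetric a β) (normForm a β) x y y := by
      by_cases hy : y = 0
      · simp [hy]
      · exact (hp y hy).le
    rw [hlenB x hx, alpha, alpha, Real.sq_sqrt hnn, deformMetric_apply, (hexp x).1, pairMetric_apply,
      pairForm_apply, normMetric_apply, zpow_neg, zpow_neg]
    congr 1
    norm_cast
    field_simp
    ring
  · have h0 := hBpos x hx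
    rw [hlenB x hx, deformForm_apply, (hexp x).2, pairForm_apply, normForm_apply, zpow_neg]
    norm_cast
    field_simp
  · have h1 : HasDerivAt (fun t => Real.exp (Φ t))
        (B (φ.symm p) * ψ (len a β (φ.symm p))) (len a β (φ.symm p)) :=
      (hΦd _ (hNJ _ hpU)).exp
    have hx : D (φ.symm p) ≠ 0 := hpU
    refine (dirDeriv_radial hsU hφ hp hpU h1 _).trans ?_
    rw [dirDeriv_chart hR hs hφ hp, ← hψe _ hpU, ← hD]
    field_simp

end Reduction

/-! ### Closedness of `b⁻² β` -/

section SkewPair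

variable {n : ℕ} {A A₁ : Coord n → Matrix (Fin n) (Fin n) ℝ} {b w : Coord n → Fin n → ℝ}
  {X : Coord n → Fin n → ℝ} {p : Coord n} {N : Coord n → ℝ} {μ : ℝ}

variable (hP : IsPairAt A b X p) (hN : N =ᶠ[nhds p] fun q => b q ⬝ᵥ X q)
  (hr : ∀ j, ∑ i, X p i * rTensor A b p i j = μ * b p j)

include hP hN hr in
theorem hasPartials_normSq_of_contraction :
    HasPartials N (fun j => 2 * (μ * b p j + sForm A b p j)) p := by
  refine ((hasPartials_dual_normSq hP.metric_diff hP.field_diff hP.symm hP.pos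
    hP.dual).congr_of_eventuallyEq hN).congr fun j => ?_
  simp only [mul_add, Finset.sum_add_distrib, hr, sForm_eq hP.pos hP.dual]

theorem sum_mul_sForm (hP : IsPairAt A b X p) : ∑ j, X p j * sForm A b p j = 0 := by
  have h1 : ∑ j, X p j * sForm A b p j = ∑ j, ∑ i, X p i * X p j * sTensor A b p i j := by
    refine Finset.sum_congr rfl fun j _ => ?_
    rw [sForm_eq hP.pos hP.dual, Finset.mul_sum]
    exact Finset.sum_congr rfl fun i _ => by ring
  have h2 : ∑ j, X p j * sForm A b p j = -∑ j, X p j * sForm A b p j := by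
    rw [h1]
    conv_lhs => rw [Finset.sum_comm]
    simp only [← Finset.sum_neg_distrib]
    exact Finset.sum_congr rfl fun j _ => Finset.sum_congr rfl fun i _ => by
      rw [sTensor, sTensor]; ring
  linarith

include hP hN hr in
theorem dirDeriv_normSq_of_contraction : dirDeriv N p (X p) = 2 * μ * N p := by
  simp only [dirDeriv, (hasPartials_normSq_of_contraction hP hN hr).partialDeriv_eq]
  have hNp : N p = ∑ j, b p j * X p j := hN.self_of_nhds
  rw [hNp]
  have h := sum_mul_sForm hP
  have e : ∑ j, X p j * (2 * (μ * b p j + sForm A b p j))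
      = 2 * μ * (∑ j, b p j * X p j) + 2 * ∑ j, X p j * sForm A b p j := by
    simp only [Finset.mul_sum, ← Finset.sum_add_distrib]
    exact Finset.sum_congr rfl fun i _ => by ring
  rw [e, h, mul_zero, add_zero]

include hP hN hr in
/-- If `s_ij = (b_i s_j - b_j s_i) / b²` then `b⁻² b_i` is closed. -/
theorem sTensor_eq_zero_of_skew (h0 : N p ≠ 0)
    (hs : ∀ i j, sTensor A b p i j
      = 1 / N p * (b p i * sForm A b p j - b p j * sForm A b p i))
    (hsym : ∀ᶠ q in nhds p, ∀ i j, A₁ q i j = A₁ q j i)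
    (hw : ∀ᶠ q in nhds p, ∀ i, w q i = (N q)⁻¹ * b q i) (i j : Fin n) :
    sTensor A₁ w p i j = 0 := by
  -- Here `d(b²) = 2 (μ β + s)`; in `d(b⁻² β)` the `μ` part drops out since `β ∧ β = 0`, and the `s`
  -- part cancels `dβ`.
  have hpN := hasPartials_normSq_of_contraction hP hN hr
  have hinv := hpN.comp (hasDerivAt_inv h0)
  have hd : ∀ l i, dVec w p l i = -(N p ^ 2)⁻¹ * (2 * (μ * b p l + sForm A b p l)) * b p i
      + (N p)⁻¹ * dVec b p l i := fun l i =>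
    ((hinv.mul (HasPartials.of_differentiableAt (hP.form_diff i))).congr_of_eventuallyEq
      (hw.mono fun q hq => hq i)).partialDeriv_eq l
  have h1 := hs i j
  rw [sTensor_eq hP.symm] at h1
  rw [sTensor_eq hsym, hd, hd]
  have h2 : 1 / 2 * (dVec b p j i - dVec b p i j) * N p
      = b p i * sForm A b p j - b p j * sForm A b p i := by
    rw [h1]
    field_simp
  field_simp
  linear_combination 2 * h2

end SkewPair

/-! ### From the barred pair to a unit pair -/

section Unitization

variable {n : ℕ} {M : Type*} [TopologicalSpace M] [ChartedSpace (Coord n) M]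
  {a : BilinField n M} {β : OneForm n M} {f k f' k' : ℝ → ℝ} {μ c : M → ℝ}

/-- The metric `a₁` with `a = f(b²) a₁ + k(b²) θ ⊗ θ`, for `θ = b⁻² β`. -/
def unitizedMetric (f k : ℝ → ℝ) (a : BilinField n M) (β : OneForm n M) : BilinField n M :=
  pairMetric (fun x => (f (normSq a β x))⁻¹)
    (fun x => -(k (normSq a β x) / (f (normSq a β x) * normSq a β x ^ 2))) a β

/-- The `1`-form `b⁻² β`. -/
def unitizedForm (a : BilinField n M) (β : OneForm n M) : OneForm n M :=
  pairForm (fun x => (normSq a β x)⁻¹) β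

variable (ha : IsRiemannianOn Set.univ a) (hβ : IsSmoothFormOn Set.univ β) (hβ0 : ∀ x, β x ≠ 0)
  (hf : ∀ t, 0 < t → ContDiffAt ℝ ∞ f t) (hk : ∀ t, 0 < t → ContDiffAt ℝ ∞ k t)
  (hf0 : ∀ t, 0 < t → 0 < f t) (hfk : ∀ t, 0 < t → f t + k t = t)

include ha hβ hβ0 hf hk hf0 hfk in
theorem isUnitPair_unitized : IsUnitPair (unitizedMetric f k a β) (unitizedForm a β) := by
  have hN := isSmoothFunOn_normSq isOpen_univ ha hβ
  have hpos : ∀ x, 0 < normSq a β x := fun x =>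
    normSq_pos (ha.symm x trivial) (ha.pos x trivial) (hβ0 x)
  have hR : IsRiemannianOn Set.univ (unitizedMetric f k a β) := by
    refine isRiemannianOn_pairMetric ha hβ
      (hN.comp (g := fun t => (f t)⁻¹) fun x _ => (hf _ (hpos x)).inv (hf0 _ (hpos x)).ne')
      (hN.comp (g := fun t => -(k t / (f t * t ^ 2))) fun x _ =>
        ((hk _ (hpos x)).div ((hf _ (hpos x)).mul (contDiffAt_id.pow 2))
          (mul_pos (hf0 _ (hpos x)) (pow_pos (hpos x) 2)).ne').neg) fun x _ v hv => ?_
    have h1 := form_sq_le (β := β) (ha.symm x trivial) (ha.pos x trivial) v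
    have h2 := ha.pos x trivial v hv
    have h3 := hpos x
    have h4 := hf0 _ h3
    have hk' : k (normSq a β x) = normSq a β x - f (normSq a β x) := by
      linarith [hfk _ h3]
    -- With `k = b² - f` the new metric is a positive combination of `b² α² - β²`, nonnegative by
    -- Cauchy–Schwarz, and `β²`.
    have e : (f (normSq a β x))⁻¹ * a x v v
        + -(k (normSq a β x) / (f (normSq a β x) * normSq a β x ^ 2)) * (β x v * β x v)
        = (f (normSq a β x))⁻¹ * (normSq a β x)⁻¹ * (normSq a β x * a x v v - β x v * β x v)
          + (normSq a β x ^ 2)⁻¹ * (β x v * β x v) := by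
      rw [hk']
      field_simp
      ring
    rw [e]
    by_cases h0 : β x v = 0
    · rw [h0]
      simp only [mul_zero, sub_zero, add_zero]
      positivity
    · have h5 : 0 < β x v * β x v := mul_self_pos.2 h0
      have h6 := sub_nonneg.2 h1
      positivity
  refine ⟨hR, isSmoothFormOn_pairForm hβ (hN.comp (g := fun t => t⁻¹) fun x _ =>
    contDiffAt_id.inv (hpos x).ne'), fun x => ?_⟩
  have h3 := hpos x
  have h4 := hf0 _ h3
  refine (normSq_pairMetric (h := 1) (ha.symm x trivial) (ha.pos x trivial)
    (fun v w => pairMetric_apply x v w) (fun v => pairForm_apply x v) (hR.pos x trivial) ?_).trans ?_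
  · have hk' : k (normSq a β x) = normSq a β x - f (normSq a β x) := by
      linarith [hfk _ h3]
    rw [hk']
    field_simp
    ring
  · field_simp

include ha hβ hβ0 hf hk hf0 hfk in
-- The hypothesis `hrc` is the change-of-pair formula for `r_ij` with `X(b²) = 2 μ b²` inserted.
-- Solved for the unit pair it gives `θ_{i|j} = c (a₁ - θ⊗θ)`, and the equation for `s_ij` gives
-- that `θ` is closed.
theorem isDouglas_unitSquare_unitized (hfd : ∀ t, 0 < t → HasDerivAt f (f' t) t)
    (hkd : ∀ t, 0 < t → HasDerivAt k (k' t) t)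
    (hr : ∀ φ ∈ IsManifold.maximalAtlas (𝓡 n) ∞ M, ∀ p ∈ φ.target, ∀ j,
      ∑ i, chartDual φ a β p i * rTensor (metricComp φ a) (formComp φ β) p i j
        = μ (φ.symm p) * formComp φ β p j)
    (hs : SkewEqOn Set.univ a β)
    (hrc : REqOn Set.univ a β fun x A b _ i j =>
      c x * (A i j - b i * b j / normSq a β x) + μ x * normSq a β x *
        (f' (normSq a β x) * ((f (normSq a β x))⁻¹ * A i j
          - k (normSq a β x) / (f (normSq a β x) * normSq a β x ^ 2) * (b i * b j))
        + k' (normSq a β x) * ((normSq a β x ^ 2)⁻¹ * (b i * b j)))) :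
    IsDouglas (unitSquare (unitizedMetric f k a β) (unitizedForm a β)) := by
  have hU := isUnitPair_unitized ha hβ hβ0 hf hk hf0 hfk
  have hpos : ∀ x, 0 < normSq a β x := fun x =>
    normSq_pos (ha.symm x trivial) (ha.pos x trivial) (hβ0 x)
  have hN := isSmoothFunOn_normSq isOpen_univ ha hβ
  refine isDouglas_of_isConformalAt hU fun φ hφ p hp => ⟨c (φ.symm p), ?_⟩
  have hP := isPairAt_chart isOpen_univ ha hβ hφ hp trivial
  have hQ := hU.isPairAt hφ hp
  have hNe := normSq_chart_eventuallyEq (β := β) isOpen_univ ha hφ hp trivial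
  have h0 := hpos (φ.symm p)
  have h4 := hf0 _ h0
  have hcl : ∀ i j, sTensor (metricComp φ (unitizedMetric f k a β)) (formComp φ (unitizedForm a β))
      p i j = 0 := sTensor_eq_zero_of_skew hP hNe (hr φ hφ p hp) h0.ne' (hs φ hφ p hp trivial)
        hQ.symm (Filter.Eventually.of_forall fun q i => formComp_pairForm i)
  refine ⟨hcl, fun i j => ?_⟩
  have hmet : ∀ q i j, metricComp φ a q i j
      = f (normSq a β (φ.symm q)) * metricComp φ (unitizedMetric f k a β) q i j
        + k (normSq a β (φ.symm q)) * (formComp φ (unitizedForm a β) q i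
          * formComp φ (unitizedForm a β) q j) := by
    intro q i j
    have h3 := hpos (φ.symm q)
    have h4 := hf0 _ h3
    rw [unitizedMetric, metricComp_pairMetric, unitizedForm, formComp_pairForm, formComp_pairForm]
    field_simp
    ring
  have hform : ∀ q i, formComp φ β q i
      = normSq a β (φ.symm q) * formComp φ (unitizedForm a β) q i := by
    intro q i
    have h3 := hpos (φ.symm q)
    rw [unitizedForm, formComp_pairForm]
    field_simp
  have hdual : ∀ᶠ q in nhds p, normSq a β (φ.symm q)
      = 1 * (f (normSq a β (φ.symm q)) + k (normSq a β (φ.symm q))) :=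
    Filter.Eventually.of_forall fun q => by rw [one_mul, hfk _ (hpos _)]
  -- Since `f + k = b²`, both pairs have the same dual field, that is, `h = 1`.
  have hX : chartDual φ a β p = chartDual φ (unitizedMetric f k a β) (unitizedForm a β) p := by
    have h1 := dual_of_pairChange (h := fun _ => 1) hQ.dual (hU.eventually_unit hφ hp)
      (Filter.Eventually.of_forall hmet) (Filter.Eventually.of_forall hform) hdual
    have h2 := inv_mulVec_of_dual hP.pos h1
    simp only [one_mul] at h2
    exact h2
  have hNX := dirDeriv_normSq_of_contraction hP hNe (hr φ hφ p hp)
  have hpf := hasPartials_radial hN hφ hp trivial (hfd _ h0)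
  have hpk := hasPartials_radial hN hφ hp trivial (hkd _ h0)
  have key := rTensor_pairChange hQ.metric_diff hQ.field_diff hQ.symm hQ.pos hQ.dual
    (hU.eventually_unit hφ hp) hcl hpf.differentiableAt hpk.differentiableAt
    (HasPartials.const 1).differentiableAt (Filter.Eventually.of_forall hmet)
    (Filter.Eventually.of_forall hform) hdual hP.pos i j
  rw [dirDeriv_radial hN hφ hp trivial (hfd _ h0), dirDeriv_radial hN hφ hp trivial (hkd _ h0), ← hX,
    hNX, (HasPartials.const 1).partialDeriv_eq, (HasPartials.const 1).partialDeriv_eq,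
    hrc φ hφ p hp trivial i j] at key
  have e1 : metricComp φ (unitizedMetric f k a β) p i j = (f (normSq a β (φ.symm p)))⁻¹
      * metricComp φ a p i j - k (normSq a β (φ.symm p)) / (f (normSq a β (φ.symm p))
        * normSq a β (φ.symm p) ^ 2) * (formComp φ β p i * formComp φ β p j) := by
    rw [unitizedMetric, metricComp_pairMetric]
    ring
  have e2 : ∀ i, formComp φ (unitizedForm a β) p i = (normSq a β (φ.symm p))⁻¹ * formComp φ β p i :=
    fun i => formComp_pairForm i
  have hk' : k (normSq a β (φ.symm p)) = normSq a β (φ.symm p) - f (normSq a β (φ.symm p)) := by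
    linarith [hfk _ h0]
  -- The derivatives of `f` and `k` along `X` cancel against the corresponding terms of `hrc`.
  have key2 : f (normSq a β (φ.symm p)) * rTensor (metricComp φ (unitizedMetric f k a β))
      (formComp φ (unitizedForm a β)) p i j = c (φ.symm p) * (metricComp φ a p i j
        - formComp φ β p i * formComp φ β p j / normSq a β (φ.symm p)) := by
    rw [e1, e2, e2] at key
    linear_combination -key
  refine mul_left_cancel₀ h4.ne' (key2.trans ?_)
  rw [e1, e2, e2, hk']
  field_simp
  ring

end Unitization

/-! ### Pairs of form (i) or (ii) give Douglas metrics -/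

section Converse

variable {n : ℕ} {M : Type*} [TopologicalSpace M] [ChartedSpace (Coord n) M]
  {a a' : BilinField n M} {β β' : OneForm n M} {τ : M → ℝ} {U : Set M} {x : M} {ρ : ℝ → ℝ}

theorem bilin_eq_of_diag (h₁ : ∀ v w, a x v w = a x w v) (h₂ : ∀ v w, a' x v w = a' x w v)
    (h : ∀ v, a x v v = a' x v v) (v w : TangentSpace (𝓡 n) x) : a x v w = a' x v w := by
  have h3 := h (v + w)
  simp only [map_add, add_apply] at h3
  linarith [h v, h w, h₁ v w, h₂ v w]

theorem diag_nonneg (hpos : ∀ v, v ≠ 0 → 0 < a x v v) (v : TangentSpace (𝓡 n) x) :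
    0 ≤ a x v v := by
  by_cases hv : v = 0
  · simp [hv]
  · exact (hpos v hv).le

section Pointwise

variable (hsymm : ∀ v w, a x v w = a x w v) (hpos : ∀ v, v ≠ 0 → 0 < a x v v) (h0 : β x ≠ 0)

theorem smul_form_ne_zero {t : ℝ} (h0 : β x ≠ 0) (h : ∀ y, β x y = t * β' x y) : β' x ≠ 0 := by
  intro h1
  refine h0 (ContinuousLinearMap.ext fun y => ?_)
  rw [h, h1]
  simp

include h0 in
theorem IsCaseI.len_pos (h : IsCaseI U a β a' β' τ) (hx : x ∈ U) : 0 < len a' β' x :=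
  SingularSquare.len_pos (h.riemannian.symm x hx) (h.riemannian.pos x hx)
    (smul_form_ne_zero h0 (h.beta_eq x hx))

include h0 in
theorem IsCaseII.len_pos (h : IsCaseII U a β a' β' τ) (hx : x ∈ U) : 0 < len a' β' x :=
  SingularSquare.len_pos (h.riemannian.symm x hx) (h.riemannian.pos x hx)
    (smul_form_ne_zero h0 (h.beta_eq x hx))

include hsymm hpos h0 in
theorem IsCaseI.metric_eq (h : IsCaseI U a β a' β' τ) (hx : x ∈ U) (v w : TangentSpace (𝓡 n) x) :
    a x v w = 1 * a' x v w
      + (len a' β' x ^ (-8 : ℤ) - len a' β' x ^ (-2 : ℤ)) * (β' x v * β' x w) := by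
  have hB := h.len_pos h0 hx
  have hs' := h.riemannian.symm x hx
  have hp' := h.riemannian.pos x hx
  set κ := len a' β' x ^ (-8 : ℤ) - len a' β' x ^ (-2 : ℤ) with hκ
  have hdiag : ∀ y, a x y y = 1 * a' x y y + κ * (β' x y * β' x y) := by
    intro y
    have h1 := h.alpha_eq x hx y
    have h2 : alpha a' x y ^ 2 = a' x y y := Real.sq_sqrt (diag_nonneg hp' y)
    rw [h2, alpha, Real.sqrt_inj (diag_nonneg hpos y)] at h1
    · rw [h1]
      ring
    · have h3 := form_sq_le (β := β') hs' hp' y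
      rw [← len_sq hs' hp'] at h3
      -- The square root in case (i) determines the metric only if its radicand is nonnegative; this
      -- rewriting and Cauchy–Schwarz show that it is.
      have e : a' x y y + κ * β' x y ^ 2
          = (len a' β' x ^ 2)⁻¹ * (len a' β' x ^ 2 * a' x y y - β' x y * β' x y)
            + (len a' β' x ^ 8)⁻¹ * β' x y ^ 2 := by
        rw [hκ, zpow_neg, zpow_neg]
        norm_cast
        field_simp
        ring
      rw [← hκ, e]
      have h4 := sub_nonneg.2 h3
      positivity
  have key := bilin_eq_of_diag (a' := pairMetric (fun _ => 1) (fun _ => κ) a' β') hsymm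
    (fun v w => by rw [pairMetric_apply, pairMetric_apply, hs' v w, mul_comm (β' x v)])
    (fun y => by rw [pairMetric_apply, hdiag]) v w
  rwa [pairMetric_apply] at key

include hsymm hpos h0 in
-- The dual vector of `β` is `b̄³` times that of `β̄`, and `β = b̄⁻³ β̄`, so the factors cancel in
-- `b²`.
theorem IsCaseI.len_eq (h : IsCaseI U a β a' β' τ) (hx : x ∈ U) : len a' β' x = len a β x := by
  have hB := h.len_pos h0 hx
  have hs' := h.riemannian.symm x hx
  have hp' := h.riemannian.pos x hx
  have h1 := normSq_pairMetric (h := len a' β' x ^ 3) hs' hp' (h.metric_eq hsymm hpos h0 hx)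
    (h.beta_eq x hx) hpos (by
      rw [← len_sq hs' hp', zpow_neg, zpow_neg, zpow_neg]
      norm_cast
      field_simp
      ring)
  rw [len, len, h1, zpow_neg]
  norm_cast
  rw [inv_mul_cancel₀ (pow_pos hB 3).ne', one_mul]

include hsymm hpos h0 in
theorem IsCaseII.metric_eq (h : IsCaseII U a β a' β' τ) (hx : x ∈ U) (v w : TangentSpace (𝓡 n) x) :
    a x v w = (len a' β' x ^ 6)⁻¹ * a' x v w + 0 * (β' x v * β' x w) := by
  have hB := h.len_pos h0 hx
  have hs' := h.riemannian.symm x hx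
  have hp' := h.riemannian.pos x hx
  have key := bilin_eq_of_diag (a' := pairMetric (fun _ => (len a' β' x ^ 6)⁻¹) (fun _ => 0) a' β')
    hsymm (fun v w => by rw [pairMetric_apply, pairMetric_apply, hs' v w, mul_comm (β' x v)])
    (fun y => by
      have h1 := congrArg (· ^ 2) (h.alpha_eq x hx y)
      simp only [alpha, mul_pow, Real.sq_sqrt (diag_nonneg hpos y),
        Real.sq_sqrt (diag_nonneg hp' y)] at h1
      rw [pairMetric_apply, h1, zpow_neg]
      norm_cast
      field_simp
      ring) v w
  rwa [pairMetric_apply] at key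

include hsymm hpos h0 in
theorem IsCaseII.len_eq (h : IsCaseII U a β a' β' τ) (hx : x ∈ U) : len a' β' x = len a β x := by
  have hB := h.len_pos h0 hx
  have hs' := h.riemannian.symm x hx
  have hp' := h.riemannian.pos x hx
  have h1 := normSq_pairMetric (h := len a' β' x ^ 3) hs' hp' (h.metric_eq hsymm hpos h0 hx)
    (h.beta_eq x hx) hpos (by
      rw [zpow_neg]
      norm_cast
      field_simp
      ring)
  rw [len, len, h1, zpow_neg]
  norm_cast
  rw [inv_mul_cancel₀ (pow_pos hB 3).ne', one_mul]

include hsymm hpos h0 in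
theorem IsCaseI.singSquare_eq (h : IsCaseI U a β a' β' τ) (hx : x ∈ U) (y : TangentSpace (𝓡 n) x) :
    singSquare a β x y =
      (√(len a' β' x ^ 6 * (len a' β' x ^ 2 * alpha a' x y ^ 2 - β' x y ^ 2) + β' x y ^ 2)
          + β' x y) ^ 2 /
        (len a' β' x ^ 2 *
          √(len a' β' x ^ 6 * (len a' β' x ^ 2 * alpha a' x y ^ 2 - β' x y ^ 2) + β' x y ^ 2)) := by
  have hB := h.len_pos h0 hx
  have e : √(len a' β' x ^ 6 * (len a' β' x ^ 2 * alpha a' x y ^ 2 - β' x y ^ 2) + β' x y ^ 2)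
      = len a' β' x ^ 4 * alpha a x y := by
    rw [h.alpha_eq x hx, ← Real.sqrt_sq (pow_pos hB 4).le, ← Real.sqrt_mul (by positivity),
      zpow_neg, zpow_neg]
    congr 1
    norm_cast
    field_simp
    ring
  rw [e, singSquare, ← h.len_eq hsymm hpos h0 hx, h.beta_eq x hx, zpow_neg]
  by_cases h1 : alpha a x y = 0
  · simp [h1]
  · norm_cast
    field_simp

include hsymm hpos h0 in
theorem IsCaseII.singSquare_eq (h : IsCaseII U a β a' β' τ) (hx : x ∈ U)
    (y : TangentSpace (𝓡 n) x) :
    singSquare a β x y =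
      (len a' β' x * alpha a' x y + β' x y) ^ 2 / (len a' β' x ^ 3 * alpha a' x y) := by
  have hB := h.len_pos h0 hx
  rw [singSquare, ← h.len_eq hsymm hpos h0 hx, h.alpha_eq x hx, h.beta_eq x hx, zpow_neg]
  by_cases h1 : alpha a' x y = 0
  · simp [h1]
  · norm_cast
    field_simp

include hsymm in
theorem deformMetric_symm (v w : TangentSpace (𝓡 n) x) :
    deformMetric ρ a β x v w = deformMetric ρ a β x w v := by
  rw [deformMetric_apply, deformMetric_apply, hsymm v w]

include hpos in
theorem deformMetric_pos (v : TangentSpace (𝓡 n) x) (hv : v ≠ 0) :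
    0 < deformMetric ρ a β x v v := by
  rw [deformMetric_apply]
  exact mul_pos (Real.exp_pos _) (hpos v hv)

include h0 in
theorem deformForm_ne_zero : deformForm ρ a β x ≠ 0 :=
  smul_ne_zero (Real.exp_pos _).ne' h0

include hsymm hpos in
theorem len_deform : len (deformMetric ρ a β) (deformForm ρ a β) x
    = Real.exp (-(ρ (normSq a β x) / 2)) * len a β x := by
  have e1 : Real.exp (2 * ρ (normSq a β x)) = Real.exp (ρ (normSq a β x) / 2) ^ 4 := by
    rw [← Real.exp_nat_mul]
    congr 1
    push_cast
    ring
  have h1 := normSq_pairMetric (a' := deformMetric ρ a β) (β' := deformForm ρ a β)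
    (f := Real.exp (2 * ρ (normSq a β x))) (k := 0) (g := Real.exp (ρ (normSq a β x) / 2))
    (h := (Real.exp (ρ (normSq a β x) / 2) ^ 3)⁻¹) hsymm hpos
    (fun v w => by rw [deformMetric_apply, zero_mul, add_zero])
    (fun v => deformForm_apply ρ x v) (deformMetric_pos hpos) (by
      rw [e1]
      field_simp
      ring)
  rw [len, h1, Real.exp_neg, len,
    show Real.exp (ρ (normSq a β x) / 2) * (Real.exp (ρ (normSq a β x) / 2) ^ 3)⁻¹
      = ((Real.exp (ρ (normSq a β x) / 2))⁻¹) ^ 2 by field_simp,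
    Real.sqrt_mul (by positivity), Real.sqrt_sq (by positivity)]

include hsymm hpos in
-- Both `bα` and `β` acquire the factor `e^{ρ/2}`; its square cancels the factor `e^ρ` of the
-- denominator.
theorem singSquare_deform (y : TangentSpace (𝓡 n) x) :
    singSquare (deformMetric ρ a β) (deformForm ρ a β) x y = singSquare a β x y := by
  have e : alpha (deformMetric ρ a β) x y
      = Real.exp (ρ (normSq a β x) / 2) ^ 2 * alpha a x y := by
    rw [alpha, alpha, deformMetric_apply, show Real.exp (2 * ρ (normSq a β x))
      = (Real.exp (ρ (normSq a β x) / 2) ^ 2) ^ 2 by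
        rw [← pow_mul, ← Real.exp_nat_mul]
        congr 1
        push_cast
        ring, Real.sqrt_mul (by positivity), Real.sqrt_sq (by positivity)]
  rw [singSquare, singSquare, len_deform hsymm hpos, e, deformForm_apply, Real.exp_neg]
  by_cases h1 : alpha a x y = 0
  · simp [h1]
  · field_simp

end Pointwise

section Douglas

variable (hsymm : ∀ x v w, a x v w = a x w v) (hpos : ∀ x v, v ≠ 0 → 0 < a x v v)
  (h0 : ∀ x, β x ≠ 0)

/-- Contraction of a component of the metric with the dual vector field. -/
theorem IsPairAt.sum_dual {A : Coord n → Matrix (Fin n) (Fin n) ℝ} {b X : Coord n → Fin n → ℝ}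
    {p : Coord n} (h : IsPairAt A b X p) (j : Fin n) : ∑ i, X p i * A p i j = b p j := by
  rw [← h.dual.self_of_nhds, Matrix.mulVec, dotProduct]
  exact Finset.sum_congr rfl fun i _ => by rw [h.symm.self_of_nhds i j, mul_comm]

include hsymm hpos h0 in
theorem IsCaseI.isDouglas (h : IsCaseI Set.univ a β a' β' τ) : IsDouglas (singSquare a β) := by
  have hB : ∀ x, 0 < len a' β' x := fun x => h.len_pos (h0 x) trivial
  have hsq : ∀ x, len a' β' x ^ 2 = normSq a' β' x := fun x =>
    len_sq (h.riemannian.symm x trivial) (h.riemannian.pos x trivial)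
  have hN : ∀ x, 0 < normSq a' β' x := fun x => by rw [← hsq]; exact pow_pos (hB x) 2
  have hd : ∀ t : ℝ, 0 < t → HasDerivAt (fun t : ℝ => (t ^ 2)⁻¹) (-2 * (t ^ 3)⁻¹) t := fun t ht => by
    refine ((hasDerivAt_pow 2 t).inv (pow_pos ht 2).ne').congr_deriv ?_
    field_simp
    push_cast
    ring
  -- Normalizing case (i) gives `b̄⁴ ᾱ² + (b̄⁻⁴ - b̄²) β̄²` and `b̄⁻² β̄`; in `t = b̄²` this is `f =
  -- t⁻²`, `k = t - t⁻²`. Contracting `r̄ = τ̄ ā` with the dual field gives `μ = τ̄`, and the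
  -- conformal factor is `3 τ̄`.
  have key := isDouglas_unitSquare_unitized (f := fun t => (t ^ 2)⁻¹)
    (k := fun t => t - (t ^ 2)⁻¹) (f' := fun t => -2 * (t ^ 3)⁻¹)
    (k' := fun t => 1 - -2 * (t ^ 3)⁻¹) (μ := τ) (c := fun x => 3 * τ x) h.riemannian h.smooth
    (fun x => smul_form_ne_zero (h0 x) (h.beta_eq x trivial)) (fun t ht => contDiffAt_pow_inv ht)
    (fun t ht => contDiffAt_id.sub (contDiffAt_pow_inv ht)) (fun t ht => by positivity)
    (fun t _ => by ring) hd (fun t ht => (hasDerivAt_id t).sub (hd t ht))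
    (fun φ hφ p hp j => by
      have hP := isPairAt_chart isOpen_univ h.riemannian h.smooth hφ hp trivial
      rw [← hP.sum_dual, Finset.mul_sum]
      refine Finset.sum_congr rfl fun i _ => ?_
      rw [h.r_eq φ hφ p hp trivial]
      ring) h.s_eq (fun φ hφ p hp _ i j => by
      have := hN (φ.symm p)
      rw [h.r_eq φ hφ p hp trivial]
      field_simp
      ring)
  convert key using 1
  funext x y
  have h1 := hB x
  have hl := h.len_eq (hsymm x) (hpos x) (h0 x) trivial
  refine singSquare_eq_unitSquare (hl ▸ h1) ?_ ?_
  · rw [← hl, h.metric_eq (hsymm x) (hpos x) (h0 x) trivial, unitizedMetric, pairMetric_apply,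
      ← hsq, zpow_neg, zpow_neg]
    norm_cast
    field_simp
    ring
  · rw [← hl, h.beta_eq x trivial, unitizedForm, pairForm_apply, ← hsq, zpow_neg]
    norm_cast
    field_simp

include hsymm hpos h0 in
theorem IsCaseII.isDouglas (h : IsCaseII Set.univ a β a' β' τ) : IsDouglas (singSquare a β) := by
  have hB : ∀ x, 0 < len a' β' x := fun x => h.len_pos (h0 x) trivial
  have hsq : ∀ x, len a' β' x ^ 2 = normSq a' β' x := fun x =>
    len_sq (h.riemannian.symm x trivial) (h.riemannian.pos x trivial)
  have hN : ∀ x, 0 < normSq a' β' x := fun x => by rw [← hsq]; exact pow_pos (hB x) 2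
  -- Normalizing case (ii) gives `b̄⁻² ᾱ²` and `b̄⁻² β̄`, so `f = t` and `k = 0`. The tensor `b̄² ā
  -- - b̄⊗b̄` annihilates the dual field, whence `μ = 0`.
  have key := isDouglas_unitSquare_unitized (f := fun t => t) (k := fun _ => 0) (f' := fun _ => 1)
    (k' := fun _ => 0) (μ := fun _ => 0) (c := fun x => τ x * normSq a' β' x) h.riemannian h.smooth
    (fun x => smul_form_ne_zero (h0 x) (h.beta_eq x trivial)) (fun t _ => contDiffAt_id)
    (fun t _ => contDiffAt_const) (fun t ht => ht) (fun t _ => add_zero t)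
    (fun t _ => hasDerivAt_id t) (fun t _ => hasDerivAt_const t 0)
    (fun φ hφ p hp j => by
      have hP := isPairAt_chart isOpen_univ h.riemannian h.smooth hφ hp trivial
      have hNp : normSq a' β' (φ.symm p)
          = ∑ i, formComp φ β' p i * chartDual φ a' β' p i :=
        (normSq_chart_eventuallyEq (β := β') isOpen_univ h.riemannian hφ hp trivial).self_of_nhds
      have e : ∑ i, chartDual φ a' β' p i * rTensor (metricComp φ a') (formComp φ β') p i j
          = τ (φ.symm p) * (normSq a' β' (φ.symm p)
              * ∑ i, chartDual φ a' β' p i * metricComp φ a' p i j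
            - (∑ i, formComp φ β' p i * chartDual φ a' β' p i) * formComp φ β' p j) := by
        simp only [h.r_eq φ hφ p hp trivial, Finset.mul_sum, Finset.sum_mul,
          ← Finset.sum_sub_distrib]
        exact Finset.sum_congr rfl fun i _ => by ring
      rw [e, hP.sum_dual, ← hNp]
      ring) h.s_eq (fun φ hφ p hp _ i j => by
      have := hN (φ.symm p)
      rw [h.r_eq φ hφ p hp trivial]
      field_simp
      ring)
  convert key using 1
  funext x y
  have h1 := hB x
  have hl := h.len_eq (hsymm x) (hpos x) (h0 x) trivial
  refine singSquare_eq_unitSquare (hl ▸ h1) ?_ ?_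
  · rw [← hl, h.metric_eq (hsymm x) (hpos x) (h0 x) trivial, unitizedMetric, pairMetric_apply,
      ← hsq]
    field_simp
    ring
  · rw [← hl, h.beta_eq x trivial, unitizedForm, pairForm_apply, ← hsq, zpow_neg]
    norm_cast
    field_simp

end Douglas

end Converse

end SingularSquare

end

/-! ### The main theorem -/

open SingularSquare in
theorem theorem1p2 {n : ℕ} (hn : 3 ≤ n) {M : Type*} [TopologicalSpace M]
    [ChartedSpace (Coord n) M] [IsManifold (𝓡 n) ∞ M]
    (a : BilinField n M) (β : OneForm n M)
    (ha : IsRiemannianOn Set.univ a) (hβ : IsSmoothFormOn Set.univ β) (hβ0 : ∀ x, β x ≠ 0)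
    (hratio : ∀ c d : M → ℝ, StructureEqOn Set.univ a β c d → SkewEqOn Set.univ a β →
      RatioDependsOnlyOnLen a β c d) :
    -- the characterization
    (IsDouglas (singSquare a β) ↔
      ReducesToCaseI Set.univ a β ∨ ReducesToCaseII Set.univ a β) ∧
    -- which of the two cases occurs
    (IsDouglas (singSquare a β) → ∃ c d : M → ℝ,
      StructureEqOn Set.univ a β c d ∧ SkewEqOn Set.univ a β ∧
      IsOpen {x | c x + normSq a β x * d x ≠ 0} ∧
      ReducesToCaseI {x | c x + normSq a β x * d x ≠ 0} a β ∧
      ∃ a' β' τ, IsCaseII (interior {x | c x + normSq a β x * d x = 0}) a β a' β' τ) ∧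
    -- the length and the expression of `F` in case (i)
    (∀ (U : Set M) (ρ : ℝ → ℝ) (a' : BilinField n M) (β' : OneForm n M) (τ : M → ℝ),
      IsCaseI U (deformMetric ρ a β) (deformForm ρ a β) a' β' τ → ∀ x ∈ U,
        len a' β' x = len (deformMetric ρ a β) (deformForm ρ a β) x ∧
        ∀ y, singSquare a β x y =
          (√(len a' β' x ^ 6 * (len a' β' x ^ 2 * alpha a' x y ^ 2 - β' x y ^ 2) + β' x y ^ 2)
              + β' x y) ^ 2 /
            (len a' β' x ^ 2 *
              √(len a' β' x ^ 6 * (len a' β' x ^ 2 * alpha a' x y ^ 2 - β' x y ^ 2)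
                + β' x y ^ 2))) ∧
    -- the length and the expression of `F` in case (ii)
    (∀ (U : Set M) (ρ : ℝ → ℝ) (a' : BilinField n M) (β' : OneForm n M) (τ : M → ℝ),
      IsCaseII U (deformMetric ρ a β) (deformForm ρ a β) a' β' τ → ∀ x ∈ U,
        len a' β' x = len (deformMetric ρ a β) (deformForm ρ a β) x ∧
        ∀ y, singSquare a β x y =
          (len a' β' x * alpha a' x y + β' x y) ^ 2 / (len a' β' x ^ 3 * alpha a' x y)) := by
  have hdm : ∀ (ρ : ℝ → ℝ) x v w, deformMetric ρ a β x v w = deformMetric ρ a β x w v :=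
    fun ρ x => deformMetric_symm (ha.symm x trivial)
  have hdp : ∀ (ρ : ℝ → ℝ) x v, v ≠ 0 → 0 < deformMetric ρ a β x v v :=
    fun ρ x => deformMetric_pos (ha.pos x trivial)
  have hd0 : ∀ (ρ : ℝ → ℝ) x, deformForm ρ a β x ≠ 0 := fun ρ x => deformForm_ne_zero (hβ0 x)
  have hinv : ∀ ρ : ℝ → ℝ, singSquare (deformMetric ρ a β) (deformForm ρ a β) = singSquare a β :=
    fun ρ => funext fun x => funext fun y => singSquare_deform (ha.symm x trivial) (ha.pos x trivial) y
  have hU := isUnitPair_norm ha hβ hβ0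
  have hpair : IsDouglas (singSquare a β) →
      ∃ c, IsConformalPair (normMetric a β) (normForm a β) c ∧ IsSmoothFunOn (n := n) Set.univ c := by
    intro hD
    rw [singSquare_eq_norm ha hβ0] at hD
    obtain ⟨c, hc⟩ := exists_isConformalAt_global (by omega) hU hD
    exact ⟨c, ⟨hU, hc⟩, isSmoothFunOn_conformal_factor (by omega) hU hc⟩
  refine ⟨⟨fun hD => ?_, ?_⟩, fun hD => ?_, fun U ρ a' β' τ h x hx => ?_,
    fun U ρ a' β' τ h x hx => ?_⟩
  -- On the whole of `M` the reduction to (ii) by the unit pair is always available.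
  · obtain ⟨c, H, -⟩ := hpair hD
    exact Or.inr (reducesToCaseII_univ ha hβ0 H)
  · rintro (⟨ρ, -, a', β', τ, h⟩ | ⟨ρ, -, a', β', τ, h⟩)
    · rw [← hinv ρ]
      exact h.isDouglas (hdm ρ) (hdp ρ) (hd0 ρ)
    · rw [← hinv ρ]
      exact h.isDouglas (hdm ρ) (hdp ρ) (hd0 ρ)
  · obtain ⟨c, H, hc⟩ := hpair hD
    have hb : ∀ x, 0 < len a β x := fun x => len_pos (ha.symm x trivial) (ha.pos x trivial) (hβ0 x)
    have hb2 : ∀ x, len a β x ^ 2 = normSq a β x := fun x =>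
      len_sq (ha.symm x trivial) (ha.pos x trivial)
    have hS := structureEqOn_univ ha hβ hβ0 H
    have hK := skewEqOn_univ ha hβ hβ0 H
    have hrat := hratio _ _ hS hK
    set D := fieldDeriv (normMetric a β) (normForm a β) (len a β) with hD'
    have hDs : IsSmoothFunOn (n := n) Set.univ D :=
      isSmoothFunOn_fieldDeriv hU.riemannian hU.smooth (isSmoothFunOn_len ha hβ hβ0)
    -- This is `c + b² d = b² X(b)`: the two regions of the theorem are given by the vanishing or
    -- not of `X(b)`.
    have he : ∀ x, len a β x ^ 3 * c x - 2 * len a β x ^ 2 * D x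
        + normSq a β x * (3 * D x - len a β x * c x) = len a β x ^ 2 * D x := fun x => by
      rw [← hb2]
      ring
    have hz : ∀ x, len a β x ^ 2 * D x = 0 ↔ D x = 0 := fun x => by
      simp [(hb x).ne']
    refine ⟨_, _, hS, hK, ?_⟩
    simp only [he, hz, ne_eq]
    refine ⟨isOpen_ne_zero hDs, reducesToCaseI_of_fieldDeriv_ne_zero ha hβ hβ0 H hc
      fun x y hxy => ?_, isCaseII_of_fieldDeriv_eq_zero ha hβ hβ0 H isOpen_interior
        fun x hx => (interior_subset hx : x ∈ {x | D x = 0})⟩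
    -- At points with equal `b`, the cross products of the ratio condition differ by `b³` times
    -- those of the conformal factor with `X(b)`.
    have h1 := hrat x y hxy
    have h2 := hb y
    beta_reduce at h1
    rw [hxy] at h1
    have h3 : len a β y ^ 3 ≠ 0 := by positivity
    exact mul_left_cancel₀ h3 (by linear_combination h1)
  · exact ⟨h.len_eq (hdm ρ x) (hdp ρ x) (hd0 ρ x) hx, fun y => by
      rw [← hinv ρ]
      exact h.singSquare_eq (hdm ρ x) (hdp ρ x) (hd0 ρ x) hx y⟩
  · exact ⟨h.len_eq (hdm ρ x) (hdp ρ x) (hd0 ρ x) hx, fun y => by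
      rw [← hinv ρ]
      exact h.singSquare_eq (hdm ρ x) (hdp ρ x) (hd0 ρ x) hx y⟩
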